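/- Conventions. For $w\in L^2(\mathbb R)$ let $(4-\partial_x^2)^{-1}w=\tfrac14 e^{-2|\cdot|}*w$, and put $$\|w\|_{\mathcal H}=\sqrt{E(w)},\qquad E(w)=\int_{\mathbb R}\bigl(4v^2+5v_x^2+v_{xx}^2\bigr)\,dx,\qquad v=(4-\partial_x^2)^{-1}w .$$ For $c>0$ let $\varphi_c(x)=c\,e^{-|x|}$. For $0<T\le+\infty$ let $\mathcal X([0,T[)$ be the set of all $u\in C([0,T[;H^1(\mathbb R))\cap L^\infty(]0,T[;W^{1,1}(\mathbb R))$ with $u_x\in L^\infty(]0,T[;BV(\mathbb R))$. A function $u\in\mathcal X([0,T[)$ is a solution of the Degasperis–Procesi (DP) equation if it is a weak solution of $$u_t+\tfrac12\partial_x(u^2)+\tfrac32(1-\partial_x^2)^{-1}\partial_x(u^2)=0,\qquad (1-\partial_x^2)^{-1}f=\tfrac12e^{-|\cdot|}*f,$$ with initial value $u_0=u(0)$, that is, for every $\phi\in C_c^\infty(]-\infty,T[\times\mathbb R)$, $$\int_0^T\!\!\int_{\mathbb R}\Bigl(u\,\phi_t+\tfrac12u^2\phi_x+\tfrac32\bigl((1-\partial_x^2)^{-1}u^2\bigr)\phi_x\Bigr)dx\,dt+\int_{\mathbb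 R}u_0(x)\phi(0,x)\,dx=0 .$$ Theorem 3.1 (Stability of Peakons). Let $c>0$. There exist $C>0$ and $\varepsilon_0>0$, depending only on $c$, such that the following holds for every $0<T\le+\infty$ and every solution $u\in\mathcal X([0,T[)$ of the DP equation. If $(1-\partial_x^2)u_0$ (in the sense of distributions) is a nonnegative Radon measure on $\mathbb R$ and $$\|u_0-\varphi_c\|_{\mathcal H}\le\varepsilon^2\quad\text{for some }0<\varepsilon<\varepsilon_0,$$ then for every $t\in[0,T[$ the function $v(t,\cdot)=(4-\partial_x^2)^{-1}u(t,\cdot)$ attains its maximum over $\mathbb R$, and for every point $\xi_1(t)\in\mathbb R$ at which it does so, $$\|u(t,\cdot)-\varphi_c(\cdot-\xi_1(t))\|_{\mathcal H}\le C\sqrt{\varepsilon}.$$ -/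

import Mathlib

open MeasureTheory Filter Topology
open scoped ContDiff ENNReal

noncomputable section

namespace DP

/-- A smooth compactly supported real test function on the line. -/
def IsTest (ψ : ℝ → ℝ) : Prop := ContDiff ℝ ∞ ψ ∧ HasCompactSupport ψ

/-- `g` is the weak (distributional) derivative of `f` on the line. -/
def HasWeakDeriv (f g : ℝ → ℝ) : Prop :=
  LocallyIntegrable f ∧ LocallyIntegrable g ∧
    ∀ ψ : ℝ → ℝ, IsTest ψ → ∫ x, f x * deriv ψ x = -∫ x, g x * ψ x

/-- `(k² - ∂ₓ²)⁻¹ f` for `k > 0`, i.e. the convolution of `f` with the fundamental solution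
`exp (-k |x|) / (2 k)` of `k² - ∂ₓ²`. -/
def invHelmholtz (k : ℝ) (f : ℝ → ℝ) (x : ℝ) : ℝ :=
  ∫ z, Real.exp (-k * |x - z|) / (2 * k) * f z

/-- The energy `E(f) = ∫ (4 v² + 5 vₓ² + vₓₓ²)` with `v = (4 - ∂ₓ²)⁻¹ f`. For `f` in `L²` the
function `v` is `C¹` and `vₓ` is locally absolutely continuous, so `deriv` is the true derivative
of `v` everywhere and of `vₓ` almost everywhere. -/
def energy (f : ℝ → ℝ) : ℝ :=
  ∫ x, (4 * invHelmholtz 2 f x ^ 2 + 5 * deriv (invHelmholtz 2 f) x ^ 2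
    + deriv (deriv (invHelmholtz 2 f)) x ^ 2)

/-- The energy norm `‖f‖_𝓗 = √E(f)`. -/
def energyNorm (f : ℝ → ℝ) : ℝ := Real.sqrt (energy f)

/-- The peakon profile `φ_c(x) = c exp (-|x|)`. -/
def peakon (c x : ℝ) : ℝ := c * Real.exp (-|x|)

/-- The time interval `[0, T[`, where `T` may be `+∞`. -/
def timeInterval (T : EReal) : Set ℝ := {t | 0 ≤ t ∧ (t : EReal) < T}

/-- `(1 - ∂ₓ²) f`, in the sense of distributions, is a nonnegative Radon measure on the line. -/
def IsNonnegMomentum (f : ℝ → ℝ) : Prop :=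
  ∃ μ : Measure ℝ, IsLocallyFiniteMeasure μ ∧
    ∀ ψ : ℝ → ℝ, IsTest ψ → ∫ x, f x * (ψ x - deriv (deriv ψ) x) = ∫ x, ψ x ∂μ

/-- `u ∈ 𝒳([0, T[)`: `u ∈ C([0, T[; H¹) ∩ L^∞([0, T[; W^{1,1})` and `uₓ ∈ L^∞([0, T[; BV)`.
Here `u t` is any representative of its class, and `ux t` is the weak derivative of `u t`. -/
def MemX (T : EReal) (u : ℝ → ℝ → ℝ) : Prop :=
  ∃ ux : ℝ → ℝ → ℝ,
    (∀ t ∈ timeInterval T,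
      MemLp (u t) 2 volume ∧ MemLp (ux t) 2 volume ∧ HasWeakDeriv (u t) (ux t)) ∧
    (∀ t ∈ timeInterval T,
      Tendsto (fun s => eLpNorm (u s - u t) 2 volume + eLpNorm (ux s - ux t) 2 volume)
        (𝓝[timeInterval T] t) (𝓝 0)) ∧
    ∃ M : ℝ≥0∞, M < ⊤ ∧ ∀ᵐ t ∂(volume.restrict (timeInterval T)),
      eLpNorm (u t) 1 volume ≤ M ∧ eLpNorm (ux t) 1 volume ≤ M ∧
        ∃ g : ℝ → ℝ, g =ᵐ[volume] ux t ∧ eVariationOn g Set.univ ≤ M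

/-- `u` is a weak solution on `[0, T[`, with initial value `u 0`, of the Degasperis–Procesi
equation in conservation form `u_t + ½ ∂ₓ(u²) + (3/2) (1 - ∂ₓ²)⁻¹ ∂ₓ(u²) = 0`. The test functions
are smooth with compact support in `]-∞, T[ × ℝ`, so they need not vanish at time `0`. -/
def IsWeakSolution (T : EReal) (u : ℝ → ℝ → ℝ) : Prop :=
  ∀ φ : ℝ × ℝ → ℝ, ContDiff ℝ ∞ φ → HasCompactSupport φ →
    (∀ p ∈ tsupport φ, (p.1 : EReal) < T) →
    (∫ t in timeInterval T, ∫ x,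
        (u t x * deriv (fun s => φ (s, x)) t
          + 1 / 2 * u t x ^ 2 * deriv (fun z => φ (t, z)) x
          + 3 / 2 * invHelmholtz 1 (fun z => u t z ^ 2) x * deriv (fun z => φ (t, z)) x))
      + ∫ x, u 0 x * φ (0, x) = 0

end DP

end

/-!
# Stability of peakons for the Degasperis–Procesi equation

The equation is `u_t = -A (u uₓ)` with `A = (4 - ∂ₓ²)(1 - ∂ₓ²)⁻¹` (`fluxOp`), and the energy is the
quadratic form of `A⁻¹ = (1 - ∂ₓ²)(4 - ∂ₓ²)⁻¹` (`energyOp`), which is equivalent to the square of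
the `L²` norm. Therefore the energy `E` and the cubic `F = ∫ u³` are conserved
(`IsStrongSolution.energy_eq`, `IsStrongSolution.integral_cube_eq`).

*Static part.* Let `0 ≤ u ≤ 6 v` with `v = (4 - ∂ₓ²)⁻¹ u`, and let `M` be the maximum of `v`. Then
`72 M³ + F ≤ 18 M E` (`cubic_inequality`), with equality for peakons. If `E` and `F` are within
`O(ε²)` of their values at the peakon of speed `c`, this forces `|M - c / 6| = O(ε)`. Moreover
`E(u - φ_c(· - ξ)) = E(u) + c² / 3 - 4 c v(ξ)` for every `ξ` (`energy_sub_peakon`), since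
pairing with a peakon in the energy space evaluates `v`. Hence the squared distance to the peakon
at a maximum point is `O(ε)` (`static_stability`).

*Propagation of the sign.* It remains to see that `0 ≤ u ≤ 6 v` holds at all times if
`(1 - ∂ₓ²) u₀` is a nonnegative measure. These inequalities define a closed convex cone in `L²` that
contains every peakon of positive momentum. A hyperplane separation argument shows that `u₀` is an
`L²` limit of multipeakons with positive momenta (`IsNonnegMomentum.toL2_mem_closure`). The
positions and momenta of such a multipeakon solve a system of ordinary differential equations for
all times, without collisions (`exists_multipeakon`), and the multipeakon is then a solution
(`isStrongSolution_multipeakon`). Finally the energy of the difference of two solutions grows at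
most exponentially, with a rate governed by the Lipschitz constant of only one of them
(`IsStrongSolution.energy_sub_le`), so `u(t)` is a limit of multipeakons with positive momenta
(`IsStrongSolution.nonneg_and_le`).

A weak solution in the class `𝒳` has, after a choice of continuous representatives, a strong time
derivative in `L²` and a Lipschitz bound in space, uniformly in time (`exists_isStrongSolution`).
-/

namespace DP

/-- `F` is an indefinite integral of `f`: the locally absolutely continuous functions `F` with
a chosen representative `f` of their derivative. -/
structure IsPrimitive (F f : ℝ → ℝ) : Prop where
  locInt : LocallyIntegrable f
  ftc : ∀ a b, F b - F a = ∫ x in a..b, f x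

namespace IsPrimitive

variable {F G f g : ℝ → ℝ}

lemma intervalIntegrable (h : IsPrimitive F f) (a b : ℝ) : IntervalIntegrable f volume a b :=
  intervalIntegrable_iff.mpr <|
    (h.locInt.integrableOn_isCompact isCompact_uIcc).mono_set Set.uIoc_subset_uIcc

lemma eq_integral (h : IsPrimitive F f) (a : ℝ) : F = fun x => F a + ∫ t in a..x, f t := by
  funext x
  rw [← h.ftc a x]; ring

lemma ae_hasDerivAt (h : IsPrimitive F f) : ∀ᵐ x, HasDerivAt F (f x) x := by
  filter_upwards [LocallyIntegrable.ae_hasDerivAt_integral h.locInt] with x hx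
  rw [h.eq_integral 0]
  exact (hx 0).const_add _

lemma absolutelyContinuous (h : IsPrimitive F f) (a b : ℝ) :
    AbsolutelyContinuousOnInterval F a b := by
  have h1 := (h.intervalIntegrable a b).absolutelyContinuousOnInterval_intervalIntegral
    (c := a) (by simp)
  have h2 : AbsolutelyContinuousOnInterval (fun _ : ℝ => F a) a b :=
    (LipschitzWith.const (F a)).lipschitzOnWith.absolutelyContinuousOnInterval
  rw [h.eq_integral a]
  exact h2.add h1

lemma continuous (h : IsPrimitive F f) : Continuous F := by
  rw [h.eq_integral 0]
  exact continuous_const.add (intervalIntegral.continuous_primitive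
      (fun a b => h.intervalIntegrable a b) 0)

lemma hasDerivAt (h : IsPrimitive F f) (hf : Continuous f) (x : ℝ) : HasDerivAt F (f x) x := by
  rw [h.eq_integral 0]
  exact (hf.integral_hasStrictDerivAt 0 x).hasDerivAt.const_add _

lemma of_hasDerivAt (h : ∀ x, HasDerivAt F (f x) x) (hf : Continuous f) : IsPrimitive F f :=
  ⟨hf.locallyIntegrable, fun a b =>
    (intervalIntegral.integral_eq_sub_of_hasDerivAt (fun x _ => h x)
        (hf.intervalIntegrable a b)).symm⟩

lemma congr (h : IsPrimitive F f) (hfg : f =ᵐ[volume] g) : IsPrimitive F g :=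
  ⟨h.locInt.congr hfg, fun a b => by
    rw [h.ftc a b]
    exact intervalIntegral.integral_congr_ae (hfg.mono fun x hx _ => hx)⟩

lemma const_mul (h : IsPrimitive F f) (c : ℝ) :
    IsPrimitive (fun x => c * F x) (fun x => c * f x) :=
  ⟨h.locInt.smul c, fun a b => by
    rw [intervalIntegral.integral_const_mul, ← h.ftc a b]; ring⟩

lemma add (hF : IsPrimitive F f) (hG : IsPrimitive G g) :
    IsPrimitive (fun x => F x + G x) (fun x => f x + g x) :=
  ⟨hF.locInt.add hG.locInt, fun a b => by
    rw [intervalIntegral.integral_add (hF.intervalIntegrable a b) (hG.intervalIntegrable a b),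
      ← hF.ftc a b, ← hG.ftc a b]; ring⟩

lemma sub (hF : IsPrimitive F f) (hG : IsPrimitive G g) :
    IsPrimitive (fun x => F x - G x) (fun x => f x - g x) := by
  simpa [sub_eq_add_neg] using hF.add (hG.const_mul (-1))

lemma mul (hF : IsPrimitive F f) (hG : IsPrimitive G g) :
    IsPrimitive (fun x => F x * G x) (fun x => f x * G x + F x * g x) := by
  have hl : LocallyIntegrable (fun x => f x * G x + F x * g x) := by
    refine LocallyIntegrable.add ?_ ?_
    · exact (locallyIntegrableOn_univ.mp
        ((locallyIntegrableOn_univ.mpr hF.locInt).mul_continuousOn hG.continuous.continuousOn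
          isOpen_univ.isLocallyClosed))
    · exact (locallyIntegrableOn_univ.mp
        ((locallyIntegrableOn_univ.mpr hG.locInt).continuousOn_mul hF.continuous.continuousOn
          isOpen_univ.isLocallyClosed))
  refine ⟨hl, fun a b => ?_⟩
  have h := ((hF.absolutelyContinuous a b).mul (hG.absolutelyContinuous a b)).integral_deriv_eq_sub
  have h' : ∫ x in a..b, deriv (F * G) x = F b * G b - F a * G a := h
  rw [← h']
  refine intervalIntegral.integral_congr_ae ?_
  filter_upwards [hF.ae_hasDerivAt, hG.ae_hasDerivAt] with x h1 h2 _
  rw [(h1.mul h2).deriv]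

/-- An integrable function with integrable derivative vanishes at both ends of the line. -/
lemma tendsto_zero (h : IsPrimitive F f) (hF : Integrable F) (hf : Integrable f) :
    Tendsto F atTop (𝓝 0) ∧ Tendsto F atBot (𝓝 0) := by
  have htop : Tendsto F atTop (𝓝 (F 0 + ∫ x in Set.Ioi 0, f x)) := by
    have := (intervalIntegral_tendsto_integral_Ioi 0 hf.integrableOn tendsto_id).const_add (F 0)
    rw [h.eq_integral 0]
    simpa using this
  have hbot : Tendsto F atBot (𝓝 (F 0 - ∫ x in Set.Iic 0, f x)) := by
    have := (intervalIntegral_tendsto_integral_Iic 0 hf.integrableOn tendsto_id).const_sub (F 0)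
    refine this.congr fun x => ?_
    rw [id, ← h.ftc x 0]; ring
  have h1 := (hF.integrableAtFilter atTop).eq_zero_of_tendsto (μ := volume) (by
    intro s hs
    obtain ⟨a, ha⟩ := mem_atTop_sets.mp hs
    rw [← top_le_iff, ← Real.volume_Ioi (a := a)]
    exact measure_mono fun x hx => ha x (le_of_lt hx)) htop
  have h2 := (hF.integrableAtFilter atBot).eq_zero_of_tendsto (μ := volume) (by
    intro s hs
    obtain ⟨a, ha⟩ := mem_atBot_sets.mp hs
    rw [← top_le_iff, ← Real.volume_Iio (a := a)]
    exact measure_mono fun x hx => ha x (le_of_lt hx)) hbot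
  exact ⟨h1 ▸ htop, h2 ▸ hbot⟩

lemma integral_eq_zero (h : IsPrimitive F f) (hF : Integrable F) (hf : Integrable f) :
    ∫ x, f x = 0 := by
  obtain ⟨h1, h2⟩ := h.tendsto_zero hF hf
  have h3 := intervalIntegral_tendsto_integral hf tendsto_neg_atTop_atBot tendsto_id
  have h4 : Tendsto (fun x : ℝ => ∫ t in (-x)..x, f t) atTop (𝓝 (0 - 0)) := by
    have := h1.sub (h2.comp tendsto_neg_atTop_atBot)
    refine this.congr fun x => ?_
    simp [h.ftc]
  simpa using tendsto_nhds_unique h3 h4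

end IsPrimitive

/-- `f` is the continuous representative of an element of `H¹(ℝ)` and `f'` represents its weak
derivative. -/
structure IsH1 (f f' : ℝ → ℝ) : Prop extends IsPrimitive f f' where
  memLp : MemLp f 2 volume
  memLp' : MemLp f' 2 volume

lemma integrable_mul {f g : ℝ → ℝ} (hf : MemLp f 2 volume) (hg : MemLp g 2 volume) :
    Integrable (fun x => f x * g x) :=
  hf.integrable_mul hg

lemma memLp_mul_of_bdd {f g : ℝ → ℝ} (hf : Continuous f) {C : ℝ} (hC : ∀ x, |f x| ≤ C)
    (hg : MemLp g 2 volume) : MemLp (fun x => f x * g x) 2 volume :=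
  hg.of_le_mul (c := C) (hf.aestronglyMeasurable.mul hg.1)
    (Eventually.of_forall fun x => by
      rw [norm_mul]; exact mul_le_mul_of_nonneg_right (hC x) (norm_nonneg _))

namespace IsH1

variable {f f' g g' : ℝ → ℝ}

lemma of_memLp (h : ∀ a b, f b - f a = ∫ x in a..b, f' x) (hf : MemLp f 2 volume)
    (hf' : MemLp f' 2 volume) : IsH1 f f' :=
  ⟨⟨hf'.locallyIntegrable (by norm_num), h⟩, hf, hf'⟩

lemma congr (h : IsH1 f f') (hfg : f' =ᵐ[volume] g') : IsH1 f g' :=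
  ⟨h.toIsPrimitive.congr hfg, h.memLp, h.memLp'.ae_eq hfg⟩

lemma const_mul (h : IsH1 f f') (c : ℝ) : IsH1 (fun x => c * f x) (fun x => c * f' x) :=
  ⟨h.toIsPrimitive.const_mul c, h.memLp.const_mul c, h.memLp'.const_mul c⟩

lemma add (hf : IsH1 f f') (hg : IsH1 g g') :
    IsH1 (fun x => f x + g x) (fun x => f' x + g' x) :=
  ⟨hf.toIsPrimitive.add hg.toIsPrimitive, hf.memLp.add hg.memLp, hf.memLp'.add hg.memLp'⟩

lemma sub (hf : IsH1 f f') (hg : IsH1 g g') :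
    IsH1 (fun x => f x - g x) (fun x => f' x - g' x) :=
  ⟨hf.toIsPrimitive.sub hg.toIsPrimitive, hf.memLp.sub hg.memLp, hf.memLp'.sub hg.memLp'⟩

lemma zero : IsH1 (fun _ => 0) (fun _ => 0) :=
  of_memLp (by simp) MemLp.zero' MemLp.zero'

lemma sum {ι : Type*} (s : Finset ι) {f f' : ι → ℝ → ℝ} (h : ∀ i ∈ s, IsH1 (f i) (f' i)) :
    IsH1 (fun x => ∑ i ∈ s, f i x) (fun x => ∑ i ∈ s, f' i x) := by
  classical
  induction s using Finset.induction_on with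
  | empty => simpa using zero
  | insert a s ha ih =>
    simp only [Finset.sum_insert ha]
    exact (h a (by simp)).add (ih fun i hi => h i (by simp [hi]))

lemma tendsto_zero (h : IsH1 f f') : Tendsto f atTop (𝓝 0) ∧ Tendsto f atBot (𝓝 0) := by
  have h1 := (h.toIsPrimitive.mul h.toIsPrimitive).tendsto_zero (integrable_mul h.memLp h.memLp)
    ((integrable_mul h.memLp' h.memLp).add (integrable_mul h.memLp h.memLp'))
  have key : ∀ l : Filter ℝ, Tendsto (fun x => f x * f x) l (𝓝 0) → Tendsto f l (𝓝 0) := by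
    intro l hl
    have := hl.sqrt
    simp only [Real.sqrt_mul_self_eq_abs, Real.sqrt_zero] at this
    exact (tendsto_zero_iff_abs_tendsto_zero _).mpr this
  exact ⟨key _ h1.1, key _ h1.2⟩

/-- The Sobolev inequality bounding the supremum norm by the `H¹` norm. -/
lemma sq_le (h : IsH1 f f') (x : ℝ) : f x ^ 2 ≤ (∫ y, f y ^ 2) + ∫ y, f' y ^ 2 := by
  have hp := h.toIsPrimitive.mul h.toIsPrimitive
  have hi := (integrable_mul h.memLp' h.memLp).add (integrable_mul h.memLp h.memLp')
  have h0 := (hp.tendsto_zero (integrable_mul h.memLp h.memLp) hi).2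
  have h1 := intervalIntegral_tendsto_integral_Iic x hi.integrableOn tendsto_id
  have h2 : Tendsto (fun a => ∫ t in a..x, (f' t * f t + f t * f' t)) atBot
      (𝓝 (f x * f x - 0)) :=
    (h0.const_sub (f x * f x)).congr fun a => by rw [← hp.ftc a x]
  have h3 : f x * f x = ∫ t in Set.Iic x, (f' t * f t + f t * f' t) := by
    simpa using tendsto_nhds_unique h2 h1
  have hs := h.memLp.integrable_sq
  have hs' := h.memLp'.integrable_sq
  rw [pow_two, h3, ← integral_add hs hs']
  calc ∫ t in Set.Iic x, (f' t * f t + f t * f' t)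
      ≤ ∫ t in Set.Iic x, (f t ^ 2 + f' t ^ 2) := by
        refine setIntegral_mono hi.integrableOn (hs.add hs').integrableOn fun t => ?_
        nlinarith [sq_nonneg (f t - f' t)]
    _ ≤ ∫ t, (f t ^ 2 + f' t ^ 2) :=
        setIntegral_le_integral (hs.add hs') (Eventually.of_forall fun t => by positivity)

lemma exists_bound (h : IsH1 f f') : ∃ C, 0 ≤ C ∧ ∀ x, |f x| ≤ C :=
  ⟨_, Real.sqrt_nonneg _, fun x => Real.abs_le_sqrt (h.sq_le x)⟩

lemma mul_memLp (h : IsH1 f f') (hg : MemLp g 2 volume) :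
    MemLp (fun x => f x * g x) 2 volume := by
  obtain ⟨C, -, hC⟩ := h.exists_bound
  exact memLp_mul_of_bdd h.continuous hC hg

lemma mul (hf : IsH1 f f') (hg : IsH1 g g') :
    IsH1 (fun x => f x * g x) (fun x => f' x * g x + f x * g' x) :=
  ⟨hf.toIsPrimitive.mul hg.toIsPrimitive, hf.mul_memLp hg.memLp,
    MemLp.add (by simpa only [mul_comm] using hg.mul_memLp hf.memLp') (hf.mul_memLp hg.memLp')⟩

/-- Integration by parts on the line for `H¹` functions. -/
lemma integral_mul_deriv (hf : IsH1 f f') (hg : IsH1 g g') :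
    ∫ x, f x * g' x = -∫ x, f' x * g x := by
  have h1 := (hf.toIsPrimitive.mul hg.toIsPrimitive).integral_eq_zero
    (integrable_mul hf.memLp hg.memLp)
    ((integrable_mul hf.memLp' hg.memLp).add (integrable_mul hf.memLp hg.memLp'))
  rw [integral_add (integrable_mul hf.memLp' hg.memLp) (integrable_mul hf.memLp hg.memLp')] at h1
  linarith

end IsH1

/-- `v` is the `H²` solution of `k² v - v'' = f`, and `p` is its derivative. -/
structure IsResolvent (k : ℝ) (f v p : ℝ → ℝ) : Prop where
  left : IsH1 v p
  right : IsH1 p (fun x => k ^ 2 * v x - f x)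

lemma eq_zero_of_integral_sq {d : ℝ → ℝ} (hd : Continuous d) (hi : MemLp d 2 volume)
    (h : ∫ x, d x ^ 2 ≤ 0) : ∀ x, d x = 0 := by
  have h0 : ∫ x, d x ^ 2 = 0 := le_antisymm h (integral_nonneg fun x => sq_nonneg _)
  rw [integral_eq_zero_iff_of_nonneg (fun x => sq_nonneg _) hi.integrable_sq] at h0
  have : (fun x => d x ^ 2) = fun _ => 0 := (hd.pow 2).ae_eq_iff_eq volume continuous_const |>.mp h0
  intro x
  have := congrFun this x
  simpa using this

namespace IsResolvent

variable {k : ℝ} {f g v p w q : ℝ → ℝ}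

lemma integral_mul (h : IsResolvent k f v p) (hf : MemLp f 2 volume) (hw : IsH1 w q) :
    ∫ x, f x * w x = k ^ 2 * (∫ x, v x * w x) + ∫ x, p x * q x := by
  have h1 := hw.integral_mul_deriv h.right
  have e : ∀ x, w x * (k ^ 2 * v x - f x) = k ^ 2 * (v x * w x) - f x * w x := fun x => by ring
  simp only [e] at h1
  rw [integral_sub ((integrable_mul h.left.memLp hw.memLp).const_mul _)
      (integrable_mul hf hw.memLp),
    integral_const_mul] at h1
  simp only [mul_comm (q _)] at h1
  linarith

/-- The resolvent is symmetric. -/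
lemma integral_mul_comm (h : IsResolvent k f v p) (h' : IsResolvent k g w q)
    (hf : MemLp f 2 volume) (hg : MemLp g 2 volume) :
    ∫ x, f x * w x = ∫ x, v x * g x := by
  have h1 := h.integral_mul hf h'.left
  have h2 := h'.integral_mul hg h.left
  simp only [mul_comm (w _), mul_comm (q _)] at h2
  simp only [mul_comm (v _)] at h1 h2 ⊢
  simp only [mul_comm (g _)] at h2 ⊢
  rw [h1, h2]

lemma integral_mul_self (h : IsResolvent k f v p) (hf : MemLp f 2 volume) :
    ∫ x, f x * v x = k ^ 2 * (∫ x, v x ^ 2) + ∫ x, p x ^ 2 := by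
  simpa only [pow_two] using h.integral_mul hf h.left

lemma unique (hk : k ≠ 0) (h : IsResolvent k f v p) (h' : IsResolvent k f w q) : v = w := by
  have hd : IsResolvent k (fun _ => 0) (fun x => v x - w x) (fun x => p x - q x) :=
    ⟨h.left.sub h'.left, by
      have := h.right.sub h'.right
      convert this using 2
      ring⟩
  have := hd.integral_mul_self MemLp.zero'
  simp only [zero_mul, integral_zero] at this
  have h2 : 0 ≤ ∫ x, (p x - q x) ^ 2 := integral_nonneg fun x => sq_nonneg _
  have h3 := eq_zero_of_integral_sq hd.left.continuous hd.left.memLp (by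
    have : 0 < k ^ 2 := by positivity
    nlinarith)
  funext x
  linarith [h3 x]

end IsResolvent

/-- The solution `∫_{-∞}^x e^{-k(x-z)} f(z) dz` of `a' + k a = f`. -/
noncomputable def leftTail (k : ℝ) (f : ℝ → ℝ) (x : ℝ) : ℝ :=
  Real.exp (-k * x) * ∫ z in Set.Iic x, Real.exp (k * z) * f z

lemma memLp_exp_Iic {k : ℝ} (hk : 0 < k) (x : ℝ) :
    MemLp (fun z => Real.exp (k * z)) 2 (volume.restrict (Set.Iic x)) := by
  rw [memLp_two_iff_integrable_sq (by fun_prop)]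
  have := integrableOn_exp_mul_Iic (a := 2 * k) (by positivity) x
  refine this.congr (Eventually.of_forall fun z => ?_)
  simp only
  rw [pow_two, ← Real.exp_add]; ring_nf

lemma leftTail_isH1 {k : ℝ} (hk : 0 < k) {f : ℝ → ℝ} (hf : MemLp f 2 volume) :
    IsH1 (leftTail k f) (fun x => f x - k * leftTail k f x) := by
  have hint : ∀ x, IntegrableOn (fun z => Real.exp (k * z) * f z) (Set.Iic x) := fun x =>
    (memLp_exp_Iic hk x).integrable_mul (hf.restrict _)
  have hI : IsPrimitive (fun x => ∫ z in Set.Iic x, Real.exp (k * z) * f z)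
      (fun z => Real.exp (k * z) * f z) := by
    refine ⟨?_, fun a b => intervalIntegral.integral_Iic_sub_Iic (hint a) (hint b)⟩
    exact (locallyIntegrableOn_univ.mp
        ((locallyIntegrableOn_univ.mpr (hf.locallyIntegrable (by norm_num))).continuousOn_mul
          (by fun_prop : Continuous fun z => Real.exp (k * z)).continuousOn
          isOpen_univ.isLocallyClosed))
  have hE : IsPrimitive (fun x => Real.exp (-k * x)) (fun x => -k * Real.exp (-k * x)) :=
    IsPrimitive.of_hasDerivAt (fun x => by
      have := ((hasDerivAt_id x).const_mul (-k)).exp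
      simpa [mul_comm] using this) (by fun_prop)
  have hA : IsPrimitive (leftTail k f) (fun x => f x - k * leftTail k f x) := by
    refine (hE.mul hI).congr (Eventually.of_forall fun x => ?_)
    have : Real.exp (-k * x) * (Real.exp (k * x) * f x) = f x := by
      rw [← mul_assoc, ← Real.exp_add]; simp
    simp only [leftTail]
    rw [this]; ring
  -- A uniform bound, from `|e^{k(z-x)} f| ≤ e^{2k(z-x)} + f²`.
  have hbd : ∀ x, |leftTail k f x| ≤ (2 * k)⁻¹ + ∫ z, f z ^ 2 := by
    intro x
    have e1 : leftTail k f x = ∫ z in Set.Iic x, Real.exp (-k * x) * (Real.exp (k * z) * f z) := by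
      rw [leftTail, integral_const_mul]
    have hi1 : IntegrableOn (fun z => Real.exp (-(2 * k) * x) * Real.exp (2 * k * z)) (Set.Iic x) :=
      (integrableOn_exp_mul_Iic (a := 2 * k) (by positivity) x).const_mul _
    have hi2 : IntegrableOn (fun z => f z ^ 2) (Set.Iic x) := hf.integrable_sq.integrableOn
    rw [e1, ← Real.norm_eq_abs]
    calc ‖∫ z in Set.Iic x, Real.exp (-k * x) * (Real.exp (k * z) * f z)‖
        ≤ ∫ z in Set.Iic x, (Real.exp (-(2 * k) * x) * Real.exp (2 * k * z) + f z ^ 2) := by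
          refine norm_integral_le_of_norm_le (hi1.add hi2) (Eventually.of_forall fun z => ?_)
          have : Real.exp (-(2 * k) * x) * Real.exp (2 * k * z)
              = (Real.exp (-k * x) * Real.exp (k * z)) ^ 2 := by
            rw [mul_pow, ← Real.exp_nat_mul, ← Real.exp_nat_mul]; push_cast; ring_nf
          rw [this, ← mul_assoc, norm_mul, Real.norm_eq_abs, Real.norm_eq_abs, ← sq_abs (f z),
            ← sq_abs (Real.exp _ * _)]
          nlinarith [sq_nonneg (|Real.exp (-k * x) * Real.exp (k * z)| - |f z|),
            abs_nonneg (f z), abs_nonneg (Real.exp (-k * x) * Real.exp (k * z))]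
      _ = (2 * k)⁻¹ + ∫ z in Set.Iic x, f z ^ 2 := by
          rw [integral_add hi1 hi2, integral_const_mul, integral_exp_mul_Iic (by positivity),
            mul_div_assoc', ← Real.exp_add]
          simp
      _ ≤ _ := by
          gcongr
          · exact Eventually.of_forall fun z => sq_nonneg _
          · exact hf.integrable_sq
          · exact Measure.restrict_le_self
  set Cb := (2 * k)⁻¹ + ∫ z, f z ^ 2
  have hsq : Integrable (fun x => leftTail k f x ^ 2) := by
    refine integrable_of_intervalIntegral_norm_bounded (a := fun n : ℝ => -n) (b := id) (l := atTop)
      ((1 / k) * ((1 / k) * (∫ z, f z ^ 2) + Cb ^ 2))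
      (fun i => ((hA.continuous.pow 2).integrableOn_Icc).mono_set Set.Ioc_subset_Icc_self)
      tendsto_neg_atTop_atBot tendsto_id ?_
    filter_upwards [eventually_ge_atTop 0] with n hn
    have hsub : -n ≤ n := by linarith
    have h1 := (hA.mul hA).ftc (-n) n
    have hii : IntervalIntegrable (fun x => leftTail k f x ^ 2) volume (-n) n :=
      (hA.continuous.pow 2).intervalIntegrable _ _
    have hif : IntervalIntegrable (fun x => f x ^ 2) volume (-n) n :=
      hf.integrable_sq.intervalIntegrable
    have h2 : ∫ x in (-n)..n, ((f x - k * leftTail k f x) * leftTail k f x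
          + leftTail k f x * (f x - k * leftTail k f x))
        ≤ ∫ x in (-n)..n, ((1 / k) * f x ^ 2 - k * leftTail k f x ^ 2) := by
      refine intervalIntegral.integral_mono_on hsub ((hA.mul hA).intervalIntegrable _ _)
        ((hif.const_mul _).sub (hii.const_mul _)) fun x _ => ?_
      have : (1 / k) * f x ^ 2 - k * leftTail k f x ^ 2
          - ((f x - k * leftTail k f x) * leftTail k f x
          + leftTail k f x * (f x - k * leftTail k f x)) = k * (f x / k - leftTail k f x) ^ 2 := by
        field_simp; ring
      nlinarith [mul_nonneg hk.le (sq_nonneg (f x / k - leftTail k f x))]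
    rw [intervalIntegral.integral_sub (hif.const_mul _) (hii.const_mul _),
      intervalIntegral.integral_const_mul, intervalIntegral.integral_const_mul, ← h1] at h2
    have h3 : ∫ x in (-n)..n, f x ^ 2 ≤ ∫ x, f x ^ 2 := by
      rw [intervalIntegral.integral_of_le hsub]
      exact setIntegral_le_integral hf.integrable_sq (Eventually.of_forall fun z => sq_nonneg _)
    have h4 : leftTail k f (-n) ^ 2 ≤ Cb ^ 2 := by
      rw [← sq_abs]; exact pow_le_pow_left₀ (abs_nonneg _) (hbd _) 2
    have h5 : (1 / k) * ∫ x in (-n)..n, f x ^ 2 ≤ (1 / k) * ∫ x, f x ^ 2 := by gcongr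
    simp only [norm_pow, Real.norm_eq_abs, sq_abs, id]
    rw [one_div_mul_eq_div k (_ + _), le_div_iff₀ hk]
    nlinarith [sq_nonneg (leftTail k f n)]
  have hm : MemLp (leftTail k f) 2 volume :=
    (memLp_two_iff_integrable_sq hA.continuous.aestronglyMeasurable).mpr hsq
  exact ⟨hA, hm, hf.sub (hm.const_mul k)⟩

/-- The solution `∫_x^∞ e^{-k(z-x)} f(z) dz` of `b' - k b = -f`. -/
noncomputable def rightTail (k : ℝ) (f : ℝ → ℝ) (x : ℝ) : ℝ :=
  leftTail k (fun z => f (-z)) (-x)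

lemma rightTail_eq (k : ℝ) (f : ℝ → ℝ) (x : ℝ) :
    rightTail k f x = Real.exp (k * x) * ∫ z in Set.Ioi x, Real.exp (-k * z) * f z := by
  rw [rightTail, leftTail]
  have := integral_comp_neg_Iic (-x) (fun z => Real.exp (-k * z) * f z)
  simp only [neg_neg, neg_mul, mul_neg] at this ⊢
  rw [this]

lemma IsH1.comp_neg {f f' : ℝ → ℝ} (h : IsH1 f f') :
    IsH1 (fun x => f (-x)) (fun x => -f' (-x)) := by
  refine IsH1.of_memLp (fun a b => ?_) (h.memLp.comp_measurePreserving
      (Measure.measurePreserving_neg volume))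
    (h.memLp'.comp_measurePreserving (Measure.measurePreserving_neg volume)).neg
  rw [h.ftc (-a) (-b), intervalIntegral.integral_neg, intervalIntegral.integral_comp_neg,
    intervalIntegral.integral_symm]

lemma rightTail_isH1 {k : ℝ} (hk : 0 < k) {f : ℝ → ℝ} (hf : MemLp f 2 volume) :
    IsH1 (rightTail k f) (fun x => k * rightTail k f x - f x) := by
  have := (leftTail_isH1 hk (hf.comp_measurePreserving
      (Measure.measurePreserving_neg volume))).comp_neg
  refine this.congr (Eventually.of_forall fun x => ?_)
  simp only [rightTail, Function.comp_def, neg_neg]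
  ring

lemma invHelmholtz_integrable {k : ℝ} (hk : 0 < k) {f : ℝ → ℝ} (hf : MemLp f 2 volume) (x : ℝ) :
    IntegrableOn (fun z => Real.exp (-k * |x - z|) / (2 * k) * f z) (Set.Iic x) ∧
    IntegrableOn (fun z => Real.exp (-k * |x - z|) / (2 * k) * f z) (Set.Ioi x) ∧
    ∫ z in Set.Iic x, Real.exp (-k * |x - z|) / (2 * k) * f z = leftTail k f x / (2 * k) ∧
    ∫ z in Set.Ioi x, Real.exp (-k * |x - z|) / (2 * k) * f z = rightTail k f x / (2 * k) := by
  have e1 : ∀ z ∈ Set.Iic x, Real.exp (-k * x) / (2 * k) * (Real.exp (k * z) * f z) =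
      Real.exp (-k * |x - z|) / (2 * k) * f z := fun z hz => by
    rw [abs_of_nonneg (sub_nonneg.mpr hz), show -k * (x - z) = -k * x + k * z by ring, Real.exp_add]
    ring
  have e2 : ∀ z ∈ Set.Ioi x, Real.exp (k * x) / (2 * k) * (Real.exp (-k * z) * f z) =
      Real.exp (-k * |x - z|) / (2 * k) * f z := fun z hz => by
    rw [abs_of_neg (sub_neg.mpr hz), show -k * -(x - z) = k * x + -k * z by ring, Real.exp_add]
    ring
  have i1 : IntegrableOn (fun z => Real.exp (k * z) * f z) (Set.Iic x) :=
    (memLp_exp_Iic hk x).integrable_mul (hf.restrict _)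
  have i2 : IntegrableOn (fun z => Real.exp (-k * z) * f z) (Set.Ioi x) := by
    have hm : MemLp (fun z => Real.exp (-k * z)) 2 (volume.restrict (Set.Ioi x)) := by
      rw [memLp_two_iff_integrable_sq (by fun_prop)]
      have := integrableOn_exp_mul_Ioi (a := -(2 * k)) (by linarith) x
      refine this.congr (Eventually.of_forall fun z => ?_)
      simp only
      rw [pow_two, ← Real.exp_add]; ring_nf
    exact hm.integrable_mul (hf.restrict _)
  refine ⟨(integrableOn_congr_fun e1 measurableSet_Iic).mp (i1.const_mul _),
    (integrableOn_congr_fun e2 measurableSet_Ioi).mp (i2.const_mul _), ?_, ?_⟩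
  · rw [← setIntegral_congr_fun measurableSet_Iic e1, integral_const_mul, leftTail]; ring
  · rw [← setIntegral_congr_fun measurableSet_Ioi e2, integral_const_mul, rightTail_eq]; ring

lemma integrable_kernel_mul {k : ℝ} (hk : 0 < k) {f : ℝ → ℝ} (hf : MemLp f 2 volume) (x : ℝ) :
    Integrable (fun z => Real.exp (-k * |x - z|) / (2 * k) * f z) := by
  obtain ⟨h1, h2, -, -⟩ := invHelmholtz_integrable hk hf x
  rw [← integrableOn_univ, ← Set.Iic_union_Ioi (a := x)]
  exact h1.union h2

lemma invHelmholtz_eq {k : ℝ} (hk : 0 < k) {f : ℝ → ℝ} (hf : MemLp f 2 volume) :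
    invHelmholtz k f = fun x => (2 * k)⁻¹ * (leftTail k f x + rightTail k f x) := by
  funext x
  obtain ⟨h1, h2, h3, h4⟩ := invHelmholtz_integrable hk hf x
  rw [invHelmholtz, ← setIntegral_univ, ← Set.Iic_union_Ioi (a := x),
    setIntegral_union (Set.Iic_disjoint_Ioi le_rfl) measurableSet_Ioi h1 h2, h3, h4]
  ring

/-- For square integrable `f` the convolution `invHelmholtz k f` solves `k² v - v'' = f`. -/
lemma isResolvent_invHelmholtz {k : ℝ} (hk : 0 < k) {f : ℝ → ℝ} (hf : MemLp f 2 volume) :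
    IsResolvent k f (invHelmholtz k f) (deriv (invHelmholtz k f)) := by
  have hl := leftTail_isH1 hk hf
  have hr := rightTail_isH1 hk hf
  have hp : IsH1 (fun x => (1 / 2) * (rightTail k f x - leftTail k f x))
      (fun x => k ^ 2 * invHelmholtz k f x - f x) := by
    refine ((hr.sub hl).const_mul (1 / 2)).congr (Eventually.of_forall fun x => ?_)
    simp only [invHelmholtz_eq hk hf]
    field_simp
    ring
  have hv : IsH1 (invHelmholtz k f) (fun x => (1 / 2) * (rightTail k f x - leftTail k f x)) := by
    have h := (hl.add hr).const_mul (2 * k)⁻¹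
    rw [← invHelmholtz_eq hk hf] at h
    refine h.congr (Eventually.of_forall fun x => ?_)
    simp only
    field_simp
    ring
  have hd : deriv (invHelmholtz k f) = fun x => (1 / 2) * (rightTail k f x - leftTail k f x) :=
    funext fun x => (hv.hasDerivAt hp.continuous x).deriv
  rw [hd]
  exact ⟨hv, hp⟩

lemma IsResolvent.eq_invHelmholtz {k : ℝ} (hk : 0 < k) {f v p : ℝ → ℝ} (hf : MemLp f 2 volume)
    (h : IsResolvent k f v p) : invHelmholtz k f = v :=
  (isResolvent_invHelmholtz hk hf).unique hk.ne' h

lemma invHelmholtz_congr {k : ℝ} {f g : ℝ → ℝ} (h : f =ᵐ[volume] g) :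
    invHelmholtz k f = invHelmholtz k g := by
  funext x
  exact integral_congr_ae (h.mono fun z hz => by simp only [hz])

lemma invHelmholtz_nonneg {k : ℝ} (hk : 0 < k) {f : ℝ → ℝ} (h : 0 ≤ᵐ[volume] f) (x : ℝ) :
    0 ≤ invHelmholtz k f x :=
  integral_nonneg_of_ae (h.mono fun z hz => mul_nonneg (by positivity) hz)

lemma invHelmholtz_add {k : ℝ} (hk : 0 < k) {f g : ℝ → ℝ} (hf : MemLp f 2 volume)
    (hg : MemLp g 2 volume) :
    invHelmholtz k (fun x => f x + g x) = fun x => invHelmholtz k f x + invHelmholtz k g x := by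
  funext x
  rw [invHelmholtz, invHelmholtz, invHelmholtz,
    ← integral_add (integrable_kernel_mul hk hf x) (integrable_kernel_mul hk hg x)]
  simp only [mul_add]

lemma invHelmholtz_const_mul {k : ℝ} (c : ℝ) (f : ℝ → ℝ) :
    invHelmholtz k (fun x => c * f x) = fun x => c * invHelmholtz k f x := by
  funext x
  rw [invHelmholtz, invHelmholtz, ← integral_const_mul]
  congr 1; funext z; ring

/-! ### The energy -/

lemma energy_congr {f g : ℝ → ℝ} (h : f =ᵐ[volume] g) : energy f = energy g := by
  simp only [energy, invHelmholtz_congr h]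

lemma energy_eq_expand {f : ℝ → ℝ} (hf : MemLp f 2 volume) :
    energy f = ∫ x, (4 * invHelmholtz 2 f x ^ 2 + 5 * deriv (invHelmholtz 2 f) x ^ 2
      + (4 * invHelmholtz 2 f x - f x) ^ 2) := by
  have h := isResolvent_invHelmholtz two_pos hf
  refine integral_congr_ae ?_
  filter_upwards [h.right.ae_hasDerivAt] with x hx
  simp only [hx.deriv]
  norm_num

lemma energy_eq {f : ℝ → ℝ} (hf : MemLp f 2 volume) :
    energy f = (∫ x, f x ^ 2) - 3 * ∫ x, f x * invHelmholtz 2 f x := by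
  have h := isResolvent_invHelmholtz two_pos hf
  have h1 := h.integral_mul_self hf
  have i1 := h.left.memLp.integrable_sq
  have i2 := h.left.memLp'.integrable_sq
  have i3 := integrable_mul hf h.left.memLp
  have i4 := hf.integrable_sq
  rw [energy_eq_expand hf]
  have e : ∀ x, 4 * invHelmholtz 2 f x ^ 2 + 5 * deriv (invHelmholtz 2 f) x ^ 2
      + (4 * invHelmholtz 2 f x - f x) ^ 2 = 20 * invHelmholtz 2 f x ^ 2
      + 5 * deriv (invHelmholtz 2 f) x ^ 2 + f x ^ 2 - 8 * (f x * invHelmholtz 2 f x) :=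
    fun x => by ring
  simp only [e]
  rw [integral_sub (((i1.const_mul 20).fun_add (i2.const_mul 5)).fun_add i4) (i3.const_mul 8),
    integral_add ((i1.const_mul 20).fun_add (i2.const_mul 5)) i4,
    integral_add (i1.const_mul 20) (i2.const_mul 5), integral_const_mul, integral_const_mul,
    integral_const_mul]
  linarith

lemma integral_mul_invHelmholtz_le_energy {f : ℝ → ℝ} (hf : MemLp f 2 volume) :
    ∫ x, f x * invHelmholtz 2 f x ≤ energy f := by
  have h := isResolvent_invHelmholtz two_pos hf
  have i1 := h.left.memLp.integrable_sq
  have i2 := h.left.memLp'.integrable_sq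
  have i3 := h.right.memLp'.integrable_sq
  rw [h.integral_mul_self hf, energy_eq_expand hf, ← integral_const_mul,
    ← integral_add (i1.const_mul _) i2]
  refine integral_mono ((i1.const_mul _).add i2)
    (((i1.const_mul 4).add (i2.const_mul 5)).add (by norm_num at i3; exact i3)) fun x => ?_
  simp only
  nlinarith [sq_nonneg (deriv (invHelmholtz 2 f) x), sq_nonneg (4 * invHelmholtz 2 f x - f x)]

/-- The energy norm dominates the `L²` norm. -/
lemma integral_sq_le_energy {f : ℝ → ℝ} (hf : MemLp f 2 volume) :
    ∫ x, f x ^ 2 ≤ 4 * energy f := by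
  linarith [integral_mul_invHelmholtz_le_energy hf, energy_eq hf]

lemma energy_nonneg (f : ℝ → ℝ) : 0 ≤ energy f :=
  integral_nonneg fun x => by positivity

lemma energy_le_integral_sq {f : ℝ → ℝ} (hf : MemLp f 2 volume) :
    energy f ≤ ∫ x, f x ^ 2 := by
  have h := (isResolvent_invHelmholtz two_pos hf).integral_mul_self hf
  have h1 : 0 ≤ ∫ x, invHelmholtz 2 f x ^ 2 := integral_nonneg fun x => sq_nonneg _
  have h2 : 0 ≤ ∫ x, deriv (invHelmholtz 2 f) x ^ 2 := integral_nonneg fun x => sq_nonneg _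
  rw [energy_eq hf, h]
  linarith

/-! ### Peakons and their potentials -/

lemma memLp_exp_abs {k : ℝ} (hk : 0 < k) (z : ℝ) :
    MemLp (fun x => Real.exp (-k * |x - z|)) 2 volume := by
  have h0 : MemLp (fun x => Real.exp (-k * |x|)) 2 volume := by
    rw [memLp_two_iff_integrable_sq (by fun_prop)]
    have h1 : IntegrableOn (fun x => Real.exp (-(2 * k) * x)) (Set.Ioi 0) :=
      integrableOn_exp_mul_Ioi (by linarith) 0
    have h2 := (integrableOn_exp_mul_Iic (a := 2 * k) (by linarith) 0)
    have e : ∀ x : ℝ, Real.exp (-k * |x|) ^ 2 = Real.exp (-(2 * k) * |x|) := fun x => by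
      rw [← Real.exp_nat_mul]; push_cast; ring_nf
    simp only [e]
    rw [← integrableOn_univ, ← Set.Iic_union_Ioi (a := (0 : ℝ))]
    refine IntegrableOn.union ?_ ?_
    · refine (integrableOn_congr_fun (fun x hx => ?_) measurableSet_Iic).mp h2
      rw [abs_of_nonpos hx]; simp
    · refine (integrableOn_congr_fun (fun x hx => ?_) measurableSet_Ioi).mp h1
      rw [abs_of_pos hx]
  exact h0.comp_measurePreserving (measurePreserving_sub_right volume z)

lemma hasDerivAt_exp_abs_of_ne (k : ℝ) {x z : ℝ} (h : x ≠ z) :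
    HasDerivAt (fun x => Real.exp (-k * |x - z|))
      (-k * (SignType.sign (x - z) : ℝ) * Real.exp (-k * |x - z|)) x := by
  have h1 := (((hasDerivAt_abs (sub_ne_zero.mpr h)).comp x
    ((hasDerivAt_id x).sub_const z)).const_mul (-k)).exp
  refine h1.congr_deriv ?_
  simp only [Function.comp_def, id]
  ring

lemma isH1_exp_abs {k : ℝ} (hk : 0 < k) (z : ℝ) :
    IsH1 (fun x => Real.exp (-k * |x - z|))
      (fun x => -k * (SignType.sign (x - z) : ℝ) * Real.exp (-k * |x - z|)) := by
  have hm : Measurable fun x : ℝ => (SignType.sign (x - z) : ℝ) := by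
    have : (fun x : ℝ => (SignType.sign (x - z) : ℝ)) =
        fun x => if 0 < x - z then 1 else if x - z < 0 then -1 else 0 := by
      funext x; rw [sign_apply]; split_ifs <;> simp
    rw [this]
    exact Measurable.ite (measurableSet_lt measurable_const (by fun_prop)) measurable_const
      (Measurable.ite (measurableSet_lt (by fun_prop) measurable_const) measurable_const
        measurable_const)
  have hs : ∀ y : ℝ, |(SignType.sign y : ℝ)| ≤ 1 := fun y => by
    rw [sign_apply]; split_ifs <;> simp
  have hmem : MemLp (fun x => -k * (SignType.sign (x - z) : ℝ) * Real.exp (-k * |x - z|)) 2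
      volume := by
    refine (memLp_exp_abs hk z).of_le_mul (c := k) ?_ (Eventually.of_forall fun x => ?_)
    · exact ((hm.const_mul (-k)).mul (by fun_prop)).aestronglyMeasurable
    · rw [norm_mul, norm_mul, norm_neg, Real.norm_of_nonneg hk.le]
      gcongr
      simpa using mul_le_mul_of_nonneg_left (hs (x - z)) hk.le
  refine IsH1.of_memLp (fun a b => ?_) (memLp_exp_abs hk z) hmem
  refine (MeasureTheory.integral_eq_of_hasDerivAt_off_countable
    (fun x => Real.exp (-k * |x - z|)) _ (s := {z}) (Set.countable_singleton z)
        (by fun_prop) (fun x hx => ?_) ?_).symm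
  · exact hasDerivAt_exp_abs_of_ne k (fun h => hx.2 (by simp [h]))
  · exact intervalIntegrable_iff.mpr
      (((hmem.locallyIntegrable (by norm_num)).integrableOn_isCompact isCompact_uIcc).mono_set
        Set.uIoc_subset_uIcc)

lemma peakon_eq (c y : ℝ) : peakon c y = c * Real.exp (-1 * |y|) := by simp [peakon]

/-- `SignType.sign 0 = 0` fixes the value of the derivative at the peak. -/
lemma isH1_peakon (c z : ℝ) : IsH1 (fun x => peakon c (x - z))
    (fun x => -(SignType.sign (x - z) : ℝ) * peakon c (x - z)) := by
  have := (isH1_exp_abs one_pos z).const_mul c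
  simp only [peakon_eq]
  refine this.congr (Eventually.of_forall fun x => ?_)
  simp only
  ring

lemma isResolvent_peakon (c z : ℝ) : IsResolvent 2 (fun x => peakon c (x - z))
    (fun x => c * ((1 / 3) * Real.exp (-1 * |x - z|) - (1 / 6) * Real.exp (-2 * |x - z|)))
    (fun x => c * ((1 / 3) * (-1 * (SignType.sign (x - z) : ℝ) * Real.exp (-1 * |x - z|))
      - (1 / 6) * (-2 * (SignType.sign (x - z) : ℝ) * Real.exp (-2 * |x - z|)))) := by
  have hv := (((isH1_exp_abs one_pos z).const_mul (1 / 3)).sub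
    ((isH1_exp_abs two_pos z).const_mul (1 / 6))).const_mul c
  have hq : MemLp (fun x => 2 ^ 2 * (c * ((1 / 3) * Real.exp (-1 * |x - z|)
      - (1 / 6) * Real.exp (-2 * |x - z|))) - peakon c (x - z)) 2 volume :=
    (hv.memLp.const_mul _).sub (isH1_peakon c z).memLp
  refine ⟨hv, ?_⟩
  -- The two kinks at `z` cancel: `p` is `C¹`.
  have hp : ∀ x, HasDerivAt
      (fun x => c * ((1 / 3) * (-1 * (SignType.sign (x - z) : ℝ) * Real.exp (-1 * |x - z|))
      - (1 / 6) * (-2 * (SignType.sign (x - z) : ℝ) * Real.exp (-2 * |x - z|))))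
      (2 ^ 2 * (c * ((1 / 3) * Real.exp (-1 * |x - z|)
      - (1 / 6) * Real.exp (-2 * |x - z|))) - peakon c (x - z)) x := by
    have key : ∀ x, x ≠ z → HasDerivAt
      (fun x => c * ((1 / 3) * (-1 * (SignType.sign (x - z) : ℝ) * Real.exp (-1 * |x - z|))
      - (1 / 6) * (-2 * (SignType.sign (x - z) : ℝ) * Real.exp (-2 * |x - z|))))
      (2 ^ 2 * (c * ((1 / 3) * Real.exp (-1 * |x - z|)
      - (1 / 6) * Real.exp (-2 * |x - z|))) - peakon c (x - z)) x := by
      intro x hx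
      have hs : HasDerivAt (fun y : ℝ => (SignType.sign (y - z) : ℝ)) 0 x := by
        refine (hasDerivAt_const x (SignType.sign (x - z) : ℝ)).congr_of_eventuallyEq ?_
        rcases lt_or_gt_of_ne hx with h | h
        · filter_upwards [Iio_mem_nhds h] with y hy
          rw [sign_neg (sub_neg.mpr hy), sign_neg (sub_neg.mpr h)]
        · filter_upwards [Ioi_mem_nhds h] with y hy
          rw [sign_pos (sub_pos.mpr hy), sign_pos (sub_pos.mpr h)]
      have h1 := (hs.const_mul (-1)).mul (hasDerivAt_exp_abs_of_ne 1 hx)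
      have h2 := (hs.const_mul (-2)).mul (hasDerivAt_exp_abs_of_ne 2 hx)
      have h3 := ((h1.const_mul (1 / 3)).sub (h2.const_mul (1 / 6))).const_mul c
      refine h3.congr_deriv ?_
      have hss : (SignType.sign (x - z) : ℝ) * (SignType.sign (x - z) : ℝ) = 1 := by
        rcases lt_or_gt_of_ne hx with h | h
        · rw [sign_neg (sub_neg.mpr h)]; simp
        · rw [sign_pos (sub_pos.mpr h)]; simp
      rw [peakon_eq]
      linear_combination (c * ((1 / 3) * Real.exp (-1 * |x - z|)
        - (2 / 3) * Real.exp (-2 * |x - z|))) * hss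
    intro x
    by_cases hx : x = z
    · subst hx
      refine hasDerivAt_of_hasDerivAt_of_ne (f :=
          (fun y => c * ((1 / 3) * (-1 * (SignType.sign (y - x) : ℝ) * Real.exp (-1 * |y - x|))
      - (1 / 6) * (-2 * (SignType.sign (y - x) : ℝ) * Real.exp (-2 * |y - x|)))))
        (g := fun y => 2 ^ 2 * (c * ((1 / 3) * Real.exp (-1 * |y - x|)
      - (1 / 6) * Real.exp (-2 * |y - x|))) - peakon c (y - x)) (fun y hy => key y hy) ?_ ?_
      · rw [Metric.continuousAt_iff']
        intro ε hε
        have hc : Tendsto (fun y => c * ((1 / 3) * Real.exp (-1 * |y - x|)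
            - (1 / 3) * Real.exp (-2 * |y - x|))) (𝓝 x) (𝓝 0) := by
          have : Continuous fun y => c * ((1 / 3) * Real.exp (-1 * |y - x|)
            - (1 / 3) * Real.exp (-2 * |y - x|)) := by fun_prop
          simpa using this.tendsto x
        filter_upwards [(Metric.tendsto_nhds.mp hc) ε hε] with y hy
        rw [Real.dist_eq] at hy ⊢
        refine lt_of_le_of_lt ?_ hy
        rcases lt_trichotomy y x with h | h | h
        · rw [sign_neg (sub_neg.mpr h)]
          simp only [sub_self, sign_zero, SignType.coe_zero, SignType.coe_neg_one]
          refine le_of_eq (congrArg abs ?_); ring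
        · subst h; simp
        · rw [sign_pos (sub_pos.mpr h), ← abs_neg]
          simp only [sub_self, sign_zero, SignType.coe_zero, SignType.coe_one]
          refine le_of_eq (congrArg abs ?_); ring
      · simp only [peakon]
        fun_prop
    · exact key x hx
  refine IsH1.mk (IsPrimitive.of_hasDerivAt hp ?_) hv.memLp' hq
  simp only [peakon]
  fun_prop

lemma invHelmholtz_peakon (c z : ℝ) : invHelmholtz 2 (fun x => peakon c (x - z)) =
    fun x => c * ((1 / 3) * Real.exp (-1 * |x - z|) - (1 / 6) * Real.exp (-2 * |x - z|)) :=
  (isResolvent_peakon c z).eq_invHelmholtz two_pos (isH1_peakon c z).memLp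

/-- Peakons are the fundamental solutions of `1 - ∂ₓ²`, up to the factor `2 c`. -/
lemma integral_peakon_mul (c z : ℝ) (f : ℝ → ℝ) :
    ∫ x, peakon c (x - z) * f x = 2 * c * invHelmholtz 1 f z := by
  rw [invHelmholtz, ← integral_const_mul]
  congr 1; funext x
  rw [peakon_eq, abs_sub_comm x z]; ring

/-- Pairing with a peakon in the energy space evaluates the potential at the peak. -/
lemma energy_pairing_peakon {f : ℝ → ℝ} (hf : MemLp f 2 volume) (c z : ℝ) :
    (∫ x, peakon c (x - z) * f x) - 3 * ∫ x, peakon c (x - z) * invHelmholtz 2 f x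
      = 2 * c * invHelmholtz 2 f z := by
  have h := isResolvent_invHelmholtz two_pos hf
  have hφ := (isH1_peakon c z).memLp
  rw [← integral_const_mul, ← integral_sub (integrable_mul hφ hf)
    ((integrable_mul hφ h.left.memLp).const_mul 3)]
  have e : ∀ x, peakon c (x - z) * f x - 3 * (peakon c (x - z) * invHelmholtz 2 f x) =
      peakon c (x - z) * (f x - 3 * invHelmholtz 2 f x) := fun x => by ring
  simp only [e]
  rw [integral_peakon_mul]
  congr 1
  refine congrFun (IsResolvent.eq_invHelmholtz one_pos (p := deriv (invHelmholtz 2 f))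
    (hf.sub (h.left.memLp.const_mul 3)) ⟨h.left, ?_⟩) z
  refine h.right.congr (Eventually.of_forall fun x => ?_)
  simp only [Pi.sub_apply]; ring

lemma energy_peakon (c z : ℝ) : energy (fun x => peakon c (x - z)) = c ^ 2 / 3 := by
  have hφ := (isH1_peakon c z).memLp
  have h := energy_pairing_peakon hφ c z
  rw [energy_eq hφ]
  simp only [pow_two] at h ⊢
  rw [h, invHelmholtz_peakon]
  simp
  ring

/-- Distance in the energy space between a function and a translated peakon. -/
lemma energy_sub_peakon {f : ℝ → ℝ} (hf : MemLp f 2 volume) (c z : ℝ) :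
    energy (fun x => f x - peakon c (x - z)) =
      energy f + c ^ 2 / 3 - 4 * c * invHelmholtz 2 f z := by
  have hφ := (isH1_peakon c z).memLp
  have hv := (isResolvent_invHelmholtz two_pos hf).left.memLp
  have hw := (isResolvent_invHelmholtz two_pos hφ).left.memLp
  have hsym := (isResolvent_invHelmholtz two_pos hf).integral_mul_comm
    (isResolvent_invHelmholtz two_pos hφ) hf hφ
  have h1 := energy_pairing_peakon hf c z
  have h2 := energy_peakon c z
  rw [energy_eq hφ] at h2
  have hS : invHelmholtz 2 (fun x => f x - peakon c (x - z)) = fun x =>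
      invHelmholtz 2 f x - invHelmholtz 2 (fun x => peakon c (x - z)) x := by
    have := invHelmholtz_add two_pos hf (hφ.const_mul (-1))
    rw [invHelmholtz_const_mul] at this
    simpa [sub_eq_add_neg] using this
  rw [energy_eq hf, energy_eq (f := fun x => f x - peakon c (x - z)) (hf.sub hφ), hS]
  set φ := fun x => peakon c (x - z)
  set w := invHelmholtz 2 φ
  set v := invHelmholtz 2 f
  have e1 : ∫ x, (f x - φ x) ^ 2 = (∫ x, f x ^ 2) + (∫ x, φ x ^ 2) - 2 * ∫ x, φ x * f x := by
    rw [← integral_const_mul, ← integral_add hf.integrable_sq hφ.integrable_sq,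
      ← integral_sub (hf.integrable_sq.fun_add hφ.integrable_sq)
          ((integrable_mul hφ hf).const_mul 2)]
    congr 1; funext x; ring
  have e2 : ∫ x, (f x - φ x) * (v x - w x) = (∫ x, f x * v x) + (∫ x, φ x * w x)
      - ((∫ x, φ x * v x) + ∫ x, f x * w x) := by
    rw [← integral_add (integrable_mul hf hv) (integrable_mul hφ hw),
      ← integral_add (integrable_mul hφ hv) (integrable_mul hf hw),
      ← integral_sub ((integrable_mul hf hv).fun_add (integrable_mul hφ hw))
        ((integrable_mul hφ hv).fun_add (integrable_mul hf hw))]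
    congr 1; funext x; ring
  have e3 : ∫ x, f x * w x = ∫ x, φ x * v x := by
    rw [hsym]; simp only [mul_comm]; rfl
  have h1' : (∫ x, φ x * f x) - 3 * (∫ x, φ x * v x) = 2 * c * v z := h1
  have h2' : (∫ x, φ x ^ 2) - 3 * (∫ x, φ x * w x) = c ^ 2 / 3 := h2
  have : ∫ x, (f x - peakon c (x - z)) ^ 2 = ∫ x, (f x - φ x) ^ 2 := rfl
  have h' : ∫ x, (f x - peakon c (x - z)) * (v x - w x) = ∫ x, (f x - φ x) * (v x - w x) := rfl
  rw [this, h', e1, e2, e3]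
  linarith

lemma integral_peakon_cube (c : ℝ) : ∫ x, peakon c x ^ 3 = 2 * c ^ 3 / 3 := by
  have h := integral_comp_abs (f := fun y => Real.exp (-3 * y))
  rw [integral_exp_mul_Ioi (by norm_num)] at h
  have e : ∀ x, peakon c x ^ 3 = c ^ 3 * Real.exp (-3 * |x|) := fun x => by
    rw [peakon_eq, mul_pow, ← Real.exp_nat_mul]; push_cast; ring_nf
  simp only [e]
  rw [integral_const_mul, h]
  simp
  ring

/-! ### The static inequality between energy, cubic invariant and maximum -/

lemma hasDerivAt_mul_abs (x : ℝ) : HasDerivAt (fun y : ℝ => y * |y|) (2 * |x|) x := by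
  have key : ∀ y : ℝ, y ≠ 0 → HasDerivAt (fun y : ℝ => y * |y|) (2 * |y|) y := fun y hy => by
    refine ((hasDerivAt_id y).mul (hasDerivAt_abs hy)).congr_deriv ?_
    rcases lt_or_gt_of_ne hy with h | h
    · rw [sign_neg h, abs_of_neg h]; simp; ring
    · rw [sign_pos h, abs_of_pos h]; simp; ring
  exact hasDerivAt_of_hasDerivAt_of_ne' key (by fun_prop) (by fun_prop) x

lemma IsH1.mul_abs {p w : ℝ → ℝ} (hp : IsH1 p w) (hw : Continuous w) :
    IsH1 (fun x => p x * |p x|) (fun x => 2 * |p x| * w x) := by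
  obtain ⟨C, hC0, hC⟩ := hp.exists_bound
  refine IsH1.mk (IsPrimitive.of_hasDerivAt (fun x =>
    (hasDerivAt_mul_abs (p x)).comp x (hp.hasDerivAt hw x)) ?_) (hp.mul_memLp hp.memLp.abs) ?_
  · exact (hp.continuous.abs.const_mul 2).mul hw
  · exact memLp_mul_of_bdd (hp.continuous.abs.const_mul 2) (C := 2 * C) (fun x => by
      rw [abs_mul, abs_abs, abs_two]; gcongr; exact hC x) hp.memLp'

lemma IsH1.integral_mul_deriv_add {f f' g g' : ℝ → ℝ} (hf : IsH1 f f') (hg : IsH1 g g') :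
    Integrable (fun x => f' x * g x + f x * g' x) ∧ ∫ x, (f' x * g x + f x * g' x) = 0 := by
  have h := (integrable_mul hf.memLp' hg.memLp).fun_add (integrable_mul hf.memLp hg.memLp')
  exact ⟨h, (hf.toIsPrimitive.mul hg.toIsPrimitive).integral_eq_zero
    (integrable_mul hf.memLp hg.memLp) h⟩

/-- On either side of its maximum point, the variation of `v` is at least that of a monotone
profile. -/
lemma integral_mul_abs_deriv_ge {v p : ℝ → ℝ} (hv : IsH1 v p) (hp : Continuous p)
    (h0 : ∀ x, 0 ≤ v x) {ξ : ℝ} (hξ : ∀ x, v x ≤ v ξ) :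
    v ξ ^ 3 / 3 ≤ ∫ x, (v ξ - v x) * v x * |p x| := by
  set M := v ξ with hM
  have hder : ∀ x, HasDerivAt (fun x => M / 2 * v x ^ 2 - v x ^ 3 / 3) ((M - v x) * v x * p x) x :=
      by
    intro x
    have h1 := hv.hasDerivAt hp x
    refine (((h1.pow 2).const_mul (M / 2)).sub ((h1.pow 3).div_const 3)).congr_deriv ?_
    push_cast; ring
  have hi : Integrable fun x => (M - v x) * v x * p x := by
    have h := ((integrable_mul hv.memLp hv.memLp').const_mul M).sub
      (integrable_mul (hv.mul_memLp hv.memLp) hv.memLp')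
    refine h.congr (Eventually.of_forall fun x => ?_)
    simp only [Pi.sub_apply]; ring
  have hia : Integrable fun x => (M - v x) * v x * |p x| := by
    refine hi.abs.congr (Eventually.of_forall fun x => ?_)
    simp only
    rw [abs_mul, abs_of_nonneg (mul_nonneg (sub_nonneg.mpr (hξ x)) (h0 x))]
  have hlim : ∀ l, Tendsto v l (𝓝 0) → Tendsto (fun x => M / 2 * v x ^ 2 - v x ^ 3 / 3) l (𝓝 0) :=
      by
    intro l hl
    simpa using ((hl.pow 2).const_mul (M / 2)).sub ((hl.pow 3).div_const 3)
  have h1 := integral_Iic_of_hasDerivAt_of_tendsto' (a := ξ) (fun x _ => hder x) hi.integrableOn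
    (hlim _ hv.tendsto_zero.2)
  have h2 := integral_Ioi_of_hasDerivAt_of_tendsto' (a := ξ) (fun x _ => hder x) hi.integrableOn
    (hlim _ hv.tendsto_zero.1)
  have hnn : ∀ x, 0 ≤ (M - v x) * v x := fun x => mul_nonneg (sub_nonneg.mpr (hξ x)) (h0 x)
  have h3 : ∫ x in Set.Iic ξ, (M - v x) * v x * p x ≤ ∫ x in Set.Iic ξ, (M - v x) * v x * |p x| :=
    integral_mono hi.integrableOn hia.integrableOn fun x =>
      mul_le_mul_of_nonneg_left (le_abs_self _) (hnn x)
  have h4 : -∫ x in Set.Ioi ξ, (M - v x) * v x * p x ≤ ∫ x in Set.Ioi ξ, (M - v x) * v x * |p x| :=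
      by
    rw [← integral_neg]
    refine integral_mono hi.integrableOn.neg hia.integrableOn fun x => ?_
    simp only
    rw [← mul_neg]
    exact mul_le_mul_of_nonneg_left (neg_le_abs _) (hnn x)
  rw [← setIntegral_univ, ← Set.Iic_union_Ioi (a := ξ),
    setIntegral_union (Set.Iic_disjoint_Ioi le_rfl) measurableSet_Ioi hia.integrableOn
      hia.integrableOn]
  simp only [← hM] at h1 h2
  nlinarith

/-- The key inequality `72 M³ - 18 E M + F ≤ 0` between the maximum `M` of the potential `v`, the
energy `E` and the cubic invariant `F`. With `g = 6v - u - 3|v'|` and `h = 12v + u - 6|v'|` it is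
obtained by integrating `(18 M - h) g² ≥ 0`, where `h ≤ 18 M` because `u ≤ 6 v`. Expanding with
`u = 4v - v''`, everything except `18 M E - F` is an exact derivative or the term
`-216 ∫ (M - v) v |v'|`, which is at most `-72 M³`. -/
lemma cubic_inequality {u u' : ℝ → ℝ} (hu : IsH1 u u')
    (h0 : ∀ x, 0 ≤ u x) (h6 : ∀ x, u x ≤ 6 * invHelmholtz 2 u x) {ξ : ℝ}
    (hξ : ∀ x, invHelmholtz 2 u x ≤ invHelmholtz 2 u ξ) :
    72 * invHelmholtz 2 u ξ ^ 3 + ∫ x, u x ^ 3 ≤ 18 * invHelmholtz 2 u ξ * energy u := by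
  have hres := isResolvent_invHelmholtz two_pos hu.memLp
  rw [energy_eq_expand hu.memLp]
  set v := invHelmholtz 2 u
  set p := deriv v
  set M := v ξ
  have hv := hres.left
  have hp : IsH1 p (fun x => 4 * v x - u x) :=
    hres.right.congr (Eventually.of_forall fun x => by norm_num)
  have hv0 : ∀ x, 0 ≤ v x := fun x => by linarith [h0 x, h6 x]
  have hwc : Continuous fun x => 4 * v x - u x := by
    have := hv.continuous; have := hu.continuous; fun_prop
  have hq := hp.mul_abs hwc
  have hpa : MemLp (fun x => |p x|) 2 volume := hp.memLp.abs
  obtain ⟨i1, z1⟩ := hv.integral_mul_deriv_add hp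
  have i3 : Integrable (fun x => 2 * |p x| * (4 * v x - u x)) := by
    have := (integrable_mul hpa hp.memLp').const_mul 2
    simpa only [mul_assoc] using this
  have z3 := hq.integral_eq_zero (integrable_mul hp.memLp hpa) i3
  obtain ⟨i4, z4⟩ := (hv.mul hv).integral_mul_deriv_add hp
  obtain ⟨i5, z5⟩ := (hp.mul hp).integral_mul_deriv_add hp
  obtain ⟨i6, z6⟩ := hv.integral_mul_deriv_add hq
  have iE : Integrable fun x => 4 * v x ^ 2 + 5 * p x ^ 2 + (4 * v x - u x) ^ 2 :=
    ((hv.memLp.integrable_sq.const_mul 4).add (hp.memLp.integrable_sq.const_mul 5)).add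
      hp.memLp'.integrable_sq
  have iF : Integrable fun x => u x ^ 3 := by
    refine (integrable_mul (hu.mul_memLp hu.memLp) hu.memLp).congr
      (Eventually.of_forall fun x => ?_)
    simp only; ring
  have iB : Integrable fun x => (M - v x) * v x * |p x| := by
    have h := ((integrable_mul hv.memLp hpa).const_mul M).sub
      (integrable_mul (hv.mul_memLp hv.memLp) hpa)
    refine h.congr (Eventually.of_forall fun x => ?_)
    simp only [Pi.sub_apply]; ring
  have hB := integral_mul_abs_deriv_ge hv hp.continuous hv0 hξ
  -- The total derivatives produced by expanding the squares.
  have iT := (((((i1.const_mul (72 * M)).fun_add (i3.const_mul (-54 * M))).fun_add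
    (i4.const_mul (-108))).fun_add (i5.const_mul (-9))).fun_add (i6.const_mul 54))
  have zT : ∫ x, (72 * M * (p x * p x + v x * (4 * v x - u x)) + -54 * M *
      (2 * |p x| * (4 * v x - u x))
      + -108 * ((p x * v x + v x * p x) * p x + v x * v x * (4 * v x - u x))
      + -9 * (((4 * v x - u x) * p x + p x * (4 * v x - u x)) * p x + p x * p x * (4 * v x - u x))
      + 54 * (p x * (p x * |p x|) + v x * (2 * |p x| * (4 * v x - u x)))) = 0 := by
    rw [integral_add ((((i1.const_mul (72 * M)).fun_add (i3.const_mul (-54 * M))).fun_add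
      (i4.const_mul (-108))).fun_add (i5.const_mul (-9))) (i6.const_mul 54),
      integral_add (((i1.const_mul (72 * M)).fun_add (i3.const_mul (-54 * M))).fun_add
      (i4.const_mul (-108))) (i5.const_mul (-9)),
      integral_add ((i1.const_mul (72 * M)).fun_add (i3.const_mul (-54 * M))) (i4.const_mul (-108)),
      integral_add (i1.const_mul (72 * M)) (i3.const_mul (-54 * M))]
    simp only [integral_const_mul]
    rw [z1, z3, z4, z5, z6]
    ring
  have hmono : ∫ x, 216 * ((M - v x) * v x * |p x|) ≤
      ∫ x, (18 * M * (4 * v x ^ 2 + 5 * p x ^ 2 + (4 * v x - u x) ^ 2)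
      + (72 * M * (p x * p x + v x * (4 * v x - u x)) + -54 * M * (2 * |p x| * (4 * v x - u x))
      + -108 * ((p x * v x + v x * p x) * p x + v x * v x * (4 * v x - u x))
      + -9 * (((4 * v x - u x) * p x + p x * (4 * v x - u x)) * p x + p x * p x * (4 * v x - u x))
      + 54 * (p x * (p x * |p x|) + v x * (2 * |p x| * (4 * v x - u x)))) - u x ^ 3) := by
    refine integral_mono (iB.const_mul 216) (((iE.const_mul (18 * M)).add iT).sub iF) fun x => ?_
    simp only
    have hh : 0 ≤ (18 * M - (12 * v x + u x - 6 * |p x|)) * (6 * v x - u x - 3 * |p x|) ^ 2 := by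
      refine mul_nonneg ?_ (sq_nonneg _)
      linarith [h6 x, hξ x, abs_nonneg (p x)]
    have hs : |p x| ^ 2 = p x ^ 2 := sq_abs _
    linear_combination hh + (18 * M * 9 - (12 * v x + u x) * 9 + 36 * (6 * v x - u x) *
        (-1) + 54 * |p x|) * hs
  rw [integral_sub ((iE.const_mul (18 * M)).fun_add iT) iF, integral_add (iE.const_mul (18 * M)) iT,
    zT, integral_const_mul, integral_const_mul] at hmono
  linarith

/-- A nonnegative potential vanishing at infinity attains its maximum. -/
lemma exists_isMaxOn {v p : ℝ → ℝ} (hv : IsH1 v p) (h0 : ∀ x, 0 ≤ v x) :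
    ∃ ξ, IsMaxOn v Set.univ ξ := by
  by_cases h : ∀ x, v x = 0
  · exact ⟨0, fun x _ => by simp [h]⟩
  push Not at h
  obtain ⟨a, ha⟩ := h
  have hpos : 0 < v a := lt_of_le_of_ne (h0 a) (Ne.symm ha)
  have hev : ∀ᶠ x in cocompact ℝ, v x ≤ v a := by
    rw [cocompact_eq_atBot_atTop]
    exact eventually_sup.mpr ⟨(hv.tendsto_zero.2.eventually_lt_const hpos).mono fun _ => le_of_lt,
      (hv.tendsto_zero.1.eventually_lt_const hpos).mono fun _ => le_of_lt⟩
  obtain ⟨x, hx⟩ := hv.continuous.exists_forall_ge' a hev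
  exact ⟨x, fun y _ => hx y⟩

lemma sq_invHelmholtz_le_energy {f : ℝ → ℝ} (hf : MemLp f 2 volume) (x : ℝ) :
    invHelmholtz 2 f x ^ 2 ≤ energy f := by
  have h := isResolvent_invHelmholtz two_pos hf
  have h1 := h.left.sq_le x
  have h2 := h.integral_mul_self hf
  have h3 := integral_mul_invHelmholtz_le_energy hf
  have h4 : 0 ≤ ∫ x, invHelmholtz 2 f x ^ 2 := integral_nonneg fun x => sq_nonneg _
  linarith

lemma sq_cube_quotient_le {a b A B : ℝ} (ha : 0 ≤ a) (hA : a ≤ A) (hb : 0 ≤ b) (hB : b ≤ B) :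
    (a ^ 2 + a * b + b ^ 2) ^ 2 ≤ (2 * (A + B) ^ 2) * (a ^ 2 + b ^ 2) := by
  have h1 : a ^ 2 + a * b + b ^ 2 ≤ (A + B) * (a + b) := by
    nlinarith [mul_nonneg ha hb, mul_nonneg ha (sub_nonneg.mpr hA),
      mul_nonneg hb (sub_nonneg.mpr hB), mul_nonneg hb (ha.trans hA), mul_nonneg ha (hb.trans hB)]
  have h2 := pow_le_pow_left₀ (by positivity) h1 2
  refine h2.trans ?_
  rw [mul_pow]
  nlinarith [mul_nonneg (sq_nonneg (A + B)) (sq_nonneg (a - b))]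

/-- Closeness of energy and cubic invariant to those of the peakon, for a function close to the
peakon in the energy norm. -/
lemma invariants_near_peakon {c : ℝ} (hc : 0 < c) : ∃ K : ℝ, 0 ≤ K ∧
    ∀ (u u' : ℝ → ℝ), IsH1 u u' → (∀ x, 0 ≤ u x) → (∀ x, u x ≤ 6 * invHelmholtz 2 u x) →
    ∀ ε : ℝ, 0 < ε → ε < 1 → energy (fun x => u x - peakon c x) ≤ (ε ^ 2) ^ 2 →
      |energy u - c ^ 2 / 3| ≤ (1 + 4 * c) * ε ^ 2 ∧
      |(∫ x, u x ^ 3) - 2 * c ^ 3 / 3| ≤ K * ε ^ 2 := by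
  set E₁ := c ^ 2 / 3 + (1 + 4 * c)
  have hE₁ : 0 ≤ E₁ := by positivity
  set B := 6 * Real.sqrt E₁
  refine ⟨2 + 4 * (B + c) ^ 2 * (E₁ + c ^ 2 / 3), by positivity, ?_⟩
  intro u u' hu h0 h6 ε hε hε1 hd
  have hφ := isH1_peakon c 0
  simp only [sub_zero] at hφ
  have hEφ : energy (fun x => peakon c x) = c ^ 2 / 3 := by simpa using energy_peakon c 0
  have hdm : MemLp (fun x => u x - peakon c x) 2 volume := hu.memLp.sub hφ.memLp
  have h4 : (ε ^ 2) ^ 2 ≤ ε ^ 2 := by nlinarith [sq_nonneg ε, pow_le_one₀ (n := 2) hε.le hε1.le]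
  -- expand the energy of `u = (u - φ) + φ`
  have hexp : energy u = energy (fun x => u x - peakon c x) + c ^ 2 / 3
      + 4 * c * invHelmholtz 2 (fun x => u x - peakon c x) 0 := by
    have h1 := energy_sub_peakon hdm (-c) 0
    have e : (fun x => u x - peakon c x - peakon (-c) (x - 0)) = u := by
      funext x; simp [peakon]
    rw [e] at h1
    rw [h1]; ring
  have hpt : |invHelmholtz 2 (fun x => u x - peakon c x) 0| ≤ ε ^ 2 :=
    abs_le_of_sq_le_sq ((sq_invHelmholtz_le_energy hdm 0).trans hd) (sq_nonneg ε)
  have hE : |energy u - c ^ 2 / 3| ≤ (1 + 4 * c) * ε ^ 2 := by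
    obtain ⟨hp1, hp2⟩ := abs_le.mp hpt
    have h00 := energy_nonneg (fun x => u x - peakon c x)
    have m1 := mul_le_mul_of_nonneg_left hp1 hc.le
    have m2 := mul_le_mul_of_nonneg_left hp2 hc.le
    rw [abs_le]
    constructor <;> nlinarith [sq_nonneg ε]
  refine ⟨hE, ?_⟩
  have hEu : energy u ≤ E₁ := by
    have := (abs_le.mp hE).2
    have h2 : ε ^ 2 ≤ 1 := pow_le_one₀ hε.le hε1.le
    have : (1 + 4 * c) * ε ^ 2 ≤ (1 + 4 * c) := by nlinarith
    simp only [E₁]; linarith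
  have huB : ∀ x, u x ≤ B := fun x => by
    have h1 := Real.abs_le_sqrt ((sq_invHelmholtz_le_energy hu.memLp x).trans hEu)
    simp only [B]
    linarith [h6 x, le_abs_self (invHelmholtz 2 u x)]
  have hφ0 : ∀ x, 0 ≤ peakon c x := fun x => by unfold peakon; positivity
  have hφc : ∀ x, peakon c x ≤ c := fun x => by
    unfold peakon
    have : Real.exp (-|x|) ≤ 1 := Real.exp_le_one_iff.mpr (by simp)
    nlinarith
  have id2 := hdm.integrable_sq
  have iu2 := hu.memLp.integrable_sq
  have iφ2 := hφ.memLp.integrable_sq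
  have icube : ∀ {f f' : ℝ → ℝ}, IsH1 f f' → Integrable fun x => f x ^ 3 := fun {f f'} hf => by
    refine (integrable_mul (hf.mul_memLp hf.memLp) hf.memLp).congr
      (Eventually.of_forall fun x => ?_)
    simp only; ring
  have hcube : ∫ x, peakon c x ^ 3 = 2 * c ^ 3 / 3 := integral_peakon_cube c
  rw [← hcube, ← integral_sub (icube hu) (icube hφ)]
  have hε2 : 0 < ε ^ 2 := by positivity
  calc |∫ x, (u x ^ 3 - peakon c x ^ 3)|
      ≤ ∫ x, ((1 / 2) * (1 / ε ^ 2) * (u x - peakon c x) ^ 2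
          + (1 / 2 * ε ^ 2) * ((2 * (B + c) ^ 2) * (u x ^ 2 + peakon c x ^ 2))) := by
        rw [← Real.norm_eq_abs]
        refine norm_integral_le_of_norm_le ((id2.const_mul _).add
          (((iu2.add iφ2).const_mul _).const_mul _)) (Eventually.of_forall fun x => ?_)
        set d := u x - peakon c x
        set q := u x ^ 2 + u x * peakon c x + peakon c x ^ 2
        have hq2 : q ^ 2 ≤ (2 * (B + c) ^ 2) * (u x ^ 2 + peakon c x ^ 2) :=
          sq_cube_quotient_le (h0 x) (huB x) (hφ0 x) (hφc x)
        have e : u x ^ 3 - peakon c x ^ 3 = d * q := by simp only [d, q]; ring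
        rw [e, Real.norm_eq_abs]
        have h1 : |d * q| ≤ (1 / 2) * (1 / ε ^ 2) * d ^ 2 + (1 / 2 * ε ^ 2) * q ^ 2 := by
          rw [abs_le]
          have s1 : (1 / 2) * (1 / ε ^ 2) * d ^ 2 + (1 / 2 * ε ^ 2) * q ^ 2 - d * q
            = 1 / 2 * (d / ε - ε * q) ^ 2 := by field_simp; ring
          have s2 : (1 / 2) * (1 / ε ^ 2) * d ^ 2 + (1 / 2 * ε ^ 2) * q ^ 2 + d * q
            = 1 / 2 * (d / ε + ε * q) ^ 2 := by field_simp; ring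
          have p1 : 0 ≤ 1 / 2 * (d / ε - ε * q) ^ 2 := by positivity
          have p2 : 0 ≤ 1 / 2 * (d / ε + ε * q) ^ 2 := by positivity
          constructor <;> linarith
        have h2 := mul_le_mul_of_nonneg_left hq2 (by positivity : 0 ≤ 1 / 2 * ε ^ 2)
        exact h1.trans (by linarith)
    _ = (1 / 2) * (1 / ε ^ 2) * (∫ x, (u x - peakon c x) ^ 2)
          + (1 / 2 * ε ^ 2) * ((2 * (B + c) ^ 2) * ((∫ x, u x ^ 2) + ∫ x, peakon c x ^ 2)) := by
        rw [integral_add (id2.const_mul _) (((iu2.fun_add iφ2).const_mul _).const_mul _),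
          integral_const_mul, integral_const_mul, integral_const_mul, integral_add iu2 iφ2]
    _ ≤ (1 / 2) * (1 / ε ^ 2) * (4 * (ε ^ 2) ^ 2)
          + (1 / 2 * ε ^ 2) * ((2 * (B + c) ^ 2) * (4 * E₁ + 4 * (c ^ 2 / 3))) := by
        have t1 := (integral_sq_le_energy hdm).trans (mul_le_mul_of_nonneg_left hd (by norm_num))
        have t2 := (integral_sq_le_energy hu.memLp).trans
            (mul_le_mul_of_nonneg_left hEu (by norm_num))
        have t3 := integral_sq_le_energy hφ.memLp
        rw [hEφ] at t3
        gcongr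
    _ = _ := by field_simp; ring

/-- The stability estimate for functions sharing the invariants of a datum close to the peakon.
The cubic inequality with the invariants of the peakon reads `(M - c / 6)² (M + c / 3) ≤ 0`, so
perturbing the invariants by `O(ε²)` moves `M` by `O(ε)`, and the squared distance to the peakon
at the maximum point is affine in `M`. -/
lemma static_stability {c : ℝ} (hc : 0 < c) : ∃ C : ℝ, 0 < C ∧
    ∀ (u₀ u₀' u u' : ℝ → ℝ), IsH1 u₀ u₀' → (∀ x, 0 ≤ u₀ x) →
      (∀ x, u₀ x ≤ 6 * invHelmholtz 2 u₀ x) → IsH1 u u' → (∀ x, 0 ≤ u x) →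
      (∀ x, u x ≤ 6 * invHelmholtz 2 u x) → energy u = energy u₀ →
      ∫ x, u x ^ 3 = ∫ x, u₀ x ^ 3 →
    ∀ ε : ℝ, 0 < ε → ε < 1 → energyNorm (fun x => u₀ x - peakon c x) ≤ ε ^ 2 →
    ∀ ξ : ℝ, IsMaxOn (invHelmholtz 2 u) Set.univ ξ →
      energyNorm (fun x => u x - peakon c (x - ξ)) ≤ C * Real.sqrt ε := by
  obtain ⟨K, hK, hinv⟩ := invariants_near_peakon hc
  set B := Real.sqrt (c ^ 2 / 3 + (1 + 4 * c))
  set K₂ := 3 / c * ((1 + 4 * c) * B / 4 + K / 72)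
  have hK₂ : 0 ≤ K₂ := by positivity
  refine ⟨Real.sqrt ((1 + 4 * c) + 4 * c * Real.sqrt K₂), by positivity, ?_⟩
  intro u₀ u₀' u u' hu₀ h0₀ h6₀ hu h0 h6 hE hF ε hε hε1 hd ξ hξ
  have hd' : energy (fun x => u₀ x - peakon c x) ≤ (ε ^ 2) ^ 2 := by
    rw [energyNorm, Real.sqrt_le_left (by positivity)] at hd
    exact hd
  obtain ⟨h1, h2⟩ := hinv u₀ u₀' hu₀ h0₀ h6₀ ε hε hε1 hd'
  rw [← hE] at h1
  rw [← hF] at h2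
  have hmax : ∀ x, invHelmholtz 2 u x ≤ invHelmholtz 2 u ξ := fun x => hξ (Set.mem_univ x)
  have hcub := cubic_inequality hu h0 h6 hmax
  have hM2 := sq_invHelmholtz_le_energy hu.memLp ξ
  rw [energyNorm, energy_sub_peakon hu.memLp, ← Real.sqrt_mul (by positivity)]
  refine Real.sqrt_le_sqrt ?_
  set M := invHelmholtz 2 u ξ
  have hM0 : 0 ≤ M := by linarith [h0 ξ, h6 ξ]
  have hε2 : ε ^ 2 ≤ 1 := pow_le_one₀ hε.le hε1.le
  have hεε : ε ^ 2 ≤ ε := by nlinarith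
  obtain ⟨a1, a2⟩ := abs_le.mp h1
  obtain ⟨b1, b2⟩ := abs_le.mp h2
  have hMB : M ≤ B := by
    refine Real.le_sqrt_of_sq_le (hM2.trans ?_)
    nlinarith
  -- the cubic with double root `c / 6`
  have hsq : (M - c / 6) ^ 2 ≤ ε ^ 2 * K₂ := by
    have e1 : (M - c / 6) ^ 2 * (M + c / 3) ≤ ε ^ 2 * ((1 + 4 * c) * B / 4 + K / 72) := by
      have e2 : (energy u - c ^ 2 / 3) * M ≤ (1 + 4 * c) * ε ^ 2 * B :=
        (mul_le_mul_of_nonneg_right a2 hM0).trans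
          (mul_le_mul_of_nonneg_left hMB (by positivity))
      nlinarith
    have e3 : (M - c / 6) ^ 2 * (c / 3) ≤ (M - c / 6) ^ 2 * (M + c / 3) := by
      gcongr; linarith
    have e4 : (M - c / 6) ^ 2 = 3 / c * ((M - c / 6) ^ 2 * (c / 3)) := by field_simp
    rw [e4]
    calc 3 / c * ((M - c / 6) ^ 2 * (c / 3)) ≤ 3 / c * (ε ^ 2 * ((1 + 4 * c) * B / 4 + K / 72)) :=
        by
          exact mul_le_mul_of_nonneg_left (e3.trans e1) (by positivity)
      _ = _ := by simp only [K₂]; ring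
  have habs : |M - c / 6| ≤ ε * Real.sqrt K₂ := by
    have := Real.abs_le_sqrt hsq
    rwa [Real.sqrt_mul (by positivity), Real.sqrt_sq hε.le] at this
  have hlow := (abs_le.mp habs).1
  have hfin : 4 * c * (c / 6 - M) ≤ 4 * c * (ε * Real.sqrt K₂) := by
    gcongr; linarith
  nlinarith

open scoped InnerProductSpace

/-! ### The Hilbert space `L²(ℝ)` and the resolvents as bounded operators -/

/-- The Hilbert space `L²(ℝ)`. -/
abbrev L2 : Type := Lp ℝ 2 (volume : Measure ℝ)

open Classical in
/-- The class of `f` in `L²(ℝ)`, with value `0` when `f` is not square integrable. -/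
noncomputable def toL2 (f : ℝ → ℝ) : L2 := if h : MemLp f 2 volume then h.toLp f else 0

lemma toL2_coe {f : ℝ → ℝ} (hf : MemLp f 2 volume) : toL2 f =ᵐ[volume] f := by
  rw [toL2, dif_pos hf]; exact hf.coeFn_toLp

lemma toL2_congr {f g : ℝ → ℝ} (h : f =ᵐ[volume] g) : toL2 f = toL2 g := by
  unfold toL2
  by_cases hf : MemLp f 2 volume
  · have hg : MemLp g 2 volume := hf.ae_eq h
    rw [dif_pos hf, dif_pos hg]
    exact (MemLp.toLp_eq_toLp_iff hf hg).mpr h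
  · have hg : ¬ MemLp g 2 volume := fun hg => hf (hg.ae_eq h.symm)
    rw [dif_neg hf, dif_neg hg]

lemma toL2_self (F : L2) : toL2 F = F := by
  rw [toL2, dif_pos (Lp.memLp F)]; exact Lp.toLp_coeFn F _

lemma toL2_add {f g : ℝ → ℝ} (hf : MemLp f 2 volume) (hg : MemLp g 2 volume) :
    toL2 (fun x => f x + g x) = toL2 f + toL2 g := by
  have : MemLp (fun x => f x + g x) 2 volume := hf.add hg
  rw [toL2, toL2, toL2, dif_pos hf, dif_pos hg, dif_pos this]; rfl

lemma toL2_const_mul {f : ℝ → ℝ} (c : ℝ) (hf : MemLp f 2 volume) :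
    toL2 (fun x => c * f x) = c • toL2 f := by
  have : MemLp (fun x => c * f x) 2 volume := hf.const_mul c
  rw [toL2, toL2, dif_pos hf, dif_pos this]; rfl

lemma toL2_sub {f g : ℝ → ℝ} (hf : MemLp f 2 volume) (hg : MemLp g 2 volume) :
    toL2 (fun x => f x - g x) = toL2 f - toL2 g := by
  have : MemLp (fun x => f x - g x) 2 volume := hf.sub hg
  rw [toL2, toL2, toL2, dif_pos hf, dif_pos hg, dif_pos this]; rfl

lemma inner_toL2 {f g : ℝ → ℝ} (hf : MemLp f 2 volume) (hg : MemLp g 2 volume) :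
    ⟪toL2 f, toL2 g⟫_ℝ = ∫ x, f x * g x := by
  rw [L2.inner_def]
  refine integral_congr_ae ?_
  filter_upwards [toL2_coe hf, toL2_coe hg] with x h1 h2
  rw [h1, h2]
  simp [mul_comm]

lemma norm_toL2_sq {f : ℝ → ℝ} (hf : MemLp f 2 volume) : ‖toL2 f‖ ^ 2 = ∫ x, f x ^ 2 := by
  rw [← real_inner_self_eq_norm_sq, inner_toL2 hf hf]
  simp only [pow_two]

lemma memLp_invHelmholtz {k : ℝ} (hk : 0 < k) {f : ℝ → ℝ} (hf : MemLp f 2 volume) :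
    MemLp (invHelmholtz k f) 2 volume := (isResolvent_invHelmholtz hk hf).left.memLp

/-- The operator `(k² - ∂ₓ²)⁻¹` on `L²(ℝ)`. -/
noncomputable def resolvent {k : ℝ} (hk : 0 < k) : L2 →L[ℝ] L2 :=
  LinearMap.mkContinuous
    { toFun := fun F => toL2 (invHelmholtz k F)
      map_add' := fun F G => by
        rw [← toL2_add (memLp_invHelmholtz hk (Lp.memLp F)) (memLp_invHelmholtz hk (Lp.memLp G)),
          ← invHelmholtz_add hk (Lp.memLp F) (Lp.memLp G), invHelmholtz_congr (Lp.coeFn_add F G)]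
        rfl
      map_smul' := fun c F => by
        rw [RingHom.id_apply, ← toL2_const_mul c (memLp_invHelmholtz hk (Lp.memLp F)),
          ← invHelmholtz_const_mul, invHelmholtz_congr (Lp.coeFn_smul c F)]
        rfl }
    (k ^ 2)⁻¹ (fun F => by
      have hF := Lp.memLp F
      have h := (isResolvent_invHelmholtz hk hF).integral_mul_self hF
      have hm := memLp_invHelmholtz hk hF
      have h2 : 0 ≤ ∫ x, deriv (invHelmholtz k F) x ^ 2 := integral_nonneg fun x => sq_nonneg _
      rw [← inner_toL2 hF hm, ← norm_toL2_sq hm, toL2_self] at h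
      have h3 := real_inner_le_norm F (toL2 (invHelmholtz k F))
      simp only [LinearMap.coe_mk, AddHom.coe_mk]
      rw [inv_mul_eq_div, le_div_iff₀ (by positivity)]
      by_contra hcon
      push Not at hcon
      have h0 : 0 < ‖toL2 (invHelmholtz k F)‖ := by
        by_contra h00
        have : ‖toL2 (invHelmholtz k F)‖ = 0 := le_antisymm (not_lt.mp h00) (norm_nonneg _)
        rw [this] at hcon
        linarith [norm_nonneg F]
      nlinarith)

lemma resolvent_toL2 {k : ℝ} (hk : 0 < k) {f : ℝ → ℝ} (hf : MemLp f 2 volume) :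
    resolvent hk (toL2 f) = toL2 (invHelmholtz k f) := by
  change toL2 (invHelmholtz k (toL2 f)) = _
  rw [invHelmholtz_congr (toL2_coe hf)]

lemma resolvent_symm {k : ℝ} (hk : 0 < k) (F G : L2) :
    ⟪resolvent hk F, G⟫_ℝ = ⟪F, resolvent hk G⟫_ℝ := by
  rw [← toL2_self F, ← toL2_self G, resolvent_toL2 hk (Lp.memLp F), resolvent_toL2 hk (Lp.memLp G),
    inner_toL2 (memLp_invHelmholtz hk (Lp.memLp F)) (Lp.memLp G),
    inner_toL2 (Lp.memLp F) (memLp_invHelmholtz hk (Lp.memLp G))]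
  exact ((isResolvent_invHelmholtz hk (Lp.memLp F)).integral_mul_comm
    (isResolvent_invHelmholtz hk (Lp.memLp G)) (Lp.memLp F) (Lp.memLp G)).symm

/-- The operator `1 + 3 (1 - ∂ₓ²)⁻¹ = (4 - ∂ₓ²) (1 - ∂ₓ²)⁻¹`; the Degasperis–Procesi equation is
`u_t = - fluxOp (u uₓ)`. -/
noncomputable def fluxOp : L2 →L[ℝ] L2 := ContinuousLinearMap.id ℝ L2 + (3 : ℝ) • resolvent one_pos

/-- The operator `1 - 3 (4 - ∂ₓ²)⁻¹ = (1 - ∂ₓ²) (4 - ∂ₓ²)⁻¹`, which represents the energy. -/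
noncomputable def energyOp : L2 →L[ℝ] L2 := ContinuousLinearMap.id ℝ L2 -
    (3 : ℝ) • resolvent two_pos

lemma fluxOp_apply (F : L2) : fluxOp F = F + (3 : ℝ) • resolvent one_pos F := rfl

lemma energyOp_apply (F : L2) : energyOp F = F - (3 : ℝ) • resolvent two_pos F := rfl

lemma fluxOp_symm (F G : L2) : ⟪fluxOp F, G⟫_ℝ = ⟪F, fluxOp G⟫_ℝ := by
  simp only [fluxOp_apply, inner_add_left, inner_add_right, inner_smul_left, inner_smul_right,
    resolvent_symm]
  rfl

lemma energyOp_symm (F G : L2) : ⟪energyOp F, G⟫_ℝ = ⟪F, energyOp G⟫_ℝ := by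
  simp only [energyOp_apply, inner_sub_left, inner_sub_right, inner_smul_left, inner_smul_right,
    resolvent_symm]
  rfl

/-- The two operators are inverse to each other, so the equation reads `energyOp u_t = - u uₓ`. -/
lemma energyOp_fluxOp (F : L2) : energyOp (fluxOp F) = F := by
  have hF := Lp.memLp F
  have h := isResolvent_invHelmholtz one_pos hF
  have hm := h.left.memLp
  have h2 : IsResolvent 2 (fun x => F x + 3 * invHelmholtz 1 F x) (invHelmholtz 1 F)
      (deriv (invHelmholtz 1 F)) :=
    ⟨h.left, h.right.congr (Eventually.of_forall fun x => by ring)⟩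
  have e : fluxOp F = toL2 (fun x => F x + 3 * invHelmholtz 1 F x) := by
    rw [toL2_add hF (hm.const_mul 3), toL2_const_mul 3 hm, ← resolvent_toL2 one_pos hF, toL2_self,
      fluxOp_apply]
  have hs : MemLp (fun x => F x + 3 * invHelmholtz 1 F x) 2 volume := hF.add (hm.const_mul 3)
  have e2 : resolvent two_pos (fluxOp F) = resolvent one_pos F := by
    rw [e, resolvent_toL2 two_pos hs, h2.eq_invHelmholtz two_pos hs, ← resolvent_toL2 one_pos hF,
      toL2_self]
  rw [energyOp_apply, e2, fluxOp_apply]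
  abel

lemma energy_eq_inner {f : ℝ → ℝ} (hf : MemLp f 2 volume) :
    energy f = ⟪toL2 f, energyOp (toL2 f)⟫_ℝ := by
  rw [energyOp_apply, inner_sub_right, inner_smul_right, resolvent_toL2 two_pos hf,
    inner_toL2 hf hf, inner_toL2 hf (memLp_invHelmholtz two_pos hf), energy_eq hf]
  simp only [pow_two]

/-! ### Products of continuous families -/

lemma IsH1.norm_toL2_mul_le {f f' g : ℝ → ℝ} (hf : IsH1 f f') (hg : MemLp g 2 volume) :
    ‖toL2 (fun x => f x * g x)‖ ≤ (‖toL2 f‖ + ‖toL2 f'‖) * ‖toL2 g‖ := by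
  refine le_of_sq_le_sq ?_ (by positivity)
  rw [norm_toL2_sq (hf.mul_memLp hg), mul_pow, norm_toL2_sq hg, ← integral_const_mul]
  refine integral_mono (hf.mul_memLp hg).integrable_sq (hg.integrable_sq.const_mul _) fun x => ?_
  simp only [mul_pow]
  refine mul_le_mul_of_nonneg_right ?_ (sq_nonneg _)
  refine (hf.sq_le x).trans ?_
  rw [← norm_toL2_sq hf.memLp, ← norm_toL2_sq hf.memLp']
  nlinarith [norm_nonneg (toL2 f), norm_nonneg (toL2 f')]

lemma continuousOn_toL2_mul {s : Set ℝ} {f f' g : ℝ → ℝ → ℝ}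
    (hf : ∀ t ∈ s, IsH1 (f t) (f' t)) (hg : ∀ t ∈ s, MemLp (g t) 2 volume)
    (cf : ContinuousOn (fun t => toL2 (f t)) s) (cf' : ContinuousOn (fun t => toL2 (f' t)) s)
    (cg : ContinuousOn (fun t => toL2 (g t)) s) :
    ContinuousOn (fun t => toL2 (fun x => f t x * g t x)) s := by
  intro t ht
  have b1 : Tendsto (fun r => ‖toL2 (f r) - toL2 (f t)‖ + ‖toL2 (f' r) - toL2 (f' t)‖) (𝓝[s] t)
      (𝓝 0) := by
    have h1 := (cf t ht).sub_const (toL2 (f t)) |>.norm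
    have h2 := (cf' t ht).sub_const (toL2 (f' t)) |>.norm
    simpa using h1.add h2
  have b2 : Tendsto (fun r => ‖toL2 (g r) - toL2 (g t)‖) (𝓝[s] t) (𝓝 0) := by
    have h1 := (cg t ht).sub_const (toL2 (g t)) |>.norm
    simpa using h1
  have b3 := (b1.mul (cg t ht).norm).add (b2.const_mul (‖toL2 (f t)‖ + ‖toL2 (f' t)‖))
  simp only [zero_mul, mul_zero, add_zero] at b3
  refine tendsto_iff_norm_sub_tendsto_zero.mpr (squeeze_zero' (Eventually.of_forall fun r =>
    norm_nonneg _) ?_ b3)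
  filter_upwards [self_mem_nhdsWithin] with r hr
  have hd := (hf r hr).sub (hf t ht)
  have hgd : MemLp (fun x => g r x - g t x) 2 volume := (hg r hr).sub (hg t ht)
  have e : toL2 (fun x => f r x * g r x) - toL2 (fun x => f t x * g t x) =
      toL2 (fun x => (f r x - f t x) * g r x) + toL2 (fun x => f t x * (g r x - g t x)) := by
    rw [← toL2_sub ((hf r hr).mul_memLp (hg r hr)) ((hf t ht).mul_memLp (hg t ht)),
      ← toL2_add (hd.mul_memLp (hg r hr)) ((hf t ht).mul_memLp hgd)]
    congr 1; funext x; ring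
  rw [e]
  refine (norm_add_le _ _).trans (add_le_add ?_ ?_)
  · have := hd.norm_toL2_mul_le (hg r hr)
    rwa [toL2_sub (hf r hr).memLp (hf t ht).memLp, toL2_sub (hf r hr).memLp'
        (hf t ht).memLp'] at this
  · have := (hf t ht).norm_toL2_mul_le hgd
    rwa [toL2_sub (hg r hr) (hg t ht)] at this

/-! ### From weak to strong time derivatives -/

/-- A curve in a Hilbert space that has a continuous weak derivative, when tested against a dense
set of vectors, is continuously differentiable. -/
lemma hasDerivWithinAt_of_weak {H : Type*} [NormedAddCommGroup H] [InnerProductSpace ℝ H]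
    [CompleteSpace H] {τ : ℝ} (hτ : 0 ≤ τ) {U V : ℝ → H} {D : Set H} (hD : Dense D)
    (hV : ContinuousOn V (Set.Icc 0 τ))
    (h : ∀ ψ ∈ D, ∀ t ∈ Set.Icc 0 τ, ⟪ψ, U t⟫_ℝ - ⟪ψ, U 0⟫_ℝ = ∫ s in (0 : ℝ)..t, ⟪ψ, V s⟫_ℝ) :
    ∀ t ∈ Set.Icc 0 τ, HasDerivWithinAt U (V t) (Set.Icc 0 τ) t := by
  set W : ℝ → H := Set.IccExtend hτ (Set.domRestrict (Set.Icc 0 τ) V)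
  have hW : Continuous W := (continuousOn_iff_continuous_domRestrict.mp hV).Icc_extend'
  have hWV : ∀ s ∈ Set.Icc 0 τ, W s = V s := fun s hs => by
    simp only [W, Set.IccExtend_of_mem hτ _ hs, Set.domRestrict_apply]
  have hU : ∀ t ∈ Set.Icc 0 τ, U t = U 0 + ∫ s in (0 : ℝ)..t, W s := by
    intro t ht
    refine hD.eq_of_inner_right ℝ fun ψ hψ => ?_
    have h1 := h ψ hψ t ht
    have h2 : ∫ s in (0 : ℝ)..t, ⟪ψ, V s⟫_ℝ = ⟪ψ, ∫ s in (0 : ℝ)..t, W s⟫_ℝ := by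
      rw [← innerSL_apply_apply ℝ ψ, ← ContinuousLinearMap.intervalIntegral_comp_comm _
        (hW.intervalIntegrable 0 t)]
      refine intervalIntegral.integral_congr fun s hs => ?_
      rw [Set.uIcc_of_le ht.1] at hs
      simp only [innerSL_apply_apply, hWV s ⟨hs.1, hs.2.trans ht.2⟩]
    rw [inner_add_right, ← h2]
    linarith
  intro t ht
  have h1 : HasDerivAt (fun t => U 0 + ∫ s in (0 : ℝ)..t, W s) (W t) t :=
    (hW.integral_hasStrictDerivAt 0 t).hasDerivAt.const_add _
  rw [hWV t ht] at h1
  exact h1.hasDerivWithinAt.congr hU (hU t ht)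

/-! ### Strong solutions and their invariants -/

/-- A curve in `H¹` on `[0, τ]`, continuously differentiable in `L²`, that satisfies the
Degasperis–Procesi equation `u_t = - fluxOp (u uₓ)`. -/
structure IsStrongSolution (τ : ℝ) (u ux : ℝ → ℝ → ℝ) : Prop where
  isH1 : ∀ t ∈ Set.Icc 0 τ, IsH1 (u t) (ux t)
  cont : ContinuousOn (fun t => toL2 (u t)) (Set.Icc 0 τ)
  contx : ContinuousOn (fun t => toL2 (ux t)) (Set.Icc 0 τ)
  hasDeriv : ∀ t ∈ Set.Icc 0 τ, HasDerivWithinAt (fun s => toL2 (u s))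
    (-fluxOp (toL2 fun x => u t x * ux t x)) (Set.Icc 0 τ) t

lemma constant_of_hasDerivWithinAt_zero {τ : ℝ} {f : ℝ → ℝ}
    (h : ∀ t ∈ Set.Icc 0 τ, HasDerivWithinAt f 0 (Set.Icc 0 τ) t) :
    ∀ t ∈ Set.Icc 0 τ, f t = f 0 :=
  constant_of_has_deriv_right_zero (fun t ht => (h t ht).continuousWithinAt) fun t ht =>
    (h t ⟨ht.1, ht.2.le⟩).mono_of_mem_nhdsWithin (Icc_mem_nhdsGE_of_mem ht)

lemma IsH1.integral_self_mul_deriv {f f' : ℝ → ℝ} (hf : IsH1 f f') : ∫ x, f x * f' x = 0 := by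
  have h := hf.integral_mul_deriv hf
  simp only [mul_comm (f' _)] at h
  linarith

lemma hasDerivWithinAt_energy {s : Set ℝ} {U : ℝ → L2} {U' : L2} {t : ℝ}
    (h : HasDerivWithinAt U U' s t) :
    HasDerivWithinAt (fun r => ⟪U r, energyOp (U r)⟫_ℝ) (2 * ⟪U t, energyOp U'⟫_ℝ) s t := by
  refine (h.inner ℝ (energyOp.hasFDerivAt.comp_hasDerivWithinAt t h)).congr_deriv ?_
  simp only [Function.comp_def]
  rw [← energyOp_symm U', real_inner_comm]
  ring

/-- Conservation of the energy. -/
lemma IsStrongSolution.energy_eq {τ : ℝ} {u ux : ℝ → ℝ → ℝ} (h : IsStrongSolution τ u ux) :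
    ∀ t ∈ Set.Icc 0 τ, energy (u t) = energy (u 0) := by
  have key := constant_of_hasDerivWithinAt_zero (τ := τ)
    (f := fun t => ⟪toL2 (u t), energyOp (toL2 (u t))⟫_ℝ) fun t ht => by
      have hu := h.isH1 t ht
      refine (hasDerivWithinAt_energy (h.hasDeriv t ht)).congr_deriv ?_
      rw [map_neg, energyOp_fluxOp, inner_neg_right, inner_toL2 hu.memLp (hu.mul_memLp hu.memLp')]
      have h1 := (hu.mul hu).integral_mul_deriv hu
      have e : ∀ x, (ux t x * u t x + u t x * ux t x) * u t x = 2 * (u t x * u t x * ux t x) :=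
        fun x => by ring
      simp only [e, integral_const_mul] at h1
      have e2 : ∀ x, u t x * (u t x * ux t x) = u t x * u t x * ux t x := fun x => by ring
      simp only [e2]
      linarith
  intro t ht
  have h0 : (0 : ℝ) ∈ Set.Icc 0 τ := ⟨le_rfl, ht.1.trans ht.2⟩
  rw [energy_eq_inner (h.isH1 t ht).memLp, energy_eq_inner (h.isH1 0 h0).memLp]
  exact key t ht

/-- Conservation of `∫ u³`. Only `u` is differentiable in `L²`, not `u²`, so the difference quotient
is taken after factoring `a³ - b³ = (a² + a b + b²) (a - b)`. -/
lemma IsStrongSolution.integral_cube_eq {τ : ℝ} {u ux : ℝ → ℝ → ℝ} (h : IsStrongSolution τ u ux) :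
    ∀ t ∈ Set.Icc 0 τ, ∫ x, u t x ^ 3 = ∫ x, u 0 x ^ 3 := by
  refine constant_of_hasDerivWithinAt_zero fun t ht => ?_
  have hu := h.isH1 t ht
  set Q : ℝ → L2 := fun r => toL2 (fun x => u r x * u r x) + toL2 (fun x => u r x * u t x)
    + toL2 (fun x => u t x * u t x)
  have hQ : ContinuousOn Q (Set.Icc 0 τ) :=
    ((continuousOn_toL2_mul h.isH1 (fun r hr => (h.isH1 r hr).memLp) h.cont h.contx h.cont).add
      (continuousOn_toL2_mul h.isH1 (fun r hr => hu.memLp) h.cont h.contx continuousOn_const)).add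
      continuousOn_const
  have hval : ∀ r ∈ Set.Icc 0 τ, (∫ x, u r x ^ 3) - ∫ x, u t x ^ 3 =
      ⟪Q r, toL2 (u r) - toL2 (u t)⟫_ℝ := by
    intro r hr
    have hr1 := h.isH1 r hr
    have m1 := hr1.mul_memLp hr1.memLp
    have m2 := hr1.mul_memLp hu.memLp
    have m3 := hu.mul_memLp hu.memLp
    have m12 : MemLp (fun x => u r x * u r x + u r x * u t x) 2 volume := m1.add m2
    have m123 : MemLp (fun x => u r x * u r x + u r x * u t x + u t x * u t x) 2 volume :=
        m12.add m3
    have md : MemLp (fun x => u r x - u t x) 2 volume := hr1.memLp.sub hu.memLp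
    have i3 : ∀ {f f' : ℝ → ℝ}, IsH1 f f' → Integrable fun x => f x ^ 3 := fun {f f'} hf => by
      refine (integrable_mul (hf.mul_memLp hf.memLp) hf.memLp).congr
        (Eventually.of_forall fun x => ?_)
      simp only; ring
    simp only [Q]
    rw [← toL2_add m1 m2, ← toL2_add m12 m3, ← toL2_sub hr1.memLp hu.memLp, inner_toL2 m123 md,
      ← integral_sub (i3 hr1) (i3 hu)]
    congr 1; funext x; ring
  have hQt : Q t = (3 : ℝ) • toL2 (fun x => u t x * u t x) := by
    simp only [Q]
    rw [show (3 : ℝ) = 1 + 1 + 1 by norm_num, add_smul, add_smul, one_smul]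
  have hder := hasDerivWithinAt_iff_tendsto_slope.mp (h.hasDeriv t ht)
  rw [hasDerivWithinAt_iff_tendsto_slope]
  have hlim := ((hQ t ht).mono Set.sdiff_subset).tendsto.inner (𝕜 := ℝ) hder
  have hzero : ⟪Q t, -fluxOp (toL2 fun x => u t x * ux t x)⟫_ℝ = 0 := by
    have m := hu.mul_memLp hu.memLp
    have hu2 := hu.mul hu
    have hP := isResolvent_invHelmholtz one_pos m
    rw [hQt, inner_neg_right, inner_smul_left, ← fluxOp_symm, fluxOp_apply,
      resolvent_toL2 one_pos m, inner_add_left, inner_smul_left,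
      inner_toL2 m (hu.mul_memLp hu.memLp'),
      inner_toL2 (memLp_invHelmholtz one_pos m) (hu.mul_memLp hu.memLp')]
    have z1 := hu2.integral_self_mul_deriv
    have z2 := hP.left.integral_mul_deriv hu2
    have z3 := hP.left.integral_self_mul_deriv
    have z4 := hP.right.integral_self_mul_deriv
    set P := invHelmholtz 1 (fun x => u t x * u t x)
    have e1 : ∀ x, u t x * u t x * (ux t x * u t x + u t x * ux t x) =
        2 * (u t x * u t x * (u t x * ux t x)) := fun x => by ring
    have e2 : ∀ x, P x * (ux t x * u t x + u t x * ux t x) = 2 * (P x * (u t x * ux t x)) :=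
      fun x => by ring
    simp only [e1, integral_const_mul] at z1
    simp only [e2, integral_const_mul] at z2
    have z5 : ∫ x, deriv P x * (u t x * u t x) = 0 := by
      have e3 : ∀ x, deriv P x * (u t x * u t x) =
          P x * deriv P x - deriv P x * (1 ^ 2 * P x - u t x * u t x) := fun x => by ring
      simp only [e3]
      rw [integral_sub (integrable_mul hP.left.memLp hP.left.memLp')
        (integrable_mul hP.right.memLp hP.right.memLp'), z3, z4]
      simp
    rw [z5] at z2
    have z1' : ∫ x, u t x * u t x * (u t x * ux t x) = 0 := by linarith
    have z2' : ∫ x, P x * (u t x * ux t x) = 0 := by linarith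
    rw [z1', z2']
    simp
  rw [hzero] at hlim
  refine hlim.congr' ?_
  filter_upwards [self_mem_nhdsWithin] with r hr
  rw [slope_def_module, slope_def_module, hval r hr.1, inner_smul_right, smul_eq_mul]

/-- Stability in the energy space: the energy of the difference of two solutions grows at most
exponentially, at a rate controlled by the Lipschitz constant of the first solution alone. With
`d = u - w`, the time derivative of the energy of `d` is `-2 ∫ d (u uₓ - w wₓ) = -∫ uₓ d²`. -/
lemma IsStrongSolution.energy_sub_le {τ : ℝ} {u ux w wx : ℝ → ℝ → ℝ} (hu : IsStrongSolution τ u ux)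
    (hw : IsStrongSolution τ w wx) {K : ℝ} (hK0 : 0 ≤ K)
    (hK : ∀ t ∈ Set.Icc 0 τ, ∀ᵐ x, |ux t x| ≤ K) :
    ∀ t ∈ Set.Icc 0 τ, energy (fun x => u t x - w t x) ≤
      Real.exp (4 * K * t) * energy (fun x => u 0 x - w 0 x) := by
  set Y : ℝ → L2 := fun t => toL2 (u t) - toL2 (w t)
  set D : ℝ → ℝ := fun t => ⟪Y t, energyOp (Y t)⟫_ℝ
  have hd : ∀ t ∈ Set.Icc 0 τ, IsH1 (fun x => u t x - w t x) (fun x => ux t x - wx t x) :=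
    fun t ht => (hu.isH1 t ht).sub (hw.isH1 t ht)
  have hY : ∀ t ∈ Set.Icc 0 τ, Y t = toL2 (fun x => u t x - w t x) := fun t ht =>
    (toL2_sub (hu.isH1 t ht).memLp (hw.isH1 t ht).memLp).symm
  have hDE : ∀ t ∈ Set.Icc 0 τ, D t = energy (fun x => u t x - w t x) := fun t ht => by
    rw [energy_eq_inner (hd t ht).memLp, ← hY t ht]
  have hder : ∀ t ∈ Set.Icc 0 τ, ∃ D' ≤ 4 * K * D t, HasDerivWithinAt D D' (Set.Icc 0 τ) t := by
    intro t ht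
    have h1 := hu.isH1 t ht
    have h2 := hw.isH1 t ht
    have hdt := hd t ht
    refine ⟨_, ?_, hasDerivWithinAt_energy ((hu.hasDeriv t ht).sub (hw.hasDeriv t ht))⟩
    rw [map_sub, map_neg, map_neg, energyOp_fluxOp, energyOp_fluxOp]
    have m1 := h1.mul_memLp h1.memLp'
    have m2 := h2.mul_memLp h2.memLp'
    have mm : MemLp (fun x => u t x * ux t x - w t x * wx t x) 2 volume := m1.sub m2
    have e0 : ⟪Y t, -toL2 (fun x => u t x * ux t x) - -toL2 (fun x => w t x * wx t x)⟫_ℝ =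
        -∫ x, (u t x - w t x) * (u t x * ux t x - w t x * wx t x) := by
      rw [← inner_toL2 hdt.memLp mm, toL2_sub m1 m2, ← hY t ht, ← inner_neg_right]
      congr 1; abel
    -- `∫ (u d²)' = ∫ (d³)' = 0` with `d = u - w`
    obtain ⟨i1, z1⟩ := h1.integral_mul_deriv_add (hdt.mul hdt)
    obtain ⟨i2, z2⟩ := hdt.integral_mul_deriv_add (hdt.mul hdt)
    have i3 : Integrable fun x => ux t x * ((u t x - w t x) * (u t x - w t x)) :=
      integrable_mul h1.memLp' (hdt.mul_memLp hdt.memLp)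
    have e1 : ∫ x, (u t x - w t x) * (u t x * ux t x - w t x * wx t x) =
        (1 / 2) * ∫ x, ux t x * ((u t x - w t x) * (u t x - w t x)) := by
      have e : ∀ x, (u t x - w t x) * (u t x * ux t x - w t x * wx t x) =
        (1 / 2) * (ux t x * ((u t x - w t x) * (u t x - w t x))) +
        ((1 / 2) * (ux t x * ((u t x - w t x) * (u t x - w t x)) + u t x *
          ((ux t x - wx t x) * (u t x - w t x) + (u t x - w t x) * (ux t x - wx t x)))
        + (-1 / 3) * ((ux t x - wx t x) * ((u t x - w t x) * (u t x - w t x)) + (u t x - w t x) *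
          ((ux t x - wx t x) * (u t x - w t x) + (u t x - w t x) * (ux t x - wx t x)))) :=
        fun x => by ring
      rw [integral_congr_ae (Eventually.of_forall e),
        integral_add (i3.const_mul _) ((i1.const_mul _).fun_add (i2.const_mul _)),
        integral_add (i1.const_mul _) (i2.const_mul _), integral_const_mul, integral_const_mul,
        integral_const_mul, z1, z2]
      ring
    have hbound : -(K * ∫ x, (u t x - w t x) ^ 2) ≤
        ∫ x, ux t x * ((u t x - w t x) * (u t x - w t x)) := by
      rw [← integral_const_mul, ← integral_neg]
      refine integral_mono_ae (hdt.memLp.integrable_sq.const_mul K).neg i3 ?_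
      filter_upwards [hK t ht] with x hx
      have := neg_le_of_abs_le hx
      nlinarith [mul_nonneg (by linarith : 0 ≤ ux t x + K) (sq_nonneg (u t x - w t x))]
    have hE := integral_sq_le_energy hdt.memLp
    rw [← hDE t ht] at hE
    change 2 * ⟪Y t, _⟫_ℝ ≤ _
    rw [e0, e1]
    nlinarith
  have hanti : AntitoneOn (fun t => Real.exp (-(4 * K * t)) * D t) (Set.Icc 0 τ) := by
    have hexp : ∀ t : ℝ, HasDerivAt (fun t => Real.exp (-(4 * K * t)))
        (Real.exp (-(4 * K * t)) * (-(4 * K))) t := fun t => by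
      have := (((hasDerivAt_id t).const_mul (4 * K)).neg).exp
      simpa using this
    have hgd : ∀ t ∈ Set.Icc 0 τ, ∃ g' ≤ 0,
        HasDerivWithinAt (fun t => Real.exp (-(4 * K * t)) * D t) g' (Set.Icc 0 τ) t := by
      intro t ht
      obtain ⟨D', hD', hDd⟩ := hder t ht
      refine ⟨_, ?_, (hexp t).hasDerivWithinAt.mul hDd⟩
      have := mul_le_mul_of_nonneg_left hD' (Real.exp_pos (-(4 * K * t))).le
      linarith
    refine antitoneOn_of_deriv_nonpos (convex_Icc 0 τ)
      (fun t ht => by obtain ⟨_, _, h⟩ := hgd t ht; exact h.continuousWithinAt) ?_ ?_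
    · intro t ht
      obtain ⟨_, _, h⟩ := hgd t (interior_subset ht)
      exact (h.hasDerivAt (mem_interior_iff_mem_nhds.mp ht)).differentiableAt.differentiableWithinAt
    · intro t ht
      obtain ⟨_, h0, h⟩ := hgd t (interior_subset ht)
      rw [(h.hasDerivAt (mem_interior_iff_mem_nhds.mp ht)).deriv]
      exact h0
  intro t ht
  have h0 : (0 : ℝ) ∈ Set.Icc 0 τ := ⟨le_rfl, ht.1.trans ht.2⟩
  have hmono : Real.exp (-(4 * K * t)) * D t ≤ D 0 := by simpa using hanti h0 ht ht.1
  rw [← hDE t ht, ← hDE 0 h0]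
  calc D t = Real.exp (4 * K * t) * (Real.exp (-(4 * K * t)) * D t) := by
        rw [← mul_assoc, ← Real.exp_add]; simp
    _ ≤ _ := by gcongr

/-! ### Weak derivatives and continuous representatives -/

lemma IsTest.deriv {ψ : ℝ → ℝ} (h : IsTest ψ) : IsTest (deriv ψ) :=
  ⟨(contDiff_infty_iff_deriv.mp h.1).2, h.2.deriv⟩

lemma IsTest.hasDerivAt {ψ : ℝ → ℝ} (h : IsTest ψ) (x : ℝ) : HasDerivAt ψ (_root_.deriv ψ x) x :=
  ((contDiff_infty_iff_deriv.mp h.1).1 x).hasDerivAt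

lemma IsTest.isPrimitive {ψ : ℝ → ℝ} (h : IsTest ψ) : IsPrimitive ψ (_root_.deriv ψ) :=
  IsPrimitive.of_hasDerivAt h.hasDerivAt h.deriv.1.continuous

lemma IsTest.memLp {ψ : ℝ → ℝ} (h : IsTest ψ) : MemLp ψ 2 volume :=
  h.1.continuous.memLp_of_hasCompactSupport h.2

lemma IsTest.isH1 {ψ : ℝ → ℝ} (h : IsTest ψ) : IsH1 ψ (_root_.deriv ψ) :=
  ⟨h.isPrimitive, h.memLp, h.deriv.memLp⟩

lemma IsTest.integrable {ψ : ℝ → ℝ} (h : IsTest ψ) : Integrable ψ :=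
  h.1.continuous.integrable_of_hasCompactSupport h.2

lemma IsTest.integrable_mul {ψ f : ℝ → ℝ} (h : IsTest ψ) (hf : LocallyIntegrable f) :
    Integrable (fun x => f x * ψ x) := by
  have := hf.integrable_smul_left_of_hasCompactSupport h.1.continuous h.2
  simpa only [smul_eq_mul, mul_comm] using this

lemma contDiff_primitive {κ : ℝ → ℝ} (h : ContDiff ℝ ∞ κ) (a : ℝ) :
    ContDiff ℝ ∞ (fun x => ∫ t in a..x, κ t) := by
  have hd : ∀ x, HasDerivAt (fun x => ∫ t in a..x, κ t) (κ x) x := fun x =>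
    (h.continuous.integral_hasStrictDerivAt a x).hasDerivAt
  rw [contDiff_infty_iff_deriv]
  refine ⟨fun x => (hd x).differentiableAt, ?_⟩
  rwa [show deriv (fun x => ∫ t in a..x, κ t) = κ from funext fun x => (hd x).deriv]

lemma exists_isTest_integral_one : ∃ ρ : ℝ → ℝ, IsTest ρ ∧ ∫ x, ρ x = 1 := by
  let b : ContDiffBump (0 : ℝ) := ⟨1, 2, one_pos, one_lt_two⟩
  exact ⟨b.normed volume, ⟨b.contDiff_normed, b.hasCompactSupport_normed⟩, b.integral_normed⟩

/-- A test function of zero mean is the derivative of a test function. -/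
lemma IsTest.exists_primitive {κ : ℝ → ℝ} (h : IsTest κ) (h0 : ∫ x, κ x = 0) :
    ∃ ψ, IsTest ψ ∧ ∀ x, _root_.deriv ψ x = κ x := by
  obtain ⟨R, hR⟩ := h.2.isCompact.isBounded.subset_closedBall (0 : ℝ)
  have hz : ∀ x, R < |x| → κ x = 0 := fun x hx => by
    by_contra hne
    have := hR (subset_tsupport _ hne)
    rw [mem_closedBall_zero_iff, Real.norm_eq_abs] at this
    linarith
  refine ⟨fun x => ∫ t in (-(|R| + 1))..x, κ t, ⟨contDiff_primitive h.1 _, ?_⟩, fun x =>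
    (h.1.continuous.integral_hasStrictDerivAt _ x).hasDerivAt.deriv⟩
  refine HasCompactSupport.of_support_subset_isCompact
      (isCompact_Icc (a := -(|R| + 1)) (b := |R| + 1)) ?_
  intro x hx
  by_contra hcon
  refine hx ?_
  simp only
  rw [Set.mem_Icc, not_and_or, not_le, not_le] at hcon
  have hRR := le_abs_self R
  have hR0 := abs_nonneg R
  rcases hcon with hlt | hgt
  · refine intervalIntegral.integral_zero_ae (Eventually.of_forall fun t ht => hz t ?_)
    rw [Set.uIoc_of_ge hlt.le] at ht
    rw [abs_of_neg (by linarith [ht.2])]; linarith [ht.2]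
  · rw [intervalIntegral.integral_of_le (by linarith), ← h0]
    refine setIntegral_eq_integral_of_forall_compl_eq_zero fun t ht => hz t ?_
    rw [Set.mem_Ioc, not_and_or, not_lt, not_le] at ht
    rcases ht with ht | ht
    · rw [abs_of_nonpos (by linarith)]; linarith
    · rw [abs_of_pos (by linarith)]; linarith

/-- A function with a weak derivative agrees almost everywhere with an indefinite integral of it. -/
lemma HasWeakDeriv.exists_isPrimitive {f g : ℝ → ℝ} (h : HasWeakDeriv f g) :
    ∃ F, F =ᵐ[volume] f ∧ IsPrimitive F g := by
  obtain ⟨hf, hg, hw⟩ := h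
  have hgi : ∀ a b, IntervalIntegrable g volume a b := fun a b => intervalIntegrable_iff.mpr
    ((hg.integrableOn_isCompact isCompact_uIcc).mono_set Set.uIoc_subset_uIcc)
  set G : ℝ → ℝ := fun x => ∫ t in (0 : ℝ)..x, g t
  have hG : IsPrimitive G g := ⟨hg, fun a b => by
    simp only [G]
    rw [intervalIntegral.integral_interval_sub_left (hgi _ _) (hgi _ _)]⟩
  have hGl : LocallyIntegrable G := hG.continuous.locallyIntegrable
  have hGw : ∀ ψ, IsTest ψ → ∫ x, G x * deriv ψ x = -∫ x, g x * ψ x := fun ψ hψ => by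
    have i1 := hψ.integrable_mul hg
    have i2 := hψ.deriv.integrable_mul hGl
    have := (hG.mul hψ.isPrimitive).integral_eq_zero (hψ.integrable_mul hGl) (i1.add i2)
    rw [integral_add i1 i2] at this
    linarith
  have hh : LocallyIntegrable (fun x => f x - G x) := hf.sub hGl
  have hhw : ∀ ψ, IsTest ψ → ∫ x, (f x - G x) * deriv ψ x = 0 := fun ψ hψ => by
    have : ∀ x, (f x - G x) * deriv ψ x = f x * deriv ψ x - G x * deriv ψ x := fun x => by ring
    simp only [this]
    rw [integral_sub (hψ.deriv.integrable_mul hf) (hψ.deriv.integrable_mul hGl), hw ψ hψ, hGw ψ hψ,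
      sub_self]
  obtain ⟨ρ, hρ, hρ1⟩ := exists_isTest_integral_one
  set c := ∫ x, (f x - G x) * ρ x
  have hc : LocallyIntegrable (fun x => f x - G x - c) := hh.sub (locallyIntegrable_const c)
  have key := ae_eq_zero_of_integral_contDiff_smul_eq_zero hc fun θ hθ1 hθ2 => by
    have hθ : IsTest θ := ⟨hθ1, hθ2⟩
    have hκ : IsTest (fun x => θ x - (∫ y, θ y) * ρ x) :=
      ⟨hθ.1.sub (contDiff_const.mul hρ.1), hθ.2.sub (HasCompactSupport.mul_left hρ.2)⟩
    obtain ⟨ψ, hψ, hψd⟩ := hκ.exists_primitive (by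
      rw [integral_sub hθ.integrable (hρ.integrable.const_mul _), integral_const_mul, hρ1, mul_one,
        sub_self])
    have h1 := hhw ψ hψ
    simp only [hψd] at h1
    have e : ∀ x, (f x - G x) * (θ x - (∫ y, θ y) * ρ x) =
        (f x - G x) * θ x - (∫ y, θ y) * ((f x - G x) * ρ x) := fun x => by ring
    simp only [e] at h1
    rw [integral_sub (hθ.integrable_mul hh) ((hρ.integrable_mul hh).const_mul _),
      integral_const_mul] at h1
    have e2 : ∀ x, θ x • (f x - G x - c) = (f x - G x) * θ x - c * θ x := fun x => by
      rw [smul_eq_mul]; ring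
    simp only [e2]
    rw [integral_sub (hθ.integrable_mul hh) (hθ.integrable.const_mul _), integral_const_mul]
    linarith
  refine ⟨fun x => G x + c, key.mono fun x hx => ?_, hG.locInt, fun a b => ?_⟩
  · simp only; linarith
  · rw [← hG.ftc a b]; ring

lemma HasWeakDeriv.exists_isH1 {f g : ℝ → ℝ} (h : HasWeakDeriv f g) (hf : MemLp f 2 volume)
    (hg : MemLp g 2 volume) : ∃ F, F =ᵐ[volume] f ∧ IsH1 F g := by
  obtain ⟨F, hF, hp⟩ := h.exists_isPrimitive
  exact ⟨F, hF, hp, hf.ae_eq hF.symm, hg⟩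

/-! ### Uniform Lipschitz bound -/

/-- The essential bound by the total variation: a square integrable function whose oscillation is at
most `M` cannot exceed `M` in absolute value. -/
lemma ae_abs_le_of_eVariationOn {f g : ℝ → ℝ} (hf : MemLp f 2 volume) (hg : g =ᵐ[volume] f)
    {M : ℝ≥0∞} (hM : M < ⊤) (hv : eVariationOn g Set.univ ≤ M) : ∀ᵐ x, |f x| ≤ M.toReal := by
  have hosc : ∀ x y, |g x - g y| ≤ M.toReal := fun x y => by
    have := (eVariationOn.edist_le g (Set.mem_univ x) (Set.mem_univ y)).trans hv
    rw [← Real.dist_eq, dist_edist]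
    exact ENNReal.toReal_mono hM.ne this
  have hg2 : MemLp g 2 volume := hf.ae_eq hg.symm
  have hb : ∀ x, |g x| ≤ M.toReal := by
    intro x
    by_contra hcon
    push Not at hcon
    have hlow : ∀ y, (|g x| - M.toReal) ^ 2 ≤ g y ^ 2 := fun y => by
      rw [← sq_abs (g y)]
      refine pow_le_pow_left₀ (by linarith) ?_ 2
      have h1 := abs_sub_abs_le_abs_sub (g x) (g y)
      linarith [hosc x y]
    have hi : Integrable (fun _ : ℝ => (|g x| - M.toReal) ^ 2) := by
      refine hg2.integrable_sq.mono' (by fun_prop) (Eventually.of_forall fun y => ?_)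
      rw [Real.norm_of_nonneg (sq_nonneg _)]
      exact hlow y
    rw [integrable_const_iff] at hi
    rcases hi with h0 | h1
    · have : |g x| - M.toReal = 0 := by simpa using h0
      linarith
    · exact absurd h1.measure_univ_lt_top (by simp)
  filter_upwards [hg] with x hx
  rw [← hx]; exact hb x

/-- A bound holding for functions arbitrarily close in `L²` holds almost everywhere. -/
lemma ae_abs_le_of_approx {f : ℝ → ℝ} (hf : MemLp f 2 volume) {K : ℝ} (hK : 0 ≤ K)
    (h : ∀ δ > 0, ∃ g : ℝ → ℝ, MemLp g 2 volume ∧ (∀ᵐ x, |g x| ≤ K) ∧ ‖toL2 f - toL2 g‖ < δ) :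
    ∀ᵐ x, |f x| ≤ K := by
  have hm : MemLp (fun x => max (|f x| - K) 0) 2 volume := by
    refine hf.of_le ?_ (Eventually.of_forall fun x => ?_)
    · exact ((hf.1.norm.sub aestronglyMeasurable_const).sup aestronglyMeasurable_const)
    · rw [Real.norm_of_nonneg (le_max_right _ _), Real.norm_eq_abs]
      exact max_le (by linarith) (abs_nonneg _)
  have hzero : ∫ x, (max (|f x| - K) 0) ^ 2 = 0 := by
    refine le_antisymm (le_of_forall_pos_le_add fun δ hδ => ?_)
        (integral_nonneg fun x => sq_nonneg _)
    obtain ⟨g, hg, hgK, hfg⟩ := h (Real.sqrt δ) (Real.sqrt_pos.mpr hδ)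
    have hsub : MemLp (fun x => f x - g x) 2 volume := hf.sub hg
    rw [← toL2_sub hf hg] at hfg
    have h2 : ‖toL2 (fun x => f x - g x)‖ ^ 2 ≤ δ := by
      rw [← Real.sq_sqrt hδ.le]; exact pow_le_pow_left₀ (norm_nonneg _) hfg.le 2
    rw [norm_toL2_sq hsub] at h2
    rw [zero_add]
    refine le_trans (integral_mono_ae hm.integrable_sq hsub.integrable_sq ?_) h2
    filter_upwards [hgK] with x hx
    rw [← sq_abs (f x - g x)]
    refine pow_le_pow_left₀ (le_max_right _ _) (max_le ?_ (abs_nonneg _)) 2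
    linarith [abs_sub_abs_le_abs_sub (f x) (g x)]
  rw [integral_eq_zero_iff_of_nonneg (fun x => sq_nonneg _) hm.integrable_sq] at hzero
  filter_upwards [hzero] with x hx
  have : max (|f x| - K) 0 = 0 := by simpa using hx
  linarith [le_max_left (|f x| - K) 0]

/-! ### Weak solutions are strong solutions -/

lemma measurableSet_timeInterval (T : EReal) : MeasurableSet (timeInterval T) :=
  (measurableSet_le measurable_const measurable_id).inter
    (measurableSet_lt measurable_coe_real_ereal measurable_const)

/-- The nonlinear term tested against `ψ`, with the derivative moved from `u²` onto `ψ`. -/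
lemma inner_fluxOp {u u' ψ : ℝ → ℝ} (hu : IsH1 u u') (hψ : IsTest ψ) :
    ⟪toL2 ψ, -fluxOp (toL2 fun x => u x * u' x)⟫_ℝ =
      ∫ x, (1 / 2 * u x ^ 2 * deriv ψ x + 3 / 2 * invHelmholtz 1
          (fun z => u z ^ 2) x * deriv ψ x) := by
  have hu2 := hu.mul hu
  have hm : MemLp (fun x => u x ^ 2) 2 volume := by simpa only [pow_two] using hu2.memLp
  have hP := isResolvent_invHelmholtz one_pos hm
  have hη := isResolvent_invHelmholtz one_pos hψ.memLp
  have hη' : IsResolvent 1 (deriv ψ) (deriv (invHelmholtz 1 ψ))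
      (fun x => 1 ^ 2 * invHelmholtz 1 ψ x - ψ x) := by
    refine ⟨hη.right, ((hη.left.const_mul (1 ^ 2)).sub hψ.isH1)⟩
  have hsym := hP.integral_mul_comm hη' hm hψ.deriv.memLp
  have mprod := hu.mul_memLp hu.memLp'
  rw [inner_neg_right, ← fluxOp_symm, fluxOp_apply, resolvent_toL2 one_pos hψ.memLp, inner_add_left,
    inner_smul_left, inner_toL2 hψ.memLp mprod, inner_toL2 hη.left.memLp mprod]
  have z1 := hψ.isH1.integral_mul_deriv hu2
  have z2 := hη.left.integral_mul_deriv hu2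
  set η := invHelmholtz 1 ψ
  have e : ∀ (θ : ℝ → ℝ) x, θ x * (u' x * u x + u x * u' x) = 2 * (θ x * (u x * u' x)) :=
    fun θ x => by ring
  simp only [e, integral_const_mul] at z1 z2
  have e1 : ∀ x, deriv ψ x * (u x * u x) = u x ^ 2 * deriv ψ x := fun x => by ring
  have e2 : ∀ x, deriv η x * (u x * u x) = u x ^ 2 * deriv η x := fun x => by ring
  simp only [e1] at z1
  simp only [e2, hsym] at z2
  have e3 : ∀ x, 1 / 2 * u x ^ 2 * deriv ψ x + 3 / 2 * invHelmholtz 1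
      (fun z => u z ^ 2) x * deriv ψ x
      = 1 / 2 * (u x ^ 2 * deriv ψ x) + 3 / 2 * (invHelmholtz 1 (fun z => u z ^ 2) x * deriv ψ x) :=
    fun x => by ring
  simp only [e3]
  rw [integral_add ((integrable_mul hm hψ.deriv.memLp).const_mul _)
    ((integrable_mul hP.left.memLp hψ.deriv.memLp).const_mul _), integral_const_mul,
    integral_const_mul]
  simp only [conj_trivial]
  linarith

/-- The fundamental lemma of the calculus of variations in time: `a` is an indefinite integral
of `b` on `[0, τ]` as soon as this holds weakly, initial value included. -/
lemma sub_eq_integral_of_weak {τ : ℝ} (hτ : 0 ≤ τ) {a b : ℝ → ℝ}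
    (ha : ContinuousOn a (Set.Icc 0 τ)) (hb : ContinuousOn b (Set.Icc 0 τ))
    (h : ∀ χ : ℝ → ℝ, IsTest χ → (∀ t, τ ≤ t → χ t = 0) →
      (∫ t in Set.Icc 0 τ, (deriv χ t * a t + χ t * b t)) + χ 0 * a 0 = 0) :
    ∀ t ∈ Set.Icc 0 τ, a t - a 0 = ∫ s in (0 : ℝ)..t, b s := by
  set A : ℝ → ℝ := Set.IccExtend hτ (Set.domRestrict (Set.Icc 0 τ) a)
  set B : ℝ → ℝ := Set.IccExtend hτ (Set.domRestrict (Set.Icc 0 τ) b)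
  have hA : Continuous A := (continuousOn_iff_continuous_domRestrict.mp ha).Icc_extend'
  have hB : Continuous B := (continuousOn_iff_continuous_domRestrict.mp hb).Icc_extend'
  have hAa : ∀ s ∈ Set.Icc 0 τ, A s = a s := fun s hs => by
    simp only [A, Set.IccExtend_of_mem hτ _ hs, Set.domRestrict_apply]
  have hBb : ∀ s ∈ Set.Icc 0 τ, B s = b s := fun s hs => by
    simp only [B, Set.IccExtend_of_mem hτ _ hs, Set.domRestrict_apply]
  set H : ℝ → ℝ := fun t => (∫ s in (0 : ℝ)..t, B s) - A t + a 0
  have hBd : ∀ t, HasDerivAt (fun t => ∫ s in (0 : ℝ)..t, B s) (B t) t := fun t =>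
    (hB.integral_hasStrictDerivAt 0 t).hasDerivAt
  have hBc : Continuous fun t => ∫ s in (0 : ℝ)..t, B s :=
    continuous_iff_continuousAt.mpr fun t => (hBd t).continuousAt
  have hH : Continuous H := (hBc.sub hA).add_const _
  have hae : ∀ᵐ t, t ∈ Set.Ioo 0 τ → H t = 0 := by
    refine isOpen_Ioo.ae_eq_zero_of_integral_contDiff_smul_eq_zero
      (hH.locallyIntegrable.locallyIntegrableOn _) fun ρ hρ1 hρ2 hρ3 => ?_
    have hρ0 : ∀ t, t ∉ Set.Ioo 0 τ → ρ t = 0 := fun t ht =>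
      image_eq_zero_of_notMem_tsupport fun h' => ht (hρ3 h')
    -- a primitive of `-ρ` vanishing after `τ`, cut off at negative times
    set R : ℝ → ℝ := fun t => (∫ s in (0 : ℝ)..τ, ρ s) - ∫ s in (0 : ℝ)..t, ρ s
    set κ : ℝ → ℝ := fun t => Real.smoothTransition (t + 2)
    have hRs : ContDiff ℝ ∞ R := contDiff_const.sub (contDiff_primitive hρ1 0)
    have hRd : ∀ t, HasDerivAt R (-ρ t) t := fun t =>
      (hρ1.continuous.integral_hasStrictDerivAt 0 t).hasDerivAt.const_sub _
    have hRτ : ∀ t, τ ≤ t → R t = 0 := fun t ht => by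
      simp only [R]
      rw [intervalIntegral.integral_interval_sub_left (hρ1.continuous.intervalIntegrable _ _)
        (hρ1.continuous.intervalIntegrable _ _)]
      refine intervalIntegral.integral_zero_ae (Eventually.of_forall fun s hs => hρ0 s ?_)
      rw [Set.uIoc_of_ge ht] at hs
      exact fun h' => absurd h'.2 (not_lt.mpr hs.1.le)
    have hκ1 : ∀ t, -1 < t → κ t = 1 := fun t ht =>
      Real.smoothTransition.one_of_one_le (by linarith)
    have hκs : ContDiff ℝ ∞ κ := Real.smoothTransition.contDiff.comp
        (contDiff_id.add contDiff_const)
    have hχ : IsTest (fun t => κ t * R t) := by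
      refine ⟨hκs.mul hRs, HasCompactSupport.of_support_subset_isCompact
          (isCompact_Icc (a := -2) (b := τ)) ?_⟩
      intro t ht
      by_contra hcon
      rw [Set.mem_Icc, not_and_or, not_le, not_le] at hcon
      refine ht ?_
      rcases hcon with h1 | h1
      · simp only [κ]
        rw [Real.smoothTransition.zero_of_nonpos (by linarith), zero_mul]
      · change κ t * R t = 0
        rw [hRτ t h1.le, mul_zero]
    have hχe : ∀ t, -1 < t → (fun t => κ t * R t) =ᶠ[𝓝 t] R := fun t ht => by
      filter_upwards [Ioi_mem_nhds ht] with s hs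
      rw [hκ1 s hs, one_mul]
    have h1 := h _ hχ fun t ht => by rw [hRτ t ht, mul_zero]
    have h2 : ∫ t in Set.Icc 0 τ, (deriv (fun t => κ t * R t) t * a t + κ t * R t * b t) =
        ∫ t in (0 : ℝ)..τ, (-(ρ t * A t) + R t * B t) := by
      rw [intervalIntegral.integral_of_le hτ, ← integral_Icc_eq_integral_Ioc]
      refine setIntegral_congr_fun measurableSet_Icc fun t ht => ?_
      have ht1 : -1 < t := by linarith [ht.1]
      rw [(hχe t ht1).deriv_eq, (hRd t).deriv, hκ1 t ht1, hAa t ht, hBb t ht]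
      ring
    rw [h2, hκ1 0 (by norm_num)] at h1
    have hρA : Continuous fun t => ρ t * A t := hρ1.continuous.mul hA
    have hnA : Continuous fun t => -(ρ t * A t) := hρA.neg
    have hRB : Continuous fun t => R t * B t := hRs.continuous.mul hB
    have hρB : Continuous fun t => ρ t * ∫ s in (0 : ℝ)..t, B s := hρ1.continuous.mul hBc
    rw [intervalIntegral.integral_add (hnA.intervalIntegrable _ _) (hRB.intervalIntegrable _ _),
      intervalIntegral.integral_neg] at h1
    have hparts := intervalIntegral.integral_mul_deriv_eq_deriv_mul (a := 0) (b := τ)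
      (fun t _ => hRd t) (fun t _ => hBd t) (hρ1.continuous.neg.intervalIntegrable _ _)
      (hB.intervalIntegrable _ _)
    rw [hRτ τ le_rfl, intervalIntegral.integral_same] at hparts
    simp only [zero_mul, mul_zero, sub_self, zero_sub, neg_mul, intervalIntegral.integral_neg,
      neg_neg] at hparts
    have hR0 : R 0 = ∫ s in (0 : ℝ)..τ, ρ s := by simp [R]
    have h3 : ∫ t, ρ t • H t = ∫ t in (0 : ℝ)..τ, (ρ t * (∫ s in (0 : ℝ)..t, B s) - ρ t * A t
        + a 0 * ρ t) := by
      rw [intervalIntegral.integral_of_le hτ, ← setIntegral_eq_integral_of_forall_compl_eq_zero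
        (s := Set.Ioc 0 τ) (fun t ht => by
          rw [hρ0 t (fun h' => ht (Set.Ioo_subset_Ioc_self h')), zero_smul])]
      refine setIntegral_congr_fun measurableSet_Ioc fun t _ => ?_
      simp only [H, smul_eq_mul]; ring
    have hBA : Continuous fun t => ρ t * (∫ s in (0 : ℝ)..t, B s) - ρ t * A t := hρB.sub hρA
    rw [h3, intervalIntegral.integral_add (hBA.intervalIntegrable _ _)
      ((hρ1.continuous.const_mul _).intervalIntegrable _ _),
      intervalIntegral.integral_sub (hρB.intervalIntegrable _ _) (hρA.intervalIntegrable _ _),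
      intervalIntegral.integral_const_mul, ← hparts, ← hR0]
    linarith
  intro t ht
  rcases hτ.eq_or_lt with rfl | hpos
  · have : t = 0 := le_antisymm ht.2 ht.1
    subst this; simp
  have hIoo : ∀ s ∈ Set.Ioo 0 τ, H s = 0 := by
    have := Measure.eqOn_open_of_ae_eq (μ := volume) (f := H) (g := fun _ => (0 : ℝ))
      (U := Set.Ioo 0 τ) ((ae_restrict_iff' measurableSet_Ioo).mpr hae) isOpen_Ioo
      hH.continuousOn continuousOn_const
    exact this
  have hHt : H t = 0 := by
    have hcl : closure (Set.Ioo 0 τ) ⊆ {s | H s = 0} :=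
      closure_minimal hIoo (isClosed_eq hH continuous_const)
    rw [closure_Ioo hpos.ne] at hcl
    exact hcl ht
  have hint : ∫ s in (0 : ℝ)..t, b s = ∫ s in (0 : ℝ)..t, B s :=
    intervalIntegral.integral_congr fun s hs => by
      rw [Set.uIcc_of_le ht.1] at hs
      exact (hBb s ⟨hs.1, hs.2.trans ht.2⟩).symm
  simp only [H] at hHt
  rw [hint, ← hAa t ht]
  linarith

/-- The weak formulation tested with `χ(t) ψ(x)`. -/
lemma IsWeakSolution.integral_mul_test {T : EReal} {u : ℝ → ℝ → ℝ} (hw : IsWeakSolution T u)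
    (hu : ∀ t ∈ timeInterval T, MemLp (u t) 2 volume ∧ MemLp (fun x => u t x ^ 2) 2 volume)
    {τ : ℝ} (hτT : (τ : EReal) < T) {χ ψ : ℝ → ℝ} (hχ : IsTest χ)
    (hχτ : ∀ t, τ ≤ t → χ t = 0) (hψ : IsTest ψ) :
    (∫ t in Set.Icc 0 τ, (deriv χ t * (∫ x, u t x * ψ x) + χ t *
      ∫ x, (1 / 2 * u t x ^ 2 * deriv ψ x + 3 / 2 * invHelmholtz 1
          (fun z => u t z ^ 2) x * deriv ψ x)))
      + χ 0 * (∫ x, u 0 x * ψ x) = 0 := by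
  have hsupp : tsupport (fun p : ℝ × ℝ => χ p.1 * ψ p.2) ⊆ tsupport χ ×ˢ tsupport ψ := by
    refine closure_minimal (fun p hp => ?_) ((isClosed_tsupport χ).prod (isClosed_tsupport ψ))
    exact ⟨subset_tsupport _ (left_ne_zero_of_mul hp), subset_tsupport _ (right_ne_zero_of_mul hp)⟩
  have hχsupp : tsupport χ ⊆ Set.Iic τ := by
    refine closure_minimal (fun t ht => ?_) isClosed_Iic
    by_contra hcon
    exact ht (hχτ t (le_of_lt (not_le.mp hcon)))
  have h := hw (fun p => χ p.1 * ψ p.2)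
    ((hχ.1.comp contDiff_fst).mul (hψ.1.comp contDiff_snd))
    ((hχ.2.isCompact.prod hψ.2.isCompact).of_isClosed_subset (isClosed_tsupport _) hsupp)
    (fun p hp => lt_of_le_of_lt (EReal.coe_le_coe_iff.mpr (hχsupp (hsupp hp).1)) hτT)
  have hG : ∀ t ∈ timeInterval T, (∫ x,
        (u t x * deriv (fun s => χ s * ψ x) t
          + 1 / 2 * u t x ^ 2 * deriv (fun z => χ t * ψ z) x
          + 3 / 2 * invHelmholtz 1 (fun z => u t z ^ 2) x * deriv (fun z => χ t * ψ z) x)) =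
      deriv χ t * (∫ x, u t x * ψ x) + χ t *
      ∫ x, (1 / 2 * u t x ^ 2 * deriv ψ x + 3 / 2 * invHelmholtz 1
          (fun z => u t z ^ 2) x * deriv ψ x) := by
    intro t ht
    obtain ⟨m1, m2⟩ := hu t ht
    have m3 := memLp_invHelmholtz one_pos m2
    have i1 := integrable_mul m1 hψ.memLp
    have i2 : Integrable fun x => (1 / 2 * u t x ^ 2 * deriv ψ x
        + 3 / 2 * invHelmholtz 1 (fun z => u t z ^ 2) x * deriv ψ x) :=
      (integrable_mul (m2.const_mul (1 / 2)) hψ.deriv.memLp).add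
        (integrable_mul (m3.const_mul (3 / 2)) hψ.deriv.memLp)
    rw [← integral_const_mul, ← integral_const_mul, ← integral_add (i1.const_mul _)
        (i2.const_mul _)]
    congr 1; funext x
    rw [((hχ.hasDerivAt t).mul_const (ψ x)).deriv, ((hψ.hasDerivAt x).const_mul (χ t)).deriv]
    ring
  have h0 : ∫ x, u 0 x * (χ 0 * ψ x) = χ 0 * ∫ x, u 0 x * ψ x := by
    rw [← integral_const_mul]; congr 1; funext x; ring
  simp only at h
  rw [setIntegral_congr_fun (measurableSet_timeInterval T) hG, h0] at h
  refine Eq.trans ?_ h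
  congr 1
  refine (setIntegral_eq_of_subset_of_forall_sdiff_eq_zero (measurableSet_timeInterval T)
    (fun t ht => ⟨ht.1, lt_of_le_of_lt (EReal.coe_le_coe_iff.mpr ht.2) hτT⟩) fun t ht => ?_).symm
  have htτ : τ < t := by
    by_contra hcon
    exact ht.2 ⟨ht.1.1, not_lt.mp hcon⟩
  have hd : deriv χ t = 0 := by
    have : χ =ᶠ[𝓝 t] fun _ => 0 := by
      filter_upwards [Ioi_mem_nhds htτ] with s hs
      exact hχτ s (le_of_lt hs)
    rw [this.deriv_eq]; simp
  rw [hd, hχτ t htτ.le]; simp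

/-- A weak solution in the class `𝒳` is, up to the choice of representatives, a strong solution,
and is Lipschitz in space uniformly in time. -/
lemma exists_isStrongSolution {T : EReal} {u : ℝ → ℝ → ℝ} (hX : MemX T u)
    (hw : IsWeakSolution T u) {τ : ℝ} (hτ : 0 ≤ τ) (hτT : (τ : EReal) < T) :
    ∃ w wx : ℝ → ℝ → ℝ, IsStrongSolution τ w wx ∧ (∀ t ∈ Set.Icc 0 τ, w t =ᵐ[volume] u t) ∧
      ∃ K : ℝ, 0 ≤ K ∧ ∀ t ∈ Set.Icc 0 τ, ∀ᵐ x, |wx t x| ≤ K := by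
  obtain ⟨ux, h1, h2, M, hM, h3⟩ := hX
  have hsub : Set.Icc 0 τ ⊆ timeInterval T := fun t ht =>
    ⟨ht.1, lt_of_le_of_lt (EReal.coe_le_coe_iff.mpr ht.2) hτT⟩
  have hrep : ∀ t, ∃ F, t ∈ timeInterval T → F =ᵐ[volume] u t ∧ IsH1 F (ux t) := fun t => by
    by_cases ht : t ∈ timeInterval T
    · obtain ⟨F, hF⟩ := (h1 t ht).2.2.exists_isH1 (h1 t ht).1 (h1 t ht).2.1
      exact ⟨F, fun _ => hF⟩
    · exact ⟨0, fun h => absurd h ht⟩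
  choose w hwF using hrep
  have hnorm : ∀ t ∈ timeInterval T, Tendsto (fun s => toL2 (w s)) (𝓝[timeInterval T] t)
      (𝓝 (toL2 (w t)))
      ∧ Tendsto (fun s => toL2 (ux s)) (𝓝[timeInterval T] t) (𝓝 (toL2 (ux t))) := by
    intro t ht
    have key : ∀ (f : ℝ → ℝ → ℝ), (∀ s ∈ timeInterval T, MemLp (f s) 2 volume) →
        Tendsto (fun s => eLpNorm (f s - f t) 2 volume) (𝓝[timeInterval T] t) (𝓝 0) →
        Tendsto (fun s => toL2 (f s)) (𝓝[timeInterval T] t) (𝓝 (toL2 (f t))) := by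
      intro f hf hlim
      refine tendsto_iff_norm_sub_tendsto_zero.mpr ?_
      have := (ENNReal.tendsto_toReal ENNReal.zero_ne_top).comp hlim
      refine this.congr' ?_
      filter_upwards [self_mem_nhdsWithin] with s hs
      rw [← toL2_sub (hf s hs) (hf t ht)]
      have hm : MemLp (fun x => f s x - f t x) 2 volume := (hf s hs).sub (hf t ht)
      rw [toL2, dif_pos hm, Lp.norm_toLp]
      rfl
    have hle1 : Tendsto (fun s => eLpNorm (u s - u t) 2 volume) (𝓝[timeInterval T] t) (𝓝 0) :=
      tendsto_of_tendsto_of_tendsto_of_le_of_le tendsto_const_nhds (h2 t ht)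
        (fun _ => zero_le) (fun _ => le_self_add)
    have hle2 : Tendsto (fun s => eLpNorm (ux s - ux t) 2 volume) (𝓝[timeInterval T] t) (𝓝 0) :=
      tendsto_of_tendsto_of_tendsto_of_le_of_le tendsto_const_nhds (h2 t ht)
        (fun _ => zero_le) (fun _ => le_add_self)
    refine ⟨?_, key ux (fun s hs => (h1 s hs).2.1) hle2⟩
    have := key u (fun s hs => (h1 s hs).1) hle1
    rw [← toL2_congr (hwF t ht).1] at this
    refine this.congr' ?_
    filter_upwards [self_mem_nhdsWithin] with s hs
    exact (toL2_congr (hwF s hs).1).symm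
  have hH1 : ∀ t ∈ Set.Icc 0 τ, IsH1 (w t) (ux t) := fun t ht => (hwF t (hsub ht)).2
  have hc : ContinuousOn (fun t => toL2 (w t)) (Set.Icc 0 τ) := fun t ht =>
    (hnorm t (hsub ht)).1.mono_left (nhdsWithin_mono _ hsub)
  have hcx : ContinuousOn (fun t => toL2 (ux t)) (Set.Icc 0 τ) := fun t ht =>
    (hnorm t (hsub ht)).2.mono_left (nhdsWithin_mono _ hsub)
  have hV : ContinuousOn (fun t => -fluxOp (toL2 fun x => w t x * ux t x)) (Set.Icc 0 τ) :=
    (fluxOp.continuous.comp_continuousOn (continuousOn_toL2_mul hH1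
      (fun t ht => (hH1 t ht).memLp') hc hcx hcx)).neg
  have hm2 : ∀ t ∈ timeInterval T, MemLp (u t) 2 volume ∧ MemLp (fun x => u t x ^ 2) 2 volume := by
    intro t ht
    obtain ⟨ha, hb⟩ := hwF t ht
    refine ⟨(h1 t ht).1, (hb.mul_memLp hb.memLp).ae_eq ?_⟩
    filter_upwards [ha] with x hx
    rw [hx, pow_two]
  refine ⟨w, ux, ⟨hH1, hc, hcx, ?_⟩, fun t ht => (hwF t (hsub ht)).1, M.toReal,
      ENNReal.toReal_nonneg, ?_⟩
  · refine hasDerivWithinAt_of_weak hτ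
      (Lp.dense_hasCompactSupport_contDiff (F := ℝ) (E := ℝ) (μ := volume) (p := 2)
          (by norm_num)) hV ?_
    rintro F ⟨ψ, hFψ, hψ2, hψ1⟩
    have hψ : IsTest ψ := ⟨hψ1, hψ2⟩
    rw [← toL2_self F, toL2_congr hFψ]
    refine sub_eq_integral_of_weak hτ (a := fun t => ⟪toL2 ψ, toL2 (w t)⟫_ℝ)
      (b := fun t => ⟪toL2 ψ, -fluxOp (toL2 fun x => w t x * ux t x)⟫_ℝ)
      (continuousOn_const.inner hc) (continuousOn_const.inner hV) fun χ hχ hχτ => ?_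
    have ht := hw.integral_mul_test hm2 hτT hχ hχτ hψ
    have e0 : ∀ t ∈ Set.Icc 0 τ, ⟪toL2 ψ, toL2 (w t)⟫_ℝ = ∫ x, u t x * ψ x := fun t ht => by
      rw [inner_toL2 hψ.memLp (hH1 t ht).memLp]
      refine integral_congr_ae ?_
      filter_upwards [(hwF t (hsub ht)).1] with x hx
      rw [hx, mul_comm]
    have e1 : ∀ t ∈ Set.Icc 0 τ, ⟪toL2 ψ, -fluxOp (toL2 fun x => w t x * ux t x)⟫_ℝ =
        ∫ x, (1 / 2 * u t x ^ 2 * deriv ψ x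
          + 3 / 2 * invHelmholtz 1 (fun z => u t z ^ 2) x * deriv ψ x) := fun t ht => by
      have hwu := (hwF t (hsub ht)).1
      have hinv : invHelmholtz 1 (fun z => w t z ^ 2) = invHelmholtz 1 (fun z => u t z ^ 2) :=
        invHelmholtz_congr (hwu.mono fun x hx => by simp only [hx])
      rw [inner_fluxOp (hH1 t ht) hψ, hinv]
      refine integral_congr_ae ?_
      filter_upwards [hwu] with x hx
      rw [hx]
    refine Eq.trans ?_ ht
    rw [e0 0 ⟨le_rfl, hτ⟩]
    congr 1
    refine setIntegral_congr_fun measurableSet_Icc fun t ht => ?_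
    rw [e0 t ht, e1 t ht]
  · intro t ht
    refine ae_abs_le_of_approx (hH1 t ht).memLp' ENNReal.toReal_nonneg fun δ hδ => ?_
    have hev := (tendsto_iff_norm_sub_tendsto_zero.mp (hnorm t (hsub ht)).2).eventually_lt_const hδ
    obtain ⟨O, hO, htO, hOsub⟩ := mem_nhdsWithin.mp hev
    -- the times just after `t` form a set of positive measure
    obtain ⟨r, htr, hrT⟩ := EReal.lt_iff_exists_real_btwn.mp (hsub ht).2
    have htr' : t < r := EReal.coe_lt_coe_iff.mp htr
    obtain ⟨r', htr', hr'⟩ : ∃ r' > t, Set.Ioo t r' ⊆ O ∩ timeInterval T := by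
      obtain ⟨l, r₁, ⟨h4, h5⟩, h6⟩ := mem_nhds_iff_exists_Ioo_subset.mp (hO.mem_nhds htO)
      refine ⟨min r r₁, lt_min htr' h5, fun s hs =>
          ⟨h6 ⟨?_, hs.2.trans_le (min_le_right _ _)⟩, ?_, ?_⟩⟩
      · exact h4.trans hs.1
      · exact ht.1.trans hs.1.le
      · exact lt_trans (EReal.coe_lt_coe_iff.mpr (hs.2.trans_le (min_le_left _ _))) hrT
    obtain ⟨s, hs, hsM⟩ : ∃ s ∈ Set.Ioo t r', ∀ᵐ x, |ux s x| ≤ M.toReal := by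
      by_contra hcon
      simp only [not_exists, not_and] at hcon
      have hz : volume (Set.Ioo t r') = 0 := by
        refine measure_mono_null (fun s hs => ?_)
            ((ae_restrict_iff' (measurableSet_timeInterval T)).mp h3)
        simp only [Set.mem_compl_iff, Set.mem_ofPred_eq]
        intro hall
        have hsT := (hr' hs).2
        obtain ⟨-, -, g, hg, hgM⟩ := hall hsT
        exact hcon s hs (ae_abs_le_of_eVariationOn (h1 s hsT).2.1 hg hM hgM)
      rw [Real.volume_Ioo, ENNReal.ofReal_eq_zero] at hz
      linarith
    refine ⟨ux s, (h1 s (hr' hs).2).2.1, hsM, ?_⟩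
    rw [norm_sub_rev]
    exact hOsub (hr' hs)

/-! ### The multipeakon system of ordinary differential equations -/

/-- A function whose derivative is bounded by a multiple of itself keeps its sign. -/
lemma pos_of_abs_deriv_le {τ Λ : ℝ} {d d' : ℝ → ℝ}
    (hd : ∀ t ∈ Set.Icc 0 τ, HasDerivWithinAt d (d' t) (Set.Icc 0 τ) t)
    (hb : ∀ t ∈ Set.Icc 0 τ, |d' t| ≤ Λ * |d t|) (h0 : 0 < d 0) :
    ∀ t ∈ Set.Icc 0 τ, 0 < d t := by
  have hc : ContinuousOn d (Set.Icc 0 τ) := fun t ht => (hd t ht).continuousWithinAt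
  have hexp : ∀ t : ℝ, HasDerivAt (fun t => Real.exp (2 * Λ * t))
      (Real.exp (2 * Λ * t) * (2 * Λ)) t := fun t => by
    have := ((hasDerivAt_id t).const_mul (2 * Λ)).exp
    simpa using this
  have hg : ∀ t ∈ Set.Icc 0 τ, ∃ g', 0 ≤ g' ∧
      HasDerivWithinAt (fun t => Real.exp (2 * Λ * t) * d t ^ 2) g' (Set.Icc 0 τ) t := by
    intro t ht
    refine ⟨_, ?_, (hexp t).hasDerivWithinAt.mul ((hd t ht).pow 2)⟩
    have h1 : -(Λ * d t ^ 2) ≤ d t * d' t := by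
      have h2 : |d t * d' t| ≤ Λ * d t ^ 2 := by
        rw [abs_mul, ← sq_abs (d t)]
        calc |d t| * |d' t| ≤ |d t| * (Λ * |d t|) := by gcongr; exact hb t ht
          _ = _ := by ring
      exact (abs_le.mp h2).1
    have h3 : Real.exp (2 * Λ * t) * (2 * Λ) * d t ^ 2 +
        Real.exp (2 * Λ * t) * (((2 : ℕ) : ℝ) * d t ^ (2 - 1) * d' t) =
        2 * Real.exp (2 * Λ * t) * (Λ * d t ^ 2 + d t * d' t) := by push_cast; ring
    rw [h3]
    have := Real.exp_pos (2 * Λ * t)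
    exact mul_nonneg (by positivity) (by linarith)
  have hmono : MonotoneOn (fun t => Real.exp (2 * Λ * t) * d t ^ 2) (Set.Icc 0 τ) := by
    refine monotoneOn_of_deriv_nonneg (convex_Icc 0 τ)
      (fun t ht => by obtain ⟨_, _, h⟩ := hg t ht; exact h.continuousWithinAt) ?_ ?_
    · intro t ht
      obtain ⟨_, _, h⟩ := hg t (interior_subset ht)
      exact (h.hasDerivAt (mem_interior_iff_mem_nhds.mp ht)).differentiableAt.differentiableWithinAt
    · intro t ht
      obtain ⟨_, h0, h⟩ := hg t (interior_subset ht)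
      rw [(h.hasDerivAt (mem_interior_iff_mem_nhds.mp ht)).deriv]
      exact h0
  have hne : ∀ t ∈ Set.Icc 0 τ, d t ≠ 0 := by
    intro t ht hz
    have := hmono ⟨le_rfl, ht.1.trans ht.2⟩ ht ht.1
    simp only [mul_zero, Real.exp_zero, one_mul, hz] at this
    have h00 : 0 < d 0 ^ 2 := by positivity
    norm_num at this
    exact h0.ne' this
  intro t ht
  by_contra hneg
  obtain ⟨s, hs, hs0⟩ := intermediate_value_Icc' ht.1 (hc.mono (Set.Icc_subset_Icc_right ht.2))
    ⟨not_lt.mp hneg, h0.le⟩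
  exact hne s ⟨hs.1, hs.2.trans ht.2⟩ hs0

/-- Bounded Lipschitz real functions, with unspecified constants. -/
def IsBoundedLipschitz {E : Type*} [PseudoMetricSpace E] (f : E → ℝ) : Prop :=
  ∃ K C : ℝ, 0 ≤ K ∧ 0 ≤ C ∧ (∀ x y, |f x - f y| ≤ K * dist x y) ∧ ∀ x, |f x| ≤ C

namespace IsBoundedLipschitz

variable {E : Type*} [PseudoMetricSpace E] {f g : E → ℝ}

lemma mul (hf : IsBoundedLipschitz f) (hg : IsBoundedLipschitz g) :
    IsBoundedLipschitz (fun x => f x * g x) := by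
  obtain ⟨K, C, hK, hC, h1, h2⟩ := hf
  obtain ⟨K', C', hK', hC', h1', h2'⟩ := hg
  refine ⟨K * C' + C * K', C * C', by positivity, by positivity, fun x y => ?_, fun x => ?_⟩
  · have e : f x * g x - f y * g y = (f x - f y) * g x + f y * (g x - g y) := by ring
    rw [e]
    refine (abs_add_le _ _).trans ?_
    rw [abs_mul, abs_mul]
    have a1 := mul_le_mul (h1 x y) (h2' x) (abs_nonneg _) (by positivity)
    have a2 := mul_le_mul (h2 y) (h1' x y) (abs_nonneg _) hC
    linarith
  · rw [abs_mul]; exact mul_le_mul (h2 x) (h2' x) (abs_nonneg _) hC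

lemma const (c : ℝ) : IsBoundedLipschitz (fun _ : E => c) :=
  ⟨0, |c|, le_rfl, abs_nonneg c, fun x y => by simp, fun _ => le_rfl⟩

lemma sum {ι : Type*} (s : Finset ι) {f : ι → E → ℝ} (h : ∀ i, IsBoundedLipschitz (f i)) :
    IsBoundedLipschitz (fun x => ∑ i ∈ s, f i x) := by
  choose K C hK hC h1 h2 using h
  refine ⟨∑ i ∈ s, K i, ∑ i ∈ s, C i, Finset.sum_nonneg fun i _ => hK i,
    Finset.sum_nonneg fun i _ => hC i, fun x y => ?_, fun x => ?_⟩
  · rw [← Finset.sum_sub_distrib, Finset.sum_mul]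
    exact (Finset.abs_sum_le_sum_abs _ _).trans (Finset.sum_le_sum fun i _ => h1 i x y)
  · exact (Finset.abs_sum_le_sum_abs _ _).trans (Finset.sum_le_sum fun i _ => h2 i x)

end IsBoundedLipschitz

lemma abs_exp_neg_abs_sub_le (a b : ℝ) : |Real.exp (-|a|) - Real.exp (-|b|)| ≤ |a - b| := by
  have key : ∀ s t : ℝ, 0 ≤ s → s ≤ t → |Real.exp (-s) - Real.exp (-t)| ≤ |s - t| := by
    intro s t hs hst
    have h1 : Real.exp (-t) ≤ Real.exp (-s) := Real.exp_le_exp.mpr (by linarith)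
    rw [abs_of_nonneg (by linarith), abs_of_nonpos (by linarith)]
    have h2 : Real.exp (-t) = Real.exp (-s) * Real.exp (-(t - s)) := by
      rw [← Real.exp_add]; ring_nf
    have h3 := Real.add_one_le_exp (-(t - s))
    have h4 : Real.exp (-s) ≤ 1 := Real.exp_le_one_iff.mpr (by linarith)
    rw [h2]
    nlinarith [Real.exp_pos (-s)]
  refine le_trans ?_ (abs_abs_sub_abs_le_abs_sub a b)
  rcases le_total |a| |b| with h | h
  · exact key _ _ (abs_nonneg _) h
  · rw [abs_sub_comm, abs_sub_comm |a|]; exact key _ _ (abs_nonneg _) h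

/-- Truncation to the interval `[0, P]`. -/
noncomputable def clamp (P x : ℝ) : ℝ := max 0 (min x P)

lemma clamp_nonneg (P x : ℝ) : 0 ≤ clamp P x := le_max_left _ _

lemma clamp_le {P : ℝ} (hP : 0 ≤ P) (x : ℝ) : clamp P x ≤ P := max_le hP (min_le_right _ _)

lemma clamp_le_abs (P x : ℝ) : clamp P x ≤ |x| :=
  max_le (abs_nonneg _) ((min_le_left _ _).trans (le_abs_self _))

lemma clamp_eq {P x : ℝ} (h0 : 0 ≤ x) (h1 : x ≤ P) : clamp P x = x := by
  rw [clamp, min_eq_left h1, max_eq_right h0]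

lemma abs_clamp_sub_le (P x y : ℝ) : |clamp P x - clamp P y| ≤ |x - y| := by
  unfold clamp
  have h1 := abs_max_sub_max_le_max 0 (min x P) 0 (min y P)
  have h2 := abs_min_sub_min_le_max x P y P
  simp only [sub_self, abs_zero] at h1 h2
  exact h1.trans (max_le (abs_nonneg _) (h2.trans (max_le le_rfl (abs_nonneg _))))

section Flow

variable {ι : Type*} [Fintype ι]

/-- The multipeakon vector field for positions `z.1` and momenta `z.2`, with momenta truncated to
`[0, P]` and with the order of the peaks prescribed by the sign matrix `s`. -/
noncomputable def peakonField (P : ℝ) (s : ι → ι → ℝ) (z : (ι → ℝ) × (ι → ℝ)) : (ι → ℝ) × (ι → ℝ) :=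
  (fun i => ∑ j, clamp P (z.2 j) * Real.exp (-|z.1 i - z.1 j|),
   fun i => ∑ j, 2 * s i j * clamp P (z.2 i) * (clamp P (z.2 j) * Real.exp (-|z.1 i - z.1 j|)))

lemma peakonField_bounds {P : ℝ} (hP : 0 ≤ P) (s : ι → ι → ℝ) : ∃ K C : NNReal,
    LipschitzWith K (peakonField P s) ∧ ∀ z, ‖peakonField P s z‖ ≤ C := by
  have hcl : ∀ j, IsBoundedLipschitz (fun z : (ι → ℝ) × (ι → ℝ) => clamp P (z.2 j)) := fun j =>
    ⟨1, P, zero_le_one, hP, fun x y => by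
      rw [one_mul]
      refine (abs_clamp_sub_le _ _ _).trans ?_
      rw [← Real.dist_eq]
      exact (dist_le_pi_dist x.2 y.2 j).trans (le_max_right _ _), fun x => by
      rw [abs_of_nonneg (clamp_nonneg _ _)]; exact clamp_le hP _⟩
  have hex : ∀ i j, IsBoundedLipschitz
      (fun z : (ι → ℝ) × (ι → ℝ) => Real.exp (-|z.1 i - z.1 j|)) := fun i j =>
    ⟨2, 1, zero_le_two, zero_le_one, fun x y => by
      refine (abs_exp_neg_abs_sub_le _ _).trans ?_
      have h1 := (dist_le_pi_dist x.1 y.1 i).trans (le_max_left _ (dist x.2 y.2))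
      have h2 := (dist_le_pi_dist x.1 y.1 j).trans (le_max_left _ (dist x.2 y.2))
      rw [Real.dist_eq] at h1 h2
      have e : x.1 i - x.1 j - (y.1 i - y.1 j) = (x.1 i - y.1 i) - (x.1 j - y.1 j) := by ring
      rw [e]
      refine (abs_sub _ _).trans ?_
      change _ ≤ 2 * max (dist x.1 y.1) (dist x.2 y.2)
      linarith, fun x => by
      rw [abs_of_nonneg (Real.exp_pos _).le]; exact Real.exp_le_one_iff.mpr (by simp)⟩
  have h1 : ∀ i, IsBoundedLipschitz (fun z => (peakonField P s z).1 i) := fun i =>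
    IsBoundedLipschitz.sum _ fun j => (hcl j).mul (hex i j)
  have h2 : ∀ i, IsBoundedLipschitz (fun z => (peakonField P s z).2 i) := fun i =>
    IsBoundedLipschitz.sum _ fun j => ((IsBoundedLipschitz.const (2 * s i j)).mul (hcl i)).mul
      ((hcl j).mul (hex i j))
  choose K₁ C₁ hK₁ hC₁ l₁ b₁ using h1
  choose K₂ C₂ hK₂ hC₂ l₂ b₂ using h2
  have s1 : ∀ {K : ι → ℝ}, (∀ i, 0 ≤ K i) → ∀ i, K i ≤ ∑ j, K j := fun hK i =>
    Finset.single_le_sum (fun j _ => hK j) (Finset.mem_univ i)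
  have n1 := Finset.sum_nonneg (s := Finset.univ) fun i _ => hK₁ i
  have n2 := Finset.sum_nonneg (s := Finset.univ) fun i _ => hK₂ i
  have m1 := Finset.sum_nonneg (s := Finset.univ) fun i _ => hC₁ i
  have m2 := Finset.sum_nonneg (s := Finset.univ) fun i _ => hC₂ i
  refine ⟨⟨∑ i, K₁ i + ∑ i, K₂ i, by positivity⟩, ⟨∑ i, C₁ i + ∑ i, C₂ i, by positivity⟩,
    LipschitzWith.of_dist_le_mul fun x y => ?_, fun z => ?_⟩
  · change _ ≤ (∑ i, K₁ i + ∑ i, K₂ i) * _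
    refine max_le ((dist_pi_le_iff (by positivity)).mpr fun i => ?_)
      ((dist_pi_le_iff (by positivity)).mpr fun i => ?_)
    · rw [Real.dist_eq]
      refine (l₁ i x y).trans (mul_le_mul_of_nonneg_right ?_ dist_nonneg)
      linarith [s1 hK₁ i]
    · rw [Real.dist_eq]
      refine (l₂ i x y).trans (mul_le_mul_of_nonneg_right ?_ dist_nonneg)
      linarith [s1 hK₂ i]
  · change _ ≤ ∑ i, C₁ i + ∑ i, C₂ i
    refine max_le ((pi_norm_le_iff_of_nonneg (by positivity)).mpr fun i => ?_)
      ((pi_norm_le_iff_of_nonneg (by positivity)).mpr fun i => ?_)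
    · refine (b₁ i z).trans ?_
      linarith [s1 hC₁ i]
    · refine (b₂ i z).trans ?_
      linarith [s1 hC₂ i]

/-- Global existence for the truncated system, whose field is bounded and globally Lipschitz. -/
lemma exists_peakonField_flow {P τ : ℝ} (hP : 0 ≤ P) (hτ : 0 ≤ τ) (s : ι → ι → ℝ)
    (z₀ : (ι → ℝ) × (ι → ℝ)) : ∃ z : ℝ → (ι → ℝ) × (ι → ℝ), z 0 = z₀ ∧
      ∀ t ∈ Set.Icc 0 τ, HasDerivWithinAt z (peakonField P s (z t)) (Set.Icc 0 τ) t := by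
  obtain ⟨K, C, hK, hC⟩ := peakonField_bounds hP s
  have hpl : IsPicardLindelof (fun _ => peakonField P s) (tmin := 0) (tmax := τ)
      ⟨0, le_rfl, hτ⟩ z₀ (C * τ.toNNReal) 0 C K :=
    { lipschitzOnWith := fun t _ => hK.lipschitzOnWith
      continuousOn := fun x _ => continuousOn_const
      norm_le := fun t _ x _ => hC x
      mul_max_le := by
        rw [sub_zero, sub_zero, max_eq_left hτ, NNReal.coe_zero, sub_zero, NNReal.coe_mul,
          Real.coe_toNNReal τ hτ] }
  exact hpl.exists_eq_forall_mem_Icc_hasDerivWithinAt₀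

/-- Global existence of multipeakons with positive momenta: the peaks never collide and the
momenta stay positive. For the truncated system with `P` the total initial momentum, differences of
positions and single momenta satisfy `|d'| ≤ Λ |d|` and so keep their signs, while antisymmetry of
the interaction conserves the total momentum; hence the truncation is never active. -/
lemma exists_multipeakon {τ : ℝ} (hτ : 0 ≤ τ) {q₀ p₀ : ι → ℝ} (hq : Function.Injective q₀)
    (hp : ∀ i, 0 < p₀ i) : ∃ q p : ℝ → ι → ℝ, q 0 = q₀ ∧ p 0 = p₀ ∧
      ∀ t ∈ Set.Icc 0 τ, (∀ i, 0 ≤ p t i) ∧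
        (∀ i, HasDerivWithinAt (fun r => q r i)
          (∑ j, p t j * Real.exp (-|q t i - q t j|)) (Set.Icc 0 τ) t) ∧
        ∀ i, HasDerivWithinAt (fun r => p r i)
          (∑ j, 2 * (SignType.sign (q t i - q t j) : ℝ) * p t i *
            (p t j * Real.exp (-|q t i - q t j|))) (Set.Icc 0 τ) t := by
  set P := ∑ i, p₀ i
  have hP : 0 ≤ P := Finset.sum_nonneg fun i _ => (hp i).le
  set s : ι → ι → ℝ := fun i j => (SignType.sign (q₀ i - q₀ j) : ℝ)
  have hs1 : ∀ i j, |s i j| ≤ 1 := fun i j => by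
    simp only [s]; rw [sign_apply]; split_ifs <;> simp
  have hanti : ∀ i j, s i j = -s j i := fun i j => by
    simp only [s]
    rw [← neg_sub (q₀ j) (q₀ i), Left.sign_neg]; simp
  obtain ⟨z, hz0, hz⟩ := exists_peakonField_flow hP hτ s (q₀, p₀)
  set q : ℝ → ι → ℝ := fun t => (z t).1
  set p : ℝ → ι → ℝ := fun t => (z t).2
  have hqd : ∀ t ∈ Set.Icc 0 τ, ∀ i, HasDerivWithinAt (fun r => q r i)
      (∑ j, clamp P (p t j) * Real.exp (-|q t i - q t j|)) (Set.Icc 0 τ) t := fun t ht i =>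
    ((ContinuousLinearMap.proj (R := ℝ) (φ := fun _ : ι => ℝ) i).comp
      (ContinuousLinearMap.fst ℝ (ι → ℝ) (ι → ℝ))).hasFDerivAt.comp_hasDerivWithinAt t (hz t ht)
  have hpd : ∀ t ∈ Set.Icc 0 τ, ∀ i, HasDerivWithinAt (fun r => p r i)
      (∑ j, 2 * s i j * clamp P (p t i) * (clamp P (p t j) * Real.exp (-|q t i - q t j|)))
      (Set.Icc 0 τ) t := fun t ht i =>
    ((ContinuousLinearMap.proj (R := ℝ) (φ := fun _ : ι => ℝ) i).comp
      (ContinuousLinearMap.snd ℝ (ι → ℝ) (ι → ℝ))).hasFDerivAt.comp_hasDerivWithinAt t (hz t ht)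
  have hq0 : q 0 = q₀ := by simp only [q, hz0]
  have hp0 : p 0 = p₀ := by simp only [p, hz0]
  have hkb : ∀ t i j, |clamp P (p t j) * Real.exp (-|q t i - q t j|)| ≤ P := fun t i j => by
    rw [abs_of_nonneg (mul_nonneg (clamp_nonneg _ _) (Real.exp_pos _).le)]
    have : Real.exp (-|q t i - q t j|) ≤ 1 := Real.exp_le_one_iff.mpr (by simp)
    nlinarith [clamp_nonneg P (p t j), clamp_le hP (p t j)]
  -- the order of the peaks is preserved
  have hord : ∀ i j, q₀ i < q₀ j → ∀ t ∈ Set.Icc 0 τ, q t i < q t j := by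
    intro i j hij t ht
    refine sub_pos.mp (pos_of_abs_deriv_le (τ := τ) (Λ := ∑ _k : ι, P) (d := fun r => q r j - q r i)
      (fun r hr => (hqd r hr j).sub (hqd r hr i)) (fun r _ => ?_) ?_ t ht)
    · rw [← Finset.sum_sub_distrib, Finset.sum_mul]
      refine (Finset.abs_sum_le_sum_abs _ _).trans (Finset.sum_le_sum fun k _ => ?_)
      rw [← mul_sub, abs_mul, abs_of_nonneg (clamp_nonneg _ _)]
      refine mul_le_mul (clamp_le hP _) ?_ (abs_nonneg _) hP
      refine (abs_exp_neg_abs_sub_le _ _).trans (le_of_eq ?_)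
      congr 1; ring
    · simp only [hq0]; linarith
  have hsign : ∀ i j, ∀ t ∈ Set.Icc 0 τ, s i j = (SignType.sign (q t i - q t j) : ℝ) := by
    intro i j t ht
    rcases lt_trichotomy (q₀ i) (q₀ j) with h | h | h
    · simp only [s]
      rw [sign_neg (sub_neg.mpr h), sign_neg (sub_neg.mpr (hord i j h t ht))]
    · have := hq h
      subst this; simp [s]
    · simp only [s]
      rw [sign_pos (sub_pos.mpr h), sign_pos (sub_pos.mpr (hord j i h t ht))]
  -- the momenta stay positive
  have hpos : ∀ i, ∀ t ∈ Set.Icc 0 τ, 0 < p t i := by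
    intro i
    refine pos_of_abs_deriv_le (Λ := ∑ _k : ι, 2 * P) (fun r hr => hpd r hr i) (fun r _ => ?_)
      (by rw [hp0]; exact hp i)
    rw [Finset.sum_mul]
    refine (Finset.abs_sum_le_sum_abs _ _).trans (Finset.sum_le_sum fun k _ => ?_)
    rw [abs_mul, abs_mul, abs_mul, abs_two, abs_of_nonneg (clamp_nonneg P (p r i))]
    calc 2 * |s i k| * clamp P (p r i) * |clamp P (p r k) * Real.exp (-|q r i - q r k|)|
        ≤ 2 * 1 * |p r i| * P := by
          refine mul_le_mul (mul_le_mul ?_ (clamp_le_abs _ _) (clamp_nonneg _ _) (by norm_num))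
            (hkb r i k) (abs_nonneg _) (by positivity)
          linarith [hs1 i k]
      _ = 2 * P * |p r i| := by ring
  -- the total momentum is conserved
  have hsum : ∀ t ∈ Set.Icc 0 τ, ∑ i, p t i = P := by
    intro t ht
    have := constant_of_hasDerivWithinAt_zero (τ := τ) (f := fun t => ∑ i, p t i) (fun r hr => by
      refine (HasDerivWithinAt.fun_sum fun i _ => hpd r hr i).congr_deriv ?_
      have hswap := Finset.sum_comm (s := Finset.univ) (t := Finset.univ) (f := fun i j : ι =>
        2 * s i j * clamp P (p r i) * (clamp P (p r j) * Real.exp (-|q r i - q r j|)))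
      have hneg : ∑ j, ∑ i, 2 * s i j * clamp P (p r i) * (clamp P (p r j) *
          Real.exp (-|q r i - q r j|)) = -∑ i, ∑ j, 2 * s i j * clamp P (p r i) *
          (clamp P (p r j) * Real.exp (-|q r i - q r j|)) := by
        rw [← Finset.sum_neg_distrib]
        refine Finset.sum_congr rfl fun j _ => ?_
        rw [← Finset.sum_neg_distrib]
        refine Finset.sum_congr rfl fun i _ => ?_
        rw [hanti i j, abs_sub_comm]; ring
      linarith) t ht
    rw [this, hp0]
  have hclamp : ∀ i, ∀ t ∈ Set.Icc 0 τ, clamp P (p t i) = p t i := fun i t ht =>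
    clamp_eq (hpos i t ht).le (by
      rw [← hsum t ht]
      exact Finset.single_le_sum (fun j _ => (hpos j t ht).le) (Finset.mem_univ i))
  refine ⟨q, p, hq0, hp0, fun t ht => ⟨fun i => (hpos i t ht).le, fun i => ?_, fun i => ?_⟩⟩
  · have := hqd t ht i
    simpa only [hclamp _ t ht] using this
  · have := hpd t ht i
    simpa only [hclamp _ t ht, hsign _ _ t ht] using this

end Flow

/-! ### Multipeakons are strong solutions -/

section Pairing

variable {ψ ψ' η η' : ℝ → ℝ}

lemma IsResolvent.hasDerivAt (h : IsResolvent 1 ψ η η') (x : ℝ) : HasDerivAt η (η' x) x :=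
  h.left.toIsPrimitive.hasDerivAt h.right.continuous x

lemma IsResolvent.hasDerivAt_deriv (h : IsResolvent 1 ψ η η') (hψ : Continuous ψ) (x : ℝ) :
    HasDerivAt η' (η x - ψ x) x := by
  have := h.right.toIsPrimitive.hasDerivAt ((h.left.continuous.const_mul _).sub hψ) x
  simpa using this

lemma IsResolvent.exists_bound_add (h : IsResolvent 1 ψ η η') (hψ : IsH1 ψ ψ') :
    ∃ C, ∀ x, ‖ψ x + 3 * η x‖ ≤ C :=
  let ⟨C, _, hC⟩ := (hψ.add (h.left.const_mul 3)).exists_bound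
  ⟨C, hC⟩

lemma IsResolvent.integrableOn_Iic (h : IsResolvent 1 ψ η η') (hψ : IsH1 ψ ψ') (a : ℝ) :
    IntegrableOn (fun x => Real.exp (2 * x) * (ψ x + 3 * η x)) (Set.Iic a) :=
  let ⟨C, hC⟩ := h.exists_bound_add hψ
  (integrableOn_exp_mul_Iic two_pos a).mul_bdd (c := C)
    (hψ.continuous.add (h.left.continuous.const_mul 3)).aestronglyMeasurable
        (Eventually.of_forall hC)

lemma IsResolvent.integrableOn_Ioi (h : IsResolvent 1 ψ η η') (hψ : IsH1 ψ ψ') (a : ℝ) :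
    IntegrableOn (fun x => Real.exp (-2 * x) * (ψ x + 3 * η x)) (Set.Ioi a) :=
  let ⟨C, hC⟩ := h.exists_bound_add hψ
  (exp_neg_integrableOn_Ioi a two_pos).mul_bdd (c := C)
    (hψ.continuous.add (h.left.continuous.const_mul 3)).aestronglyMeasurable
        (Eventually.of_forall hC)

lemma IsResolvent.integral_Iic (h : IsResolvent 1 ψ η η') (hψ : IsH1 ψ ψ') (a : ℝ) :
    ∫ x in Set.Iic a, Real.exp (2 * x) * (ψ x + 3 * η x) =
      Real.exp (2 * a) * (2 * η a - η' a) := by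
  have hd : ∀ x ∈ Set.Iic a, HasDerivAt (fun x => Real.exp (2 * x) * (2 * η x - η' x))
      (Real.exp (2 * x) * (ψ x + 3 * η x)) x := fun x _ => by
    have h1 : HasDerivAt (fun x => Real.exp (2 * x)) (Real.exp (2 * x) * 2) x := by
      simpa using ((hasDerivAt_id x).const_mul 2).exp
    refine (h1.mul (((h.hasDerivAt x).const_mul 2).sub
      (h.hasDerivAt_deriv hψ.continuous x))).congr_deriv ?_
    simp only [Pi.sub_apply]
    ring
  rw [integral_Iic_of_hasDerivAt_of_tendsto' hd (h.integrableOn_Iic hψ a) (m := 0), sub_zero]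
  have h1 : Tendsto (fun x : ℝ => Real.exp (2 * x)) atBot (𝓝 0) :=
    Real.tendsto_exp_atBot.comp (tendsto_id.const_mul_atBot two_pos)
  simpa using h1.mul ((h.left.tendsto_zero.2.const_mul 2).sub h.right.tendsto_zero.2)

lemma IsResolvent.integral_Ioi (h : IsResolvent 1 ψ η η') (hψ : IsH1 ψ ψ') (a : ℝ) :
    ∫ x in Set.Ioi a, Real.exp (-2 * x) * (ψ x + 3 * η x) =
      Real.exp (-2 * a) * (2 * η a + η' a) := by
  have hd : ∀ x ∈ Set.Ici a, HasDerivAt (fun x => Real.exp (-2 * x) * (-(2 * η x + η' x)))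
      (Real.exp (-2 * x) * (ψ x + 3 * η x)) x := fun x _ => by
    have h1 : HasDerivAt (fun x => Real.exp (-2 * x)) (Real.exp (-2 * x) * (-2)) x := by
      simpa using ((hasDerivAt_id x).const_mul (-2)).exp
    refine (h1.mul (((h.hasDerivAt x).const_mul 2).add
      (h.hasDerivAt_deriv hψ.continuous x)).neg).congr_deriv ?_
    simp only [Pi.neg_apply, Pi.add_apply]
    ring
  rw [integral_Ioi_of_hasDerivAt_of_tendsto' hd (h.integrableOn_Ioi hψ a) (m := 0)]
  · ring
  have h1 : Tendsto (fun x : ℝ => Real.exp (-2 * x)) atTop (𝓝 0) :=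
    Real.tendsto_exp_atBot.comp (tendsto_id.const_mul_atTop_of_neg (by norm_num))
  simpa using h1.mul ((h.left.tendsto_zero.1.const_mul 2).add h.right.tendsto_zero.1).neg

/-- The quadratic interaction of two unit peakons at `a` and `b`: minus the derivative of
`e^{-|x - a|} e^{-|x - b|}` vanishes between the peaks, and is a pure exponential on either side of
them, where the test function `ψ + 3 η` has an explicit primitive. -/
lemma IsResolvent.integral_peakon_pair (h : IsResolvent 1 ψ η η') (hψ : IsH1 ψ ψ') {a b : ℝ}
    (hab : a ≤ b) :
    ∫ x, (ψ x + 3 * η x) * (((SignType.sign (x - a) : ℝ) + (SignType.sign (x - b) : ℝ)) *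
      (peakon 1 (x - a) * peakon 1 (x - b))) =
      2 * Real.exp (-|a - b|) * (η' a + η' b +
        2 * (SignType.sign (a - b) : ℝ) * (η a - η b)) := by
  have hi1 := (integrable_indicator_iff measurableSet_Iic).mpr
    ((h.integrableOn_Iic hψ a).const_mul (-2 * Real.exp (-a - b)))
  have hi2 := (integrable_indicator_iff measurableSet_Ioi).mpr
    ((h.integrableOn_Ioi hψ b).const_mul (2 * Real.exp (a + b)))
  have hae : (fun x => (ψ x + 3 * η x) *
      (((SignType.sign (x - a) : ℝ) + (SignType.sign (x - b) : ℝ)) *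
      (peakon 1 (x - a) * peakon 1 (x - b)))) =ᵐ[volume] fun x =>
      (Set.Iic a).indicator
        (fun x => -2 * Real.exp (-a - b) * (Real.exp (2 * x) * (ψ x + 3 * η x))) x +
      (Set.Ioi b).indicator
        (fun x => 2 * Real.exp (a + b) * (Real.exp (-2 * x) * (ψ x + 3 * η x))) x := by
    have hne : ∀ c : ℝ, ∀ᵐ x, x ≠ c := fun c => by
      simp [ae_iff]
    filter_upwards [hne a, hne b] with x hxa hxb
    simp only [peakon, one_mul, ← Real.exp_add]
    rcases lt_or_gt_of_ne hxa with h1 | h1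
    · rw [Set.indicator_of_mem (Set.mem_Iic.mpr h1.le),
        Set.indicator_of_notMem (by simp; linarith), sign_neg (by linarith),
        sign_neg (by linarith), abs_of_neg (by linarith), abs_of_neg (by linarith)]
      have e : Real.exp (- -(x - a) + - -(x - b)) = Real.exp (-a - b) * Real.exp (2 * x) := by
        rw [← Real.exp_add]; congr 1; ring
      rw [e]; simp; ring
    · rw [Set.indicator_of_notMem (by simpa using h1), sign_pos (by linarith)]
      rcases lt_or_gt_of_ne hxb with h2 | h2
      · rw [Set.indicator_of_notMem (by simp; linarith), sign_neg (by linarith)]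
        simp
      · rw [Set.indicator_of_mem (Set.mem_Ioi.mpr h2), sign_pos (by linarith),
          abs_of_pos (by linarith), abs_of_pos (by linarith)]
        have e : Real.exp (-(x - a) + -(x - b)) = Real.exp (a + b) * Real.exp (-2 * x) := by
          rw [← Real.exp_add]; congr 1; ring
        rw [e]; simp; ring
  rw [integral_congr_ae hae, integral_add hi1 hi2, integral_indicator measurableSet_Iic,
    integral_indicator measurableSet_Ioi, integral_const_mul, integral_const_mul,
    h.integral_Iic hψ, h.integral_Ioi hψ]
  have e1 : Real.exp (-a - b) * Real.exp (2 * a) = Real.exp (-|a - b|) := by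
    rw [← Real.exp_add, abs_of_nonpos (by linarith)]; congr 1; ring
  have e2 : Real.exp (a + b) * Real.exp (-2 * b) = Real.exp (-|a - b|) := by
    rw [← Real.exp_add, abs_of_nonpos (by linarith)]; congr 1; ring
  have e3 : (SignType.sign (a - b) : ℝ) * (η a - η b) = -(η a - η b) := by
    rcases hab.eq_or_lt with rfl | h1
    · simp
    · rw [sign_neg (by linarith)]; simp
  linear_combination (-2 * (2 * η a - η' a)) * e1 + 2 * (2 * η b + η' b) * e2 -
    4 * Real.exp (-|a - b|) * e3

/-- The two mixed terms of a pair of peaks, in either order. -/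
lemma IsResolvent.integral_peakon_pair_add (h : IsResolvent 1 ψ η η') (hψ : IsH1 ψ ψ') (a b : ℝ) :
    (∫ x, (ψ x + 3 * η x) * (peakon 1 (x - a) * ((SignType.sign (x - b) : ℝ) * peakon 1 (x - b)))) +
    ∫ x, (ψ x + 3 * η x) * (peakon 1 (x - b) * ((SignType.sign (x - a) : ℝ) * peakon 1 (x - a))) =
      2 * Real.exp (-|a - b|) * (η' a + η' b +
        2 * (SignType.sign (a - b) : ℝ) * (η a - η b)) := by
  have hint : ∀ a b, Integrable fun x => (ψ x + 3 * η x) *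
      (peakon 1 (x - a) * ((SignType.sign (x - b) : ℝ) * peakon 1 (x - b))) := fun a b => by
    have m : MemLp (fun x => (SignType.sign (x - b) : ℝ) * peakon 1 (x - b)) 2 volume := by
      simpa only [neg_mul, one_mul, mul_neg, neg_neg] using (isH1_peakon 1 b).memLp'.const_mul (-1)
    exact integrable_mul (hψ.add (h.left.const_mul 3)).memLp ((isH1_peakon 1 a).mul_memLp m)
  rw [← integral_add (hint a b) (hint b a)]
  rcases le_total a b with hab | hab
  · rw [← h.integral_peakon_pair hψ hab]
    congr 1; funext x; ring
  · have e : (SignType.sign (a - b) : ℝ) * (η a - η b) =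
        (SignType.sign (b - a) : ℝ) * (η b - η a) := by
      rw [← neg_sub a b, Left.sign_neg]; push_cast; ring
    rw [mul_assoc 2 (SignType.sign (a - b) : ℝ), e, abs_sub_comm, add_comm (η' a), ← mul_assoc 2 _
        (η b - η a),
      ← h.integral_peakon_pair hψ hab]
    congr 1; funext x; ring

end Pairing

/-- Translation is continuous on `L²(ℝ)`. -/
lemma continuous_toL2_translate {f : ℝ → ℝ} (hf : MemLp f 2 volume) :
    Continuous fun z : ℝ => toL2 fun x => f (x - z) := by
  let g : ℝ → C(ℝ, ℝ) := fun z => ⟨fun x => x - z, by fun_prop⟩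
  have hg : Continuous g := ContinuousMap.continuous_of_continuous_uncurry _ (by
    change Continuous fun p : ℝ × ℝ => p.2 - p.1
    fun_prop)
  have hm : ∀ z, MeasurePreserving (g z) volume volume := fun z => measurePreserving_sub_right _ z
  have := (continuous_const (y := toL2 f)).compMeasurePreservingLp hg hm (by norm_num)
  refine this.congr fun z => ?_
  have hfz : MemLp (fun x => f (x - z)) 2 volume := hf.comp_measurePreserving (hm z)
  rw [toL2, dif_pos hf, toL2, dif_pos hfz]
  exact Lp.toLp_compMeasurePreserving hf (hm z)

section Multipeakon

variable {ι : Type*} [Fintype ι]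

lemma toL2_sum {f : ι → ℝ → ℝ} (hf : ∀ i, MemLp (f i) 2 volume) :
    toL2 (fun x => ∑ i, f i x) = ∑ i, toL2 (f i) := by
  have key : ∀ s : Finset ι, toL2 (fun x => ∑ i ∈ s, f i x) = ∑ i ∈ s, toL2 (f i) := by
    classical
    intro s
    induction s using Finset.induction_on with
    | empty =>
      have := toL2_const_mul (f := fun _ => 0) 0 MemLp.zero'
      simpa using this
    | insert a s ha ih =>
      simp only [Finset.sum_insert ha]
      rw [toL2_add (hf a) (memLp_finsetSum s fun i _ => hf i), ih]
  exact key _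

/-- Double sums agree as soon as the symmetrized summands do. -/
lemma sum_sum_eq_of_symm {A B : ι → ι → ℝ} (h : ∀ i j, A i j + A j i = B i j + B j i) :
    ∑ i, ∑ j, A i j = ∑ i, ∑ j, B i j := by
  have h1 : ∑ i, ∑ j, (A i j + A j i) = ∑ i, ∑ j, (B i j + B j i) :=
    Finset.sum_congr rfl fun i _ => Finset.sum_congr rfl fun j _ => h i j
  simp only [Finset.sum_add_distrib] at h1
  rw [Finset.sum_comm (f := fun i j => A j i), Finset.sum_comm (f := fun i j => B j i)] at h1
  linarith

lemma isH1_multipeakon (p q : ι → ℝ) : IsH1 (fun x => ∑ i, peakon (p i) (x - q i))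
    (fun x => ∑ i, -(SignType.sign (x - q i) : ℝ) * peakon (p i) (x - q i)) :=
  IsH1.sum _ fun i _ => isH1_peakon (p i) (q i)

/-- The flux of a multipeakon tested against `ψ`, by the pairwise interaction integrals. -/
lemma inner_fluxOp_multipeakon {ψ η η' ψ' : ℝ → ℝ} (h : IsResolvent 1 ψ η η') (hψ : IsH1 ψ ψ')
    (p q : ι → ℝ) :
    ⟪toL2 ψ, -fluxOp (toL2 fun x => (∑ i, peakon (p i) (x - q i)) *
      ∑ i, -(SignType.sign (x - q i) : ℝ) * peakon (p i) (x - q i))⟫_ℝ =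
    ∑ i, 2 * ((∑ j, 2 * (SignType.sign (q i - q j) : ℝ) * p i *
      (p j * Real.exp (-|q i - q j|))) * η (q i) +
      p i * (η' (q i) * ∑ j, p j * Real.exp (-|q i - q j|))) := by
  have hu := isH1_multipeakon p q
  have m := hu.mul_memLp hu.memLp'
  have hη : η = invHelmholtz 1 ψ := (h.eq_invHelmholtz one_pos hψ.memLp).symm
  have hζ := (hψ.add (h.left.const_mul 3)).memLp
  have e0 : fluxOp (toL2 ψ) = toL2 (fun x => ψ x + 3 * η x) := by
    rw [toL2_add hψ.memLp (h.left.memLp.const_mul 3), toL2_const_mul 3 h.left.memLp,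
      fluxOp_apply, resolvent_toL2 one_pos hψ.memLp, hη]
  rw [inner_neg_right, ← fluxOp_symm, e0, inner_toL2 hζ m, ← integral_neg]
  have hint : ∀ i j, Integrable fun x => p i * p j * ((ψ x + 3 * η x) *
      (peakon 1 (x - q i) * ((SignType.sign (x - q j) : ℝ) * peakon 1 (x - q j)))) := fun i j => by
    have m : MemLp (fun x => (SignType.sign (x - q j) : ℝ) * peakon 1 (x - q j)) 2 volume := by
      simpa only [neg_mul, one_mul, mul_neg, neg_neg] using (isH1_peakon 1 (q j)).memLp'.const_mul
          (-1)
    exact (integrable_mul hζ ((isH1_peakon 1 (q i)).mul_memLp m)).const_mul _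
  have e1 : ∀ x, -((ψ x + 3 * η x) * ((∑ i, peakon (p i) (x - q i)) *
      ∑ i, -(SignType.sign (x - q i) : ℝ) * peakon (p i) (x - q i))) =
      ∑ i, ∑ j, p i * p j * ((ψ x + 3 * η x) *
      (peakon 1 (x - q i) * ((SignType.sign (x - q j) : ℝ) * peakon 1 (x - q j)))) := fun x => by
    rw [Finset.sum_mul_sum, Finset.mul_sum, ← Finset.sum_neg_distrib]
    refine Finset.sum_congr rfl fun i _ => ?_
    rw [Finset.mul_sum, ← Finset.sum_neg_distrib]
    refine Finset.sum_congr rfl fun j _ => ?_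
    simp only [peakon]; ring
  simp only [e1]
  rw [integral_finsetSum _ fun i _ => integrable_finsetSum _ fun j _ => hint i j]
  simp only [integral_finsetSum _ fun j _ => hint _ j, integral_const_mul]
  have e2 : ∀ i, 2 * ((∑ j, 2 * (SignType.sign (q i - q j) : ℝ) * p i *
      (p j * Real.exp (-|q i - q j|))) * η (q i) +
      p i * (η' (q i) * ∑ j, p j * Real.exp (-|q i - q j|))) =
      ∑ j, 2 * p i * p j * Real.exp (-|q i - q j|) *
        (2 * (SignType.sign (q i - q j) : ℝ) * η (q i) + η' (q i)) := fun i => by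
    rw [Finset.sum_mul, Finset.mul_sum, Finset.mul_sum, ← Finset.sum_add_distrib, Finset.mul_sum]
    exact Finset.sum_congr rfl fun j _ => by ring
  simp only [e2]
  refine sum_sum_eq_of_symm fun i j => ?_
  have h1 := h.integral_peakon_pair_add hψ (q i) (q j)
  have e3 : (SignType.sign (q j - q i) : ℝ) = -(SignType.sign (q i - q j) : ℝ) := by
    rw [← neg_sub (q i) (q j), Left.sign_neg]; push_cast; ring
  rw [abs_sub_comm (q j), e3]
  linear_combination p i * p j * h1

/-- A multipeakon whose positions and momenta solve the multipeakon system is a strong solution. -/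
lemma isStrongSolution_multipeakon {τ : ℝ} (hτ : 0 ≤ τ) {q p : ℝ → ι → ℝ}
    (hq : ∀ t ∈ Set.Icc 0 τ, ∀ i, HasDerivWithinAt (fun r => q r i)
      (∑ j, p t j * Real.exp (-|q t i - q t j|)) (Set.Icc 0 τ) t)
    (hp : ∀ t ∈ Set.Icc 0 τ, ∀ i, HasDerivWithinAt (fun r => p r i)
      (∑ j, 2 * (SignType.sign (q t i - q t j) : ℝ) * p t i *
        (p t j * Real.exp (-|q t i - q t j|))) (Set.Icc 0 τ) t) :
    IsStrongSolution τ (fun t x => ∑ i, peakon (p t i) (x - q t i))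
      (fun t x => ∑ i, -(SignType.sign (x - q t i) : ℝ) * peakon (p t i) (x - q t i)) := by
  have hH : ∀ t ∈ Set.Icc 0 τ, IsH1 (fun x => ∑ i, peakon (p t i) (x - q t i))
      (fun x => ∑ i, -(SignType.sign (x - q t i) : ℝ) * peakon (p t i) (x - q t i)) :=
    fun t _ => isH1_multipeakon _ _
  have cq : ∀ i, ContinuousOn (fun t => q t i) (Set.Icc 0 τ) := fun i t ht =>
    (hq t ht i).continuousWithinAt
  have cp : ∀ i, ContinuousOn (fun t => p t i) (Set.Icc 0 τ) := fun i t ht =>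
    (hp t ht i).continuousWithinAt
  have hsum : ∀ {f : ℝ → ℝ}, MemLp f 2 volume → ContinuousOn
      (fun t => toL2 fun x => ∑ i, p t i * f (x - q t i)) (Set.Icc 0 τ) := by
    intro f hf
    have hfz : ∀ z, MemLp (fun x => f (x - z)) 2 volume := fun z =>
      hf.comp_measurePreserving (measurePreserving_sub_right _ z)
    have e : ∀ t, (toL2 fun x => ∑ i, p t i * f (x - q t i)) =
        ∑ i, p t i • toL2 fun x => f (x - q t i) := fun t => by
      rw [toL2_sum fun i => (hfz (q t i)).const_mul (p t i)]
      exact Finset.sum_congr rfl fun i _ => toL2_const_mul _ (hfz _)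
    simp only [e]
    exact continuousOn_finsetSum _ fun i _ =>
      (cp i).smul ((continuous_toL2_translate hf).comp_continuousOn (cq i))
  have hc : ContinuousOn (fun t => toL2 fun x => ∑ i, peakon (p t i) (x - q t i))
      (Set.Icc 0 τ) := by
    have := hsum (by simpa using (isH1_peakon 1 0).memLp)
    simpa only [peakon, one_mul] using this
  have hcx : ContinuousOn (fun t => toL2 fun x =>
      ∑ i, -(SignType.sign (x - q t i) : ℝ) * peakon (p t i) (x - q t i)) (Set.Icc 0 τ) := by
    have := hsum (f := fun x => -(SignType.sign x : ℝ) * peakon 1 x)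
      (by simpa using (isH1_peakon 1 0).memLp')
    refine this.congr fun t _ => ?_
    refine congrArg toL2 (funext fun x => Finset.sum_congr rfl fun i _ => ?_)
    simp only [peakon]; ring
  have hV : ContinuousOn (fun t => -fluxOp (toL2 fun x => (∑ i, peakon (p t i) (x - q t i)) *
      ∑ i, -(SignType.sign (x - q t i) : ℝ) * peakon (p t i) (x - q t i))) (Set.Icc 0 τ) :=
    (fluxOp.continuous.comp_continuousOn
      (continuousOn_toL2_mul hH (fun t ht => (hH t ht).memLp') hc hcx hcx)).neg
  refine ⟨hH, hc, hcx, hasDerivWithinAt_of_weak hτ (Lp.dense_hasCompactSupport_contDiff (F := ℝ)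
    (E := ℝ) (μ := volume) (p := 2) (by norm_num)) hV ?_⟩
  rintro F ⟨ψ, hFψ, hψ2, hψ1⟩ t ht
  have hψ : IsTest ψ := ⟨hψ1, hψ2⟩
  rw [← toL2_self F, toL2_congr hFψ]
  have hr := isResolvent_invHelmholtz one_pos hψ.memLp
  set η := invHelmholtz 1 ψ with hη
  have hval : ∀ r ∈ Set.Icc 0 τ, ⟪toL2 ψ, toL2 fun x => ∑ i, peakon (p r i) (x - q r i)⟫_ℝ =
      ∑ i, 2 * (p r i * η (q r i)) := fun r hr => by
    rw [inner_toL2 hψ.memLp (hH r hr).memLp]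
    simp only [Finset.mul_sum]
    rw [integral_finsetSum _ fun i _ => integrable_mul hψ.memLp (isH1_peakon _ _).memLp]
    refine Finset.sum_congr rfl fun i _ => ?_
    have := integral_peakon_mul (p r i) (q r i) ψ
    simp only [mul_comm (ψ _)]
    rw [this]; ring
  have hder : ∀ r ∈ Set.Icc 0 τ, HasDerivWithinAt
      (fun r => ⟪toL2 ψ, toL2 fun x => ∑ i, peakon (p r i) (x - q r i)⟫_ℝ)
      ⟪toL2 ψ, -fluxOp (toL2 fun x => (∑ i, peakon (p r i) (x - q r i)) *
        ∑ i, -(SignType.sign (x - q r i) : ℝ) * peakon (p r i) (x - q r i))⟫_ℝ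
      (Set.Icc 0 τ) r := fun r hr' => by
    rw [inner_fluxOp_multipeakon hr hψ.isH1]
    refine HasDerivWithinAt.congr ?_ hval (hval r hr')
    refine HasDerivWithinAt.fun_sum fun i _ => ?_
    have h1 : HasDerivWithinAt (fun r => η (q r i))
        (deriv η (q r i) * ∑ j, p r j * Real.exp (-|q r i - q r j|)) (Set.Icc 0 τ) r :=
      HasDerivAt.comp_hasDerivWithinAt (h := fun r => q r i) r (hr.hasDerivAt (q r i)) (hq r hr' i)
    exact ((hp r hr' i).fun_mul h1).const_mul 2
  refine (intervalIntegral.integral_eq_sub_of_hasDerivAt_of_le ht.1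
    (fun r hr => ((hder r ⟨hr.1, hr.2.trans ht.2⟩).continuousWithinAt.mono
      (Set.Icc_subset_Icc_right ht.2)))
    (fun r hr => (hder r ⟨hr.1.le, hr.2.le.trans ht.2⟩).hasDerivAt
      (Icc_mem_nhds hr.1 (hr.2.trans_le ht.2))) ?_).symm
  refine ContinuousOn.intervalIntegrable ?_
  rw [Set.uIcc_of_le ht.1]
  exact continuousOn_const.inner (hV.mono (Set.Icc_subset_Icc_right ht.2))

end Multipeakon

/-! ### Nonnegative momentum and the cone of peakons -/

lemma IsNonnegMomentum.congr {f g : ℝ → ℝ} (h : IsNonnegMomentum f) (hfg : f =ᵐ[volume] g) :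
    IsNonnegMomentum g := by
  obtain ⟨μ, hμ, h⟩ := h
  refine ⟨μ, hμ, fun ψ hψ => ?_⟩
  rw [← h ψ hψ]
  exact integral_congr_ae (hfg.mono fun x hx => by simp only [hx])

lemma IsNonnegMomentum.integral_test_nonneg {u u' ψ : ℝ → ℝ} (h : IsNonnegMomentum u)
    (hu : IsH1 u u') (hψ : IsTest ψ) (h0 : ∀ x, 0 ≤ ψ x) :
    0 ≤ ∫ x, (u x * ψ x + u' x * deriv ψ x) := by
  obtain ⟨μ, -, h⟩ := h
  have h1 : 0 ≤ ∫ x, ψ x ∂μ := integral_nonneg h0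
  rw [← h ψ hψ] at h1
  have h2 := hu.integral_mul_deriv hψ.deriv.isH1
  have i1 := integrable_mul hu.memLp hψ.memLp
  have i2 := integrable_mul hu.memLp hψ.deriv.deriv.memLp
  rw [integral_add i1 (integrable_mul hu.memLp' hψ.deriv.memLp)]
  simp only [mul_sub] at h1
  rw [integral_sub i1 i2, h2] at h1
  linarith

lemma abs_normed_convolution_sub_le {g : ℝ → ℝ} {R δ ε : ℝ} (hg : Continuous g)
    (hR : ∀ x, R < |x| → g x = 0) (hδ : ∀ x y, |x - y| < δ → |g x - g y| ≤ ε)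
    (φ : ContDiffBump (0 : ℝ)) (hφ : φ.rOut ≤ min δ 1) (x : ℝ) :
    |convolution (φ.normed volume) g (ContinuousLinearMap.lsmul ℝ ℝ) volume x - g x| ≤
      (Set.Icc (-(R + 1)) (R + 1)).indicator (fun _ => ε) x := by
  rw [← Real.dist_eq]
  by_cases hx : x ∈ Set.Icc (-(R + 1)) (R + 1)
  · rw [Set.indicator_of_mem hx]
    refine ContDiffBump.dist_normed_convolution_le hg.aestronglyMeasurable fun y hy => ?_
    rw [Real.dist_eq]
    refine hδ y x ?_
    rw [Metric.mem_ball, Real.dist_eq] at hy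
    exact hy.trans_le (hφ.trans (min_le_left _ _))
  · rw [Set.indicator_of_notMem hx]
    have hx' : R + 1 < |x| := by
      by_contra hcon
      exact hx (abs_le.mp (not_lt.mp hcon))
    refine ContDiffBump.dist_normed_convolution_le hg.aestronglyMeasurable fun y hy => ?_
    rw [Metric.mem_ball, Real.dist_eq] at hy
    have h1 := hy.trans_le (hφ.trans (min_le_right _ _))
    have h2 := abs_sub_abs_le_abs_sub x y
    rw [abs_sub_comm] at h2
    rw [hR x (by linarith), hR y (by linarith), dist_self]

/-- A nonnegative `C¹` function of compact support is a limit in `C¹`, with controlled support, of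
nonnegative test functions. -/
lemma exists_isTest_approx {ζ ζ' : ℝ → ℝ} {R ε : ℝ} (hd : ∀ x, HasDerivAt ζ (ζ' x) x)
    (hc : Continuous ζ') (hR : ∀ x, R < |x| → ζ x = 0) (hR' : ∀ x, R < |x| → ζ' x = 0)
    (h0 : ∀ x, 0 ≤ ζ x) (hε : 0 < ε) : ∃ ψ, IsTest ψ ∧ (∀ x, 0 ≤ ψ x) ∧
      (∀ x, |ψ x - ζ x| ≤ (Set.Icc (-(R + 1)) (R + 1)).indicator (fun _ => ε) x) ∧
      ∀ x, |deriv ψ x - ζ' x| ≤ (Set.Icc (-(R + 1)) (R + 1)).indicator (fun _ => ε) x := by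
  have hζ : Continuous ζ := continuous_iff_continuousAt.mpr fun x => (hd x).continuousAt
  have hder : deriv ζ = ζ' := funext fun x => (hd x).deriv
  have hζ1 : ContDiff ℝ 1 ζ := contDiff_one_iff_deriv.mpr
    ⟨fun x => (hd x).differentiableAt, by rwa [hder]⟩
  have hsupp : ∀ {g : ℝ → ℝ}, (∀ x, R < |x| → g x = 0) → HasCompactSupport g := fun hg =>
    HasCompactSupport.of_support_subset_isCompact (isCompact_Icc (a := -R) (b := R)) fun x hx => by
      by_contra hcon
      refine hx (hg x ?_)
      by_contra h2
      exact hcon (abs_le.mp (not_lt.mp h2))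
  have huc : ∀ {g : ℝ → ℝ}, Continuous g → (∀ x, R < |x| → g x = 0) →
      ∃ δ > 0, ∀ x y, |x - y| < δ → |g x - g y| ≤ ε := fun hgc hg => by
    obtain ⟨δ, hδ, h⟩ := Metric.uniformContinuous_iff.mp
      ((hsupp hg).uniformContinuous_of_continuous hgc) ε hε
    exact ⟨δ, hδ, fun x y hxy => (h (a := x) (b := y) (by rwa [Real.dist_eq])).le⟩
  obtain ⟨δ, hδ, h1⟩ := huc hζ hR
  obtain ⟨δ', hδ', h1'⟩ := huc hc hR'
  have hr : 0 < min (min δ δ') 1 := lt_min (lt_min hδ hδ') one_pos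
  let φ : ContDiffBump (0 : ℝ) := ⟨min (min δ δ') 1 / 2, min (min δ δ') 1, half_pos hr,
      half_lt_self hr⟩
  have hφ : ContDiff ℝ ∞ (φ.normed volume) := φ.contDiff_normed
  have hconv : ∀ x, HasDerivAt
      (convolution (φ.normed volume) ζ (ContinuousLinearMap.lsmul ℝ ℝ) volume)
      (convolution (φ.normed volume) ζ' (ContinuousLinearMap.lsmul ℝ ℝ) volume x) x := fun x => by
    rw [← hder]
    exact (hsupp hR).hasDerivAt_convolution_right _ hφ.continuous.locallyIntegrable hζ1 x
  refine ⟨convolution (φ.normed volume) ζ (ContinuousLinearMap.lsmul ℝ ℝ) volume,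
    ⟨φ.hasCompactSupport_normed.contDiff_convolution_left _ hφ hζ.locallyIntegrable,
      φ.hasCompactSupport_normed.convolution _ (hsupp hR)⟩, fun x => ?_, fun x => ?_, fun x => ?_⟩
  · exact integral_nonneg fun t => mul_nonneg (φ.nonneg_normed t) (h0 _)
  · exact abs_normed_convolution_sub_le hζ hR h1 φ (min_le_min_right _ (min_le_left _ _)) x
  · rw [(hconv x).deriv]
    exact abs_normed_convolution_sub_le hc hR' h1' φ (min_le_min_right _ (min_le_right _ _)) x

lemma IsNonnegMomentum.integral_compactSupport_nonneg {u u' ζ ζ' : ℝ → ℝ} {R : ℝ}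
    (h : IsNonnegMomentum u) (hu : IsH1 u u') (hd : ∀ x, HasDerivAt ζ (ζ' x) x)
    (hc : Continuous ζ') (hR : ∀ x, R < |x| → ζ x = 0) (hR' : ∀ x, R < |x| → ζ' x = 0)
    (h0 : ∀ x, 0 ≤ ζ x) : 0 ≤ ∫ x, (u x * ζ x + u' x * ζ' x) := by
  set I := Set.Icc (-(R + 1)) (R + 1)
  set A := ∫ x in I, (|u x| + |u' x|)
  have hA : 0 ≤ A := integral_nonneg fun x => add_nonneg (abs_nonneg _) (abs_nonneg _)
  have l1 : IntegrableOn (fun x => |u x| + |u' x|) I :=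
    ((hu.memLp.locallyIntegrable (by norm_num)).integrableOn_isCompact isCompact_Icc).abs.add
      ((hu.memLp'.locallyIntegrable (by norm_num)).integrableOn_isCompact isCompact_Icc).abs
  have hζ : Continuous ζ := continuous_iff_continuousAt.mpr fun x => (hd x).continuousAt
  have hsupp : ∀ {g : ℝ → ℝ}, Continuous g → (∀ x, R < |x| → g x = 0) → MemLp g 2 volume :=
    fun hgc hg => hgc.memLp_of_hasCompactSupport
      (HasCompactSupport.of_support_subset_isCompact (isCompact_Icc (a := -R) (b := R))
        fun x hx => by
          by_contra hcon
          refine hx (hg x ?_)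
          by_contra h2
          exact hcon (abs_le.mp (not_lt.mp h2)))
  have key : ∀ ε, 0 < ε → -(ε * A) ≤ ∫ x, (u x * ζ x + u' x * ζ' x) := by
    intro ε hε
    obtain ⟨ψ, hψ, hψ0, e1, e2⟩ := exists_isTest_approx hd hc hR hR' h0 hε
    have h1 := h.integral_test_nonneg hu hψ hψ0
    have i1 : Integrable fun x => u x * ψ x + u' x * deriv ψ x :=
      (integrable_mul hu.memLp hψ.memLp).add (integrable_mul hu.memLp' hψ.deriv.memLp)
    have i2 : Integrable (I.indicator fun x => ε * (|u x| + |u' x|)) :=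
      (integrable_indicator_iff measurableSet_Icc).mpr (l1.const_mul ε)
    have i3 : Integrable fun x => u x * ζ x + u' x * ζ' x :=
      (integrable_mul hu.memLp (hsupp hζ hR)).add (integrable_mul hu.memLp' (hsupp hc hR'))
    have h2 : ∫ x, (u x * ψ x + u' x * deriv ψ x - I.indicator (fun x => ε * (|u x| + |u' x|)) x) ≤
        ∫ x, (u x * ζ x + u' x * ζ' x) := by
      refine integral_mono (i1.sub i2) i3 fun x => ?_
      have a1 : u x * (ψ x - ζ x) ≤ |u x| * I.indicator (fun _ => ε) x := (le_abs_self _).trans (by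
        rw [abs_mul]; exact mul_le_mul_of_nonneg_left (e1 x) (abs_nonneg _))
      have a2 : u' x * (deriv ψ x - ζ' x) ≤ |u' x| * I.indicator (fun _ => ε) x :=
        (le_abs_self _).trans (by
          rw [abs_mul]; exact mul_le_mul_of_nonneg_left (e2 x) (abs_nonneg _))
      have a3 : I.indicator (fun x => ε * (|u x| + |u' x|)) x =
          (|u x| + |u' x|) * I.indicator (fun _ => ε) x := by
        by_cases hx : x ∈ I
        · rw [Set.indicator_of_mem hx, Set.indicator_of_mem hx, mul_comm]
        · rw [Set.indicator_of_notMem hx, Set.indicator_of_notMem hx, mul_zero]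
      simp only [a3]
      linarith
    rw [integral_sub i1 i2, integral_indicator measurableSet_Icc, integral_const_mul] at h2
    linarith
  by_contra hneg
  have hX := not_le.mp hneg
  have hε : 0 < -(∫ x, (u x * ζ x + u' x * ζ' x)) / (A + 1) := div_pos (by linarith) (by linarith)
  have h1 := key _ hε
  have h2 : -(∫ x, (u x * ζ x + u' x * ζ' x)) / (A + 1) * (A + 1) =
      -(∫ x, (u x * ζ x + u' x * ζ' x)) := div_mul_cancel₀ _ (by linarith)
  linarith

/-- Pairing a function of nonnegative momentum in `H¹` with a nonnegative `C¹` function in `H¹`, by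
smooth cutoffs `φ (x / (n + 1))`. -/
lemma IsNonnegMomentum.integral_nonneg {u u' η η' : ℝ → ℝ} (h : IsNonnegMomentum u)
    (hu : IsH1 u u') (hη : IsH1 η η') (hc : Continuous η') (h0 : ∀ x, 0 ≤ η x) :
    0 ≤ ∫ x, (u x * η x + u' x * η' x) := by
  let φ : ContDiffBump (0 : ℝ) := ⟨1, 2, one_pos, one_lt_two⟩
  have hφ : IsTest φ := ⟨φ.contDiff, φ.hasCompactSupport⟩
  obtain ⟨C, hC0, hC⟩ := hφ.deriv.isH1.exists_bound
  have hφ1 : ∀ x, |φ x| ≤ 1 := fun x => by rw [abs_of_nonneg φ.nonneg]; exact φ.le_one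
  set s : ℕ → ℝ := fun n => 1 / ((n : ℝ) + 1)
  have hs0 : ∀ n, 0 < s n := fun n => by positivity
  have hs1 : ∀ n, s n ≤ 1 := fun n => by
    rw [div_le_one (by positivity)]; linarith [n.cast_nonneg (α := ℝ)]
  have hs : Tendsto s atTop (𝓝 0) := tendsto_one_div_add_atTop_nhds_zero_nat
  have hlarge : ∀ n x, 2 / s n < |x| → 2 < |s n * x| := fun n x hx => by
    rw [abs_mul, abs_of_pos (hs0 n), mul_comm]
    exact (div_lt_iff₀ (hs0 n)).mp hx
  have hφz : ∀ y, 2 < |y| → φ y = 0 := fun y hy => φ.zero_of_le_dist (by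
    rw [Real.dist_eq, sub_zero]; exact hy.le)
  have hφz' : ∀ y, 2 < |y| → deriv φ y = 0 := fun y hy => by
    by_contra hne
    have := support_deriv_subset (Function.mem_support.mpr hne)
    rw [φ.tsupport_eq, Metric.mem_closedBall, Real.dist_eq, sub_zero] at this
    exact absurd this (not_le.mpr hy)
  have hcη := hη.continuous
  have hpos : ∀ n, 0 ≤ ∫ x, (u x * (φ (s n * x) * η x) +
      u' x * (s n * deriv φ (s n * x) * η x + φ (s n * x) * η' x)) := fun n => by
    refine h.integral_compactSupport_nonneg (R := 2 / s n) hu (fun x => ?_) ?_ (fun x hx => ?_)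
      (fun x hx => ?_) fun x => mul_nonneg φ.nonneg (h0 x)
    · have h1 : HasDerivAt (fun x => s n * x) (s n) x := by
        simpa using (hasDerivAt_id x).const_mul (s n)
      have h2 := HasDerivAt.comp x (hφ.hasDerivAt (s n * x)) h1
      refine (h2.fun_mul (hη.toIsPrimitive.hasDerivAt hc x)).congr_deriv ?_
      simp only [Function.comp]; ring
    · have c1 := hφ.1.continuous
      have c2 := hφ.deriv.1.continuous
      fun_prop
    · rw [hφz _ (hlarge n x hx), zero_mul]
    · rw [hφz _ (hlarge n x hx), hφz' _ (hlarge n x hx)]; ring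
  refine ge_of_tendsto' (tendsto_integral_of_dominated_convergence
    (fun x => |u x * η x| + (C * |u' x * η x| + |u' x * η' x|)) (fun n => ?_) ?_
        (fun n => ?_) ?_) hpos
  · have c1 := hφ.1.continuous
    have c2 := hφ.deriv.1.continuous
    refine (hu.memLp.1.mul (Continuous.aestronglyMeasurable (by fun_prop))).add
      (hu.memLp'.1.mul (Continuous.aestronglyMeasurable (by fun_prop)))
  · exact (integrable_mul hu.memLp hη.memLp).abs.add
      (((integrable_mul hu.memLp' hη.memLp).abs.const_mul C).add
        (integrable_mul hu.memLp' hη.memLp').abs)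
  · refine Eventually.of_forall fun x => ?_
    have e : u x * (φ (s n * x) * η x) +
        u' x * (s n * deriv φ (s n * x) * η x + φ (s n * x) * η' x) =
        φ (s n * x) * (u x * η x) + ((s n * deriv φ (s n * x)) * (u' x * η x) +
          φ (s n * x) * (u' x * η' x)) := by ring
    rw [e, Real.norm_eq_abs]
    have a1 : ∀ y, |φ (s n * x) * y| ≤ |y| := fun y => by
      rw [abs_mul]; exact mul_le_of_le_one_left (abs_nonneg _) (hφ1 _)
    have a2 : |s n * deriv φ (s n * x) * (u' x * η x)| ≤ C * |u' x * η x| := by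
      rw [abs_mul, abs_mul, abs_of_pos (hs0 n)]
      refine mul_le_mul_of_nonneg_right ?_ (abs_nonneg _)
      calc s n * |deriv φ (s n * x)| ≤ 1 * C :=
            mul_le_mul (hs1 n) (hC _) (abs_nonneg _) zero_le_one
        _ = C := one_mul C
    exact (abs_add_le _ _).trans (add_le_add (a1 _)
      ((abs_add_le _ _).trans (add_le_add a2 (a1 _))))
  · refine Eventually.of_forall fun x => ?_
    have hsx : Tendsto (fun n => s n * x) atTop (𝓝 0) := by simpa using hs.mul_const x
    have t1 : Tendsto (fun n => φ (s n * x)) atTop (𝓝 1) := by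
      have := (hφ.1.continuous.tendsto 0).comp hsx
      rwa [φ.one_of_mem_closedBall (Metric.mem_closedBall_self φ.rIn_pos.le)] at this
    have t2 : Tendsto (fun n => s n * deriv φ (s n * x)) atTop (𝓝 0) := by
      simpa using hs.mul ((hφ.deriv.1.continuous.tendsto 0).comp hsx)
    have := ((t1.mul_const (η x)).const_mul (u x)).add
      (((t2.mul_const (η x)).add (t1.mul_const (η' x))).const_mul (u' x))
    simpa using this

/-- The convex cone in `L²(ℝ)` generated by the unit peakons. -/
noncomputable def peakonCone : PointedCone ℝ L2 :=
  PointedCone.hull ℝ (Set.range fun z : ℝ => toL2 fun x => peakon 1 (x - z))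

/-- A function of nonnegative momentum is a limit of nonnegative combinations of peakons: otherwise
a hyperplane `⟪·, g⟫ = 0` separates it from them, but nonnegativity of `g` on all peakons
means that `(1 - ∂ₓ²)⁻¹ g` is nonnegative. -/
lemma IsNonnegMomentum.toL2_mem_closure {u u' : ℝ → ℝ} (h : IsNonnegMomentum u)
    (hu : IsH1 u u') : toL2 u ∈ closure (peakonCone : Set L2) := by
  by_contra hcon
  let K : ProperCone ℝ L2 := ⟨peakonCone.closure, isClosed_closure⟩
  obtain ⟨y, hy, hneg⟩ := K.hyperplane_separation' (x₀ := toL2 u) hcon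
  have hyL := Lp.memLp y
  have hr := isResolvent_invHelmholtz one_pos hyL
  have hpos : ∀ z, 0 ≤ invHelmholtz 1 y z := fun z => by
    have h1 := hy (toL2 fun x => peakon 1 (x - z))
      (subset_closure (Submodule.subset_span ⟨z, rfl⟩))
    rw [← toL2_self y, inner_toL2 (isH1_peakon 1 z).memLp hyL, integral_peakon_mul] at h1
    linarith
  have h1 := h.integral_nonneg hu hr.left hr.right.continuous hpos
  rw [← toL2_self y, inner_toL2 hu.memLp hyL] at hneg
  have h2 := hr.integral_mul hyL hu
  rw [integral_add (integrable_mul hu.memLp hr.left.memLp)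
    (integrable_mul hu.memLp' hr.left.memLp')] at h1
  simp only [mul_comm (u _), mul_comm (u' _)] at h1 hneg
  linarith

/-- Nonnegative momentum is approximated in `L²` by multipeakons with distinct positions and
positive momenta. -/
lemma IsNonnegMomentum.exists_multipeakon_near {u u' : ℝ → ℝ} (h : IsNonnegMomentum u)
    (hu : IsH1 u u') {δ : ℝ} (hδ : 0 < δ) : ∃ (s : Finset ℝ) (q p : s → ℝ),
      Function.Injective q ∧ (∀ i, 0 < p i) ∧
      ‖toL2 u - toL2 fun x => ∑ i, peakon (p i) (x - q i)‖ < δ := by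
  obtain ⟨b, hb, hub⟩ := Metric.mem_closure_iff.mp (h.toL2_mem_closure hu) δ hδ
  obtain ⟨a, rfl⟩ := Finsupp.mem_span_range_iff_exists_finsupp.mp hb
  refine ⟨a.support, fun i => i, fun i => (a i : ℝ), Subtype.val_injective, fun i => ?_, ?_⟩
  · exact lt_of_le_of_ne (a i).2 fun h0 =>
      (Finsupp.mem_support_iff.mp i.2) (Subtype.ext h0.symm)
  · rw [dist_eq_norm] at hub
    convert! hub using 3
    rw [toL2_sum fun i => (isH1_peakon _ _).memLp, Finsupp.sum,
      ← Finset.sum_coe_sort a.support fun z => a z • toL2 fun x => peakon 1 (x - z)]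
    refine Finset.sum_congr rfl fun i _ => ?_
    change _ = (a i : ℝ) • toL2 fun x => peakon 1 (x - i)
    rw [← toL2_const_mul _ (isH1_peakon _ _).memLp]
    simp only [peakon, one_mul]

/-! ### Positivity is propagated by the flow -/

lemma toL2_le {f g : ℝ → ℝ} (hf : MemLp f 2 volume) (hg : MemLp g 2 volume) :
    toL2 f ≤ toL2 g ↔ f ≤ᵐ[volume] g := by
  rw [← Lp.coeFn_le]
  constructor
  · intro h
    filter_upwards [h, toL2_coe hf, toL2_coe hg] with x h1 h2 h3
    rwa [← h2, ← h3]
  · intro h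
    filter_upwards [h, toL2_coe hf, toL2_coe hg] with x h1 h2 h3
    rwa [h2, h3]

lemma le_of_ae_le_of_continuous {f g : ℝ → ℝ} (hf : Continuous f) (hg : Continuous g)
    (h : f ≤ᵐ[volume] g) (x : ℝ) : f x ≤ g x := by
  have h1 := (Measure.dense_of_ae h).closure_eq
  rw [(isClosed_le hf hg).closure_eq] at h1
  have h2 : x ∈ {x | f x ≤ g x} := h1 ▸ Set.mem_univ x
  exact h2

/-- The `f` in `L²` with `0 ≤ f ≤ 6 (4 - ∂ₓ²)⁻¹ f`, the pointwise bounds that nonnegative momentum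
gives. -/
def positivityCone : Set L2 := {F | 0 ≤ F ∧ F ≤ (6 : ℝ) • resolvent two_pos F}

lemma isClosed_positivityCone : IsClosed positivityCone :=
  (isClosed_le (f := fun _ : L2 => 0) (g := fun F => F) continuous_const continuous_id).inter
    (isClosed_le (f := fun F : L2 => F) (g := fun F => (6 : ℝ) • resolvent two_pos F)
      continuous_id ((resolvent two_pos).continuous.fun_const_smul 6))

lemma toL2_zero : toL2 (fun _ => 0) = 0 := by
  have := toL2_const_mul (f := fun _ => 0) 0 MemLp.zero'
  simpa using this

lemma toL2_mem_positivityCone {f f' : ℝ → ℝ} (hf : IsH1 f f') :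
    toL2 f ∈ positivityCone ↔ ∀ x, 0 ≤ f x ∧ f x ≤ 6 * invHelmholtz 2 f x := by
  have hv := (isResolvent_invHelmholtz two_pos hf.memLp).left
  have h6 := hv.const_mul 6
  rw [positivityCone, Set.mem_ofPred_eq, resolvent_toL2 two_pos hf.memLp,
    ← toL2_const_mul 6 hv.memLp, ← toL2_zero, toL2_le MemLp.zero' hf.memLp,
    toL2_le hf.memLp h6.memLp]
  exact ⟨fun h x => ⟨le_of_ae_le_of_continuous continuous_const hf.continuous h.1 x,
    le_of_ae_le_of_continuous hf.continuous h6.continuous h.2 x⟩,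
    fun h => ⟨Eventually.of_forall fun x => (h x).1, Eventually.of_forall fun x => (h x).2⟩⟩

lemma toL2_peakon_mem_positivityCone {c : ℝ} (hc : 0 ≤ c) (z : ℝ) :
    toL2 (fun x => peakon c (x - z)) ∈ positivityCone := by
  refine (toL2_mem_positivityCone (isH1_peakon c z)).mpr fun x =>
    ⟨mul_nonneg hc (Real.exp_pos _).le, ?_⟩
  rw [invHelmholtz_peakon, peakon_eq]
  have h1 : Real.exp (-2 * |x - z|) ≤ Real.exp (-1 * |x - z|) :=
    Real.exp_le_exp.mpr (by linarith [abs_nonneg (x - z)])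
  nlinarith

lemma toL2_multipeakon_mem_positivityCone {ι : Type*} [Fintype ι] {p : ι → ℝ} (hp : ∀ i, 0 ≤ p i)
    (q : ι → ℝ) : toL2 (fun x => ∑ i, peakon (p i) (x - q i)) ∈ positivityCone := by
  have h := fun i => toL2_peakon_mem_positivityCone (hp i) (q i)
  rw [toL2_sum fun i => (isH1_peakon _ _).memLp]
  refine ⟨Finset.sum_nonneg fun i _ => (h i).1, ?_⟩
  rw [map_sum, Finset.smul_sum]
  exact Finset.sum_le_sum fun i _ => (h i).2

/-- A strong solution of nonnegative initial momentum satisfies `0 ≤ u ≤ 6 (4 - ∂ₓ²)⁻¹ u`,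
being a limit of multipeakons with positive momenta. The stability constant depends only on the
Lipschitz constant `K` of `u`, not on that of the approximations. -/
lemma IsStrongSolution.nonneg_and_le {τ : ℝ} (hτ : 0 ≤ τ) {u ux : ℝ → ℝ → ℝ}
    (hu : IsStrongSolution τ u ux) {K : ℝ} (hK0 : 0 ≤ K)
    (hK : ∀ t ∈ Set.Icc 0 τ, ∀ᵐ x, |ux t x| ≤ K) (h : IsNonnegMomentum (u 0)) :
    ∀ t ∈ Set.Icc 0 τ, ∀ x, 0 ≤ u t x ∧ u t x ≤ 6 * invHelmholtz 2 (u t) x := by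
  intro t ht
  have h0 : (0 : ℝ) ∈ Set.Icc 0 τ := ⟨le_rfl, hτ⟩
  rw [← toL2_mem_positivityCone (hu.isH1 t ht), ← isClosed_positivityCone.closure_eq]
  refine Metric.mem_closure_iff.mpr fun ε hε => ?_
  -- `E f ≤ ∫ f² ≤ 4 E f`, so `L²` distances grow at most by this factor up to time `t`
  set L := 2 * Real.exp (2 * K * t)
  have hL : 0 < L := by positivity
  obtain ⟨s, q₀, p₀, hq₀, hp₀, hnear⟩ :=
    h.exists_multipeakon_near (hu.isH1 0 h0) (div_pos hε hL)
  obtain ⟨q, p, rfl, rfl, hqp⟩ := exists_multipeakon hτ hq₀ hp₀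
  have hw := isStrongSolution_multipeakon hτ (fun t ht => (hqp t ht).2.1)
    fun t ht => (hqp t ht).2.2
  refine ⟨_, toL2_multipeakon_mem_positivityCone (hqp t ht).1 (q t), ?_⟩
  have m0 := (hu.isH1 0 h0).sub (hw.isH1 0 h0)
  have mt := (hu.isH1 t ht).sub (hw.isH1 t ht)
  have h1 := hu.energy_sub_le hw hK0 hK t ht
  have h2 := integral_sq_le_energy mt.memLp
  have h3 := energy_le_integral_sq m0.memLp
  rw [← norm_toL2_sq m0.memLp, toL2_sub (hu.isH1 0 h0).memLp (hw.isH1 0 h0).memLp] at h3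
  rw [← norm_toL2_sq mt.memLp, toL2_sub (hu.isH1 t ht).memLp (hw.isH1 t ht).memLp] at h2
  rw [dist_eq_norm]
  refine lt_of_pow_lt_pow_left₀ 2 hε.le ?_
  rw [lt_div_iff₀ hL] at hnear
  have h4 := mul_le_mul_of_nonneg_left h3 (Real.exp_pos (4 * K * t)).le
  have h5 : L ^ 2 = 4 * Real.exp (4 * K * t) := by
    rw [mul_pow, ← Real.exp_nat_mul]; push_cast; ring_nf
  have h6 := pow_lt_pow_left₀ hnear (by positivity) two_ne_zero
  rw [mul_pow, h5] at h6
  linarith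

end DP

theorem theorem3p1 (c : ℝ) (hc : 0 < c) :
    ∃ C : ℝ, 0 < C ∧ ∃ ε₀ : ℝ, 0 < ε₀ ∧
      ∀ (T : EReal) (u : ℝ → ℝ → ℝ), 0 < T → DP.MemX T u → DP.IsWeakSolution T u →
        DP.IsNonnegMomentum (u 0) →
        ∀ ε : ℝ, 0 < ε → ε < ε₀ →
          DP.energyNorm (fun x => u 0 x - DP.peakon c x) ≤ ε ^ 2 →
          ∀ t : ℝ, 0 ≤ t → (t : EReal) < T →
            (∃ ξ : ℝ, IsMaxOn (DP.invHelmholtz 2 (u t)) Set.univ ξ) ∧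
            ∀ ξ : ℝ, IsMaxOn (DP.invHelmholtz 2 (u t)) Set.univ ξ →
              DP.energyNorm (fun x => u t x - DP.peakon c (x - ξ)) ≤ C * Real.sqrt ε := by
  obtain ⟨C, hC, hstab⟩ := DP.static_stability hc
  refine ⟨C, hC, 1, one_pos, fun T u _ hX hw hm ε hε hε1 hnear t ht htT => ?_⟩
  -- `w` is the continuous representative of `u` on `[0, t]`; nothing in the claim sees the choice
  obtain ⟨w, wx, hs, hwu, K, hK0, hK⟩ := DP.exists_isStrongSolution hX hw ht htT
  have h0 : (0 : ℝ) ∈ Set.Icc 0 t := ⟨le_rfl, ht⟩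
  have htt : t ∈ Set.Icc 0 t := ⟨ht, le_rfl⟩
  have hpos := hs.nonneg_and_le ht hK0 hK (hm.congr (hwu 0 h0).symm)
  have hcongr : ∀ r ∈ Set.Icc 0 t, ∀ ξ, DP.energyNorm (fun x => u r x - DP.peakon c (x - ξ)) =
      DP.energyNorm (fun x => w r x - DP.peakon c (x - ξ)) := fun r hr ξ =>
    congrArg Real.sqrt (DP.energy_congr ((hwu r hr).symm.mono fun x hx => by simp only [hx]))
  have hnear' : DP.energyNorm (fun x => w 0 x - DP.peakon c x) ≤ ε ^ 2 := by
    have := hcongr 0 h0 0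
    simp only [sub_zero] at this
    rwa [← this]
  rw [← DP.invHelmholtz_congr (hwu t htt)]
  refine ⟨DP.exists_isMaxOn (DP.isResolvent_invHelmholtz two_pos (hs.isH1 t htt).memLp).left
    fun x => DP.invHelmholtz_nonneg two_pos (Eventually.of_forall fun x => (hpos t htt x).1) x,
    fun ξ hξ => ?_⟩
  rw [hcongr t htt]
  exact hstab (w 0) (wx 0) (w t) (wx t) (hs.isH1 0 h0) (fun x => (hpos 0 h0 x).1)
    (fun x => (hpos 0 h0 x).2) (hs.isH1 t htt) (fun x => (hpos t htt x).1)
    (fun x => (hpos t htt x).2) (hs.energy_eq t htt)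
        (hs.integral_cube_eq t htt) ε hε hε1 hnear' ξ hξ
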